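/- Let $T,\nu,\varepsilon>0$ and consider the one-dimensional isothermal Navier--Stokes--Poisson system in Lagrangian mass coordinates $$v_t-u_y=0,\qquad u_t+\Big(\frac Tv\Big)_y=\Big(\frac{\nu u_y}{v}\Big)_y-\frac{\phi_y}{v},\qquad -\varepsilon^2\Big(\frac{\phi_y}{v}\Big)_y=1-ve^{\phi}.$$ Let $v_->0$ and $u_-\in\mathbb R$. Given $(v_+,u_+,s)$ with $v_+>v_-$, $s>0$, and the Rankine--Hugoniot relations $$-s(v_+-v_-)-(u_+-u_-)=0,\qquad -s(u_+-u_-)+(T+1)\Big(\frac1{v_+}-\frac1{v_-}\Big)=0,$$ a shock profile is a smooth solution $(\bar v,\bar u,\bar\phi)(x)$, $x=y-st\in\mathbb R$, with $\bar v>0$, of $$-s\bar v_x-\bar u_x=0,\qquad -s\bar u_x+\Big(\frac T{\bar v}\Big)_x=\Big(\frac{\nu\bar u_x}{\bar v}\Big)_x-\frac{\bar\phi_x}{\bar v},\qquad -\varepsilon^2\Big(\frac{\bar\phi_x}{\bar v}\Big)_x=1-\bar ve^{\bar\phi},$$ $$\lim_{x\to\pm\infty}(\bar v,\bar u,\bar\phi)(x)=(v_\pm,u_\pm,-\ln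 v_\pm).$$ The linearized operator about the profile is the operator $L$ on $L^2(\mathbb R;\mathbb C)\times L^2(\mathbb R;\mathbb C)$ with domain $H^1(\mathbb R)\times H^2(\mathbb R)$ given, for $U=(v,u)^{\mathrm{tr}}$, by $$LU=\big(AU+BU_x+D\,(\phi,0)^{\mathrm{tr}}_x+E\,(\phi,0)^{\mathrm{tr}}_{xx}\big)_x,$$ with the derivative of the sum in the sense of distributions, where $$A=\begin{pmatrix}s&1\\ \frac{T+1}{\bar v^2}-\frac{\nu\bar u_x}{\bar v^2}-\frac{\varepsilon^2\bar\phi_x^2}{\bar v^3}+\frac{\varepsilon^2}{\bar v}\big(\frac{\bar\phi_x}{\bar v^2}\big)_x+\frac{\varepsilon^2}{\bar v^2}\big(\frac{\bar\phi_x}{\bar v}\big)_x&s\end{pmatrix},\quad B=\begin{pmatrix}0&0\\ \frac{\varepsilon^2\bar\phi_x}{\bar v^3}&\frac\nu{\bar v}\end{pmatrix},$$ $$D=\begin{pmatrix}0&0\\ \frac{\varepsilon^2\bar\phi_x}{\bar v^2}+\frac{\varepsilon^2\bar v_x}{\bar v^3}&0\end{pmatrix},\quad E=\begin{pmatrix}0&0\\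 -\frac{\varepsilon^2}{\bar v^2}&0\end{pmatrix},$$ and $\phi\in H^2(\mathbb R)$ is the solution of the linearized Poisson equation $$\bar ve^{\bar\phi}\phi+\frac{\varepsilon^2\bar v_x}{\bar v^2}\phi_x-\frac{\varepsilon^2}{\bar v}\phi_{xx}=\Big(-e^{\bar\phi}-\frac{\varepsilon^2\bar\phi_{xx}}{\bar v^2}+\frac{2\varepsilon^2\bar v_x\bar\phi_x}{\bar v^3}\Big)v-\frac{\varepsilon^2\bar\phi_x}{\bar v^2}v_x .$$ Then there exists $\delta_1>0$, depending only on $T,\nu,\varepsilon,v_-,u_-$, such that for all $(v_+,u_+,s)$ as above with $|v_+-v_-|<\delta_1$ and every shock profile $(\bar v,\bar u,\bar\phi)$ connecting $(v_-,u_-,-\ln v_-)$ to $(v_+,u_+,-\ln v_+)$, the operator $L$ has no eigenvalue in $\Omega:=\{\lambda\in\mathbb C:\operatorname{Re}\lambda\ge0\}\setminus\{0\}$; in particular $$\sigma_{\mathrm{pt}}(L)\subset\mathbb C\setminus\Omega,$$ where $\sigma_{\mathrm{pt}}(L)$ is the set of all $\lambda\in\mathbb C$ for which $L-\lambda I$ is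 Fredholm of index zero but not invertible. -/

import Mathlib

open MeasureTheory Filter Topology
open scoped ContDiff

noncomputable section

namespace NSP

/-! ### Shock profiles -/

/-- The Rankine--Hugoniot relations between the far-field states `(vm, um)`, `(vp, up)` (at `-∞` and
`+∞`) and the shock speed `s`. -/
def RankineHugoniot (T s vm um vp up : ℝ) : Prop :=
  -s * (vp - vm) - (up - um) = 0 ∧ -s * (up - um) + (T + 1) * (1 / vp - 1 / vm) = 0

/-- `(v, u, φ)` is a shock profile: a smooth solution, with positive specific volume `v`, of the
travelling-wave equations of the Navier--Stokes--Poisson system with speed `s`, connecting the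
quasi-neutral far-field states `(vm, um, -ln vm)` and `(vp, up, -ln vp)`. -/
structure IsShockProfile (T ν ε s vm um vp up : ℝ) (v u φ : ℝ → ℝ) : Prop where
  smooth_v : ContDiff ℝ ∞ v
  smooth_u : ContDiff ℝ ∞ u
  smooth_φ : ContDiff ℝ ∞ φ
  v_pos : ∀ x, 0 < v x
  mass : ∀ x, -s * deriv v x - deriv u x = 0
  momentum : ∀ x, -s * deriv u x + deriv (fun y => T / v y) x
    = deriv (fun y => ν * deriv u y / v y) x - deriv φ x / v x
  poisson : ∀ x, -ε ^ 2 * deriv (fun y => deriv φ y / v y) x = 1 - v x * Real.exp (φ x)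
  v_bot : Tendsto v atBot (𝓝 vm)
  u_bot : Tendsto u atBot (𝓝 um)
  φ_bot : Tendsto φ atBot (𝓝 (-Real.log vm))
  v_top : Tendsto v atTop (𝓝 vp)
  u_top : Tendsto u atTop (𝓝 up)
  φ_top : Tendsto φ atTop (𝓝 (-Real.log vp))

/-! ### Function spaces -/

/-- The complex space `L²(ℝ)`. -/
abbrev L2 : Type := Lp ℂ 2 (volume : Measure ℝ)

/-- The state space `L²(ℝ) × L²(ℝ)`; its elements are `U = (v, u)`. -/
abbrev State : Type := L2 × L2

/-- `g` is the weak (distributional) derivative of `f` on `ℝ`. -/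
def HasWeakDeriv (f g : ℝ → ℂ) : Prop :=
  LocallyIntegrable f volume ∧ LocallyIntegrable g volume ∧
    ∀ η : ℝ → ℝ, ContDiff ℝ ∞ η → HasCompactSupport η →
      ∫ x, deriv η x • f x = -∫ x, η x • g x

theorem integrable_test {η : ℝ → ℝ} {f : ℝ → ℂ} (hf : LocallyIntegrable f volume)
    (hη : Continuous η) (hc : HasCompactSupport η) : Integrable (fun x => η x • f x) volume :=
  hf.integrable_smul_left_of_hasCompactSupport hη hc

theorem integrable_test_deriv {η : ℝ → ℝ} {f : ℝ → ℂ} (hf : LocallyIntegrable f volume)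
    (hη : ContDiff ℝ ∞ η) (hc : HasCompactSupport η) :
    Integrable (fun x => deriv η x • f x) volume :=
  integrable_test hf (hη.continuous_deriv (by simp)) hc.deriv

theorem HasWeakDeriv.congr {f g f' g' : ℝ → ℂ} (h : HasWeakDeriv f g)
    (hf : f =ᵐ[volume] f') (hg : g =ᵐ[volume] g') : HasWeakDeriv f' g' := by
  obtain ⟨h1, h2, h3⟩ := h
  refine ⟨h1.congr hf, h2.congr hg, fun η hη hc => ?_⟩
  have e1 : ∫ x, deriv η x • f' x = ∫ x, deriv η x • f x :=
    integral_congr_ae (by filter_upwards [hf] with x hx; rw [hx])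
  have e2 : ∫ x, η x • g' x = ∫ x, η x • g x :=
    integral_congr_ae (by filter_upwards [hg] with x hx; rw [hx])
  rw [e1, e2, h3 η hη hc]

theorem HasWeakDeriv.zero : HasWeakDeriv (fun _ => 0) (fun _ => 0) :=
  ⟨locallyIntegrable_const 0, locallyIntegrable_const 0, fun η _ _ => by simp⟩

theorem HasWeakDeriv.add {f g f' g' : ℝ → ℂ} (h : HasWeakDeriv f g) (h' : HasWeakDeriv f' g') :
    HasWeakDeriv (fun x => f x + f' x) (fun x => g x + g' x) := by
  obtain ⟨h1, h2, h3⟩ := h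
  obtain ⟨k1, k2, k3⟩ := h'
  refine ⟨h1.add k1, h2.add k2, fun η hη hc => ?_⟩
  simp only [smul_add]
  rw [integral_add (integrable_test_deriv h1 hη hc) (integrable_test_deriv k1 hη hc),
    integral_add (integrable_test h2 hη.continuous hc) (integrable_test k2 hη.continuous hc),
    h3 η hη hc, k3 η hη hc]
  ring

theorem HasWeakDeriv.const_mul {f g : ℝ → ℂ} (h : HasWeakDeriv f g) (c : ℂ) :
    HasWeakDeriv (fun x => c * f x) (fun x => c * g x) := by
  obtain ⟨h1, h2, h3⟩ := h
  refine ⟨h1.smul c, h2.smul c, fun η hη hc => ?_⟩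
  have e := h3 η hη hc
  have e1 : ∀ x, deriv η x • (c * f x) = c * (deriv η x • f x) := fun x => by
    rw [mul_smul_comm]
  have e2 : ∀ x, η x • (c * g x) = c * (η x • g x) := fun x => by
    rw [mul_smul_comm]
  simp only [e1, e2, integral_const_mul, e, mul_neg]

/-! ### Coefficients of the linearized operator

The profile is `(v, u, φ)`. The coefficient matrices are
`A = (s, 1; a21, s)`, `B = (0, 0; b21, b22)`, `D = (0, 0; d21, 0)`, `E = (0, 0; e21, 0)`. -/

/-- Lower left entry of `A`. -/
def a21 (T ν ε : ℝ) (v u φ : ℝ → ℝ) (x : ℝ) : ℝ :=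
  (T + 1) / v x ^ 2 - ν * deriv u x / v x ^ 2 - ε ^ 2 * deriv φ x ^ 2 / v x ^ 3
    + ε ^ 2 / v x * deriv (fun y => deriv φ y / v y ^ 2) x
    + ε ^ 2 / v x ^ 2 * deriv (fun y => deriv φ y / v y) x

/-- Lower left entry of `B`. -/
def b21 (ε : ℝ) (v φ : ℝ → ℝ) (x : ℝ) : ℝ := ε ^ 2 * deriv φ x / v x ^ 3

/-- Lower right entry of `B`. -/
def b22 (ν : ℝ) (v : ℝ → ℝ) (x : ℝ) : ℝ := ν / v x

/-- Lower left entry of `D`. -/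
def d21 (ε : ℝ) (v φ : ℝ → ℝ) (x : ℝ) : ℝ :=
  ε ^ 2 * deriv φ x / v x ^ 2 + ε ^ 2 * deriv v x / v x ^ 3

/-- Lower left entry of `E`. -/
def e21 (ε : ℝ) (v : ℝ → ℝ) (x : ℝ) : ℝ := -ε ^ 2 / v x ^ 2

/-- The operator `𝒜 = v e^φ + (ε² v'/v²) ∂ₓ - (ε²/v) ∂ₓₓ` of the linearized Poisson equation, applied
to a function with zeroth, first and second derivative `p`, `p'`, `p''`. -/
def poissonA (ε : ℝ) (v φ : ℝ → ℝ) (p p' p'' : ℝ → ℂ) (x : ℝ) : ℂ :=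
  ((v x * Real.exp (φ x) : ℝ) : ℂ) * p x + ((ε ^ 2 * deriv v x / v x ^ 2 : ℝ) : ℂ) * p' x
    - ((ε ^ 2 / v x : ℝ) : ℂ) * p'' x

/-- The operator `ℬ = -e^φ - ε² φ''/v² + 2 ε² v' φ'/v³ - (ε² φ'/v²) ∂ₓ` of the linearized Poisson
equation, applied to a function with zeroth and first derivative `w`, `w'`. -/
def poissonB (ε : ℝ) (v φ : ℝ → ℝ) (w w' : ℝ → ℂ) (x : ℝ) : ℂ :=
  ((-Real.exp (φ x) - ε ^ 2 * deriv (deriv φ) x / v x ^ 2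
      + 2 * ε ^ 2 * deriv v x * deriv φ x / v x ^ 3 : ℝ) : ℂ) * w x
    - ((ε ^ 2 * deriv φ x / v x ^ 2 : ℝ) : ℂ) * w' x

/-- The second component of the flux `A U + B Uₓ + D pₓ + E pₓₓ`, where `U = (w, z)` and `p` is the
perturbation of the potential. (The first component is `s w + z`.) -/
def flux2 (T ν ε s : ℝ) (v u φ : ℝ → ℝ) (w w' z z' p' p'' : ℝ → ℂ) (x : ℝ) : ℂ :=
  (a21 T ν ε v u φ x : ℂ) * w x + (s : ℂ) * z x
    + (b21 ε v φ x : ℂ) * w' x + (b22 ν v x : ℂ) * z' x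
    + (d21 ε v φ x : ℂ) * p' x + (e21 ε v x : ℂ) * p'' x

/-- `L U = F`, for the linearized operator
`L U = (A U)ₓ + (B Uₓ)ₓ + (D (𝒜⁻¹ℬ U)ₓ)ₓ + (E (𝒜⁻¹ℬ U)ₓₓ)ₓ` with domain `H¹(ℝ) × H²(ℝ)`:
`U = (w, z)` with `w ∈ H¹`, `z ∈ H²`, the function `p = 𝒜⁻¹ℬ w` is the solution in `H²` of
`𝒜 p = ℬ w`, and `F` is the distributional derivative of the total flux. (The singular parts of
`(B Uₓ)ₓ` and `(E pₓₓ)ₓ` cancel, so the derivative is taken of the sum.) -/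
def LinearizedEq (T ν ε s : ℝ) (v u φ : ℝ → ℝ) (U F : State) : Prop :=
  ∃ w' z' z'' p p' p'' : L2,
    HasWeakDeriv U.1 w' ∧ HasWeakDeriv U.2 z' ∧ HasWeakDeriv z' z'' ∧
    HasWeakDeriv p p' ∧ HasWeakDeriv p' p'' ∧
    (∀ᵐ x ∂(volume : Measure ℝ), poissonA ε v φ p p' p'' x = poissonB ε v φ U.1 w' x) ∧
    HasWeakDeriv (fun x => (s : ℂ) * U.1 x + U.2 x) F.1 ∧
    HasWeakDeriv (flux2 T ν ε s v u φ U.1 w' U.2 z' p' p'') F.2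

/-- The linearized operator `L` about the profile `(v, u, φ)`, as an unbounded operator on
`L²(ℝ) × L²(ℝ)` given by its graph, the set of all pairs `(U, L U)`. -/
def linearizedOp (T ν ε s : ℝ) (v u φ : ℝ → ℝ) : Submodule ℂ (State × State) where
  carrier := {q | LinearizedEq T ν ε s v u φ q.1 q.2}
  zero_mem' := by
    have hz : (fun _ => (0 : ℂ)) =ᵐ[volume] ((0 : L2) : ℝ → ℂ) := (Lp.coeFn_zero ℂ 2 volume).symm
    have h0 : HasWeakDeriv ((0 : L2) : ℝ → ℂ) ((0 : L2) : ℝ → ℂ) := HasWeakDeriv.zero.congr hz hz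
    refine ⟨0, 0, 0, 0, 0, 0, h0, h0, h0, h0, h0, ?_, ?_, ?_⟩
    · filter_upwards [hz] with x hx
      simp [poissonA, poissonB]
    · refine HasWeakDeriv.zero.congr ?_ hz
      filter_upwards [hz] with x hx
      simp
    · refine HasWeakDeriv.zero.congr ?_ hz
      filter_upwards [hz] with x hx
      simp [flux2]
  add_mem' := by
    rintro ⟨⟨w, z⟩, ⟨f, g⟩⟩ ⟨⟨W, Z⟩, ⟨F, G⟩⟩ ⟨w', z', z'', p, p', p'', h1, h2, h3, h4, h5, h6, h7, h8⟩
      ⟨W', Z', Z'', P, P', P'', k1, k2, k3, k4, k5, k6, k7, k8⟩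
    have hadd : ∀ a b : L2, (fun x => a x + b x) =ᵐ[volume] ((a + b : L2) : ℝ → ℂ) :=
      fun a b => (Lp.coeFn_add a b).symm
    refine ⟨w' + W', z' + Z', z'' + Z'', p + P, p' + P', p'' + P'',
      (h1.add k1).congr (hadd _ _) (hadd _ _), (h2.add k2).congr (hadd _ _) (hadd _ _),
      (h3.add k3).congr (hadd _ _) (hadd _ _), (h4.add k4).congr (hadd _ _) (hadd _ _),
      (h5.add k5).congr (hadd _ _) (hadd _ _), ?_, (h7.add k7).congr ?_ (hadd _ _),
      (h8.add k8).congr ?_ (hadd _ _)⟩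
    · filter_upwards [h6, k6, hadd w W, hadd w' W', hadd p P, hadd p' P', hadd p'' P'']
        with x e1 e2 a1 a2 a3 a4 a5
      simp only [poissonA, poissonB, Prod.fst_add, ← a1, ← a2, ← a3, ← a4, ← a5] at e1 e2 ⊢
      linear_combination e1 + e2
    · filter_upwards [hadd w W, hadd z Z] with x a1 a2
      simp only [Prod.fst_add, Prod.snd_add, ← a1, ← a2]
      ring
    · filter_upwards [hadd w W, hadd w' W', hadd z Z, hadd z' Z', hadd p' P', hadd p'' P'']
        with x a1 a2 a3 a4 a5 a6
      simp only [flux2, Prod.fst_add, Prod.snd_add, ← a1, ← a2, ← a3, ← a4, ← a5, ← a6]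
      ring
  smul_mem' := by
    rintro c ⟨⟨w, z⟩, ⟨f, g⟩⟩ ⟨w', z', z'', p, p', p'', h1, h2, h3, h4, h5, h6, h7, h8⟩
    have hsm : ∀ a : L2, (fun x => c * a x) =ᵐ[volume] ((c • a : L2) : ℝ → ℂ) :=
      fun a => (Lp.coeFn_smul c a).symm
    refine ⟨c • w', c • z', c • z'', c • p, c • p', c • p'',
      (h1.const_mul c).congr (hsm _) (hsm _), (h2.const_mul c).congr (hsm _) (hsm _),
      (h3.const_mul c).congr (hsm _) (hsm _), (h4.const_mul c).congr (hsm _) (hsm _),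
      (h5.const_mul c).congr (hsm _) (hsm _), ?_, (h7.const_mul c).congr ?_ (hsm _),
      (h8.const_mul c).congr ?_ (hsm _)⟩
    · filter_upwards [h6, hsm w, hsm w', hsm p, hsm p', hsm p''] with x e1 a1 a2 a3 a4 a5
      simp only [poissonA, poissonB, Prod.smul_fst, ← a1, ← a2, ← a3, ← a4, ← a5] at e1 ⊢
      linear_combination c * e1
    · filter_upwards [hsm w, hsm z] with x a1 a2
      simp only [Prod.smul_fst, Prod.smul_snd, ← a1, ← a2]
      ring
    · filter_upwards [hsm w, hsm w', hsm z, hsm z', hsm p', hsm p''] with x a1 a2 a3 a4 a5 a6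
      simp only [flux2, Prod.smul_fst, Prod.smul_snd, ← a1, ← a2, ← a3, ← a4, ← a5, ← a6]
      ring

/-! ### Eigenvalues and point spectrum of an operator given by its graph -/

section Spectrum

variable {X : Type*} [NormedAddCommGroup X] [NormedSpace ℂ X]

/-- The kernel of `G - lam`. -/
def eigenspace (G : Submodule ℂ (X × X)) (lam : ℂ) : Submodule ℂ X :=
  G.comap (LinearMap.prod LinearMap.id (lam • LinearMap.id))

/-- The range of `G - lam`. -/
def shiftRange (G : Submodule ℂ (X × X)) (lam : ℂ) : Submodule ℂ X :=
  G.map (LinearMap.snd ℂ X X - lam • LinearMap.fst ℂ X X)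

/-- `lam` is an eigenvalue: there is `U ≠ 0` in the domain with `G U = lam U`. -/
def IsEigenvalue (G : Submodule ℂ (X × X)) (lam : ℂ) : Prop :=
  ∃ U : X, U ≠ 0 ∧ (U, lam • U) ∈ G

/-- `G - lam` is Fredholm of index zero. -/
def IsFredholmIndexZero (G : Submodule ℂ (X × X)) (lam : ℂ) : Prop :=
  FiniteDimensional ℂ (eigenspace G lam) ∧ IsClosed (shiftRange G lam : Set X) ∧
    FiniteDimensional ℂ (X ⧸ shiftRange G lam) ∧
    Module.finrank ℂ (eigenspace G lam) = Module.finrank ℂ (X ⧸ shiftRange G lam)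

/-- The point spectrum of a closed operator: all `lam` for which `G - lam` is Fredholm of index zero
but not invertible (the essential spectrum being the rest of the spectrum). -/
def pointSpectrum (G : Submodule ℂ (X × X)) : Set ℂ :=
  {lam | IsFredholmIndexZero G lam ∧ ¬ (eigenspace G lam = ⊥ ∧ shiftRange G lam = ⊤)}

end Spectrum

/-- The deleted closed right half-plane. -/
def unstableHalfPlane : Set ℂ := {lam | 0 ≤ lam.re} \ {0}

end NSP

end

noncomputable section

namespace NSP

/-! The operator is in conservation form, so for `lam ≠ 0` an eigenfunction `(w, z)` is the
derivative of the decaying pair `(V, U)` = flux / `lam`. The integrated system is far better suited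
to energy estimates. With `φ` and `θ` the perturbations of the potential and of the field, it is a
first order ODE system (`EigenSystem`) over the profile equations (`ProfileSystem`).

Pair the integrated mass equation with `V` and the momentum equation with `(v²/j) U`, the weight
that makes the coupling `w U + V z` an exact derivative. Viscosity gives `|z|²`, and the derivative
of the weight gives `y |U|²`, with `y = v'/v > 0` because a small shock is monotone. All other
coefficients are `O(y)`, since they vanish for a constant profile. Three further identities are
added: `volumeQ` yields dissipation of `w`, `φ`, `θ`; `poissonQ` applied to `lam (V, φ, θ)` controls
`|lam θ|²` uniformly in `lam`; and `2 Re lam` times `poissonQ` with weight `ε²/j` turns the terms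
carrying `Re lam` into a nonnegative form. The sum `totalQ` has derivative at least `c (|z|² +
|w|²)` (`total_rate_lower`) and vanishes at both ends, hence `w = z = 0` (`eigenSystem_trivial`).

This needs every profile of small amplitude to be near the constant state, increasing, and with `|E|
≤ C y`; nothing of the sort is assumed. An entropy that is monotone along the profile has total
variation tending to zero with the amplitude. With maximum principles it bounds `v`, the deviation
`φ + log v` from neutrality, and `y` (`Connects.near_const`). Near the constant state the profile
equations have one expanding, one contracting and one slow direction; invariant cones show that an
orbit decaying at both ends is governed by the slow variable `y`, which gives `|E| ≤ (2/m) |y|`. A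
zero of `y` would then force a constant profile (`Connects.abs_field_le`). -/

/-- The real inner product `Re (a * conj b)` on `ℂ`. -/
def ip (a b : ℂ) : ℝ := a.re * b.re + a.im * b.im

theorem hasDerivAt_re {f : ℝ → ℂ} {f' : ℂ} {x : ℝ} (hf : HasDerivAt f f' x) :
    HasDerivAt (fun t => (f t).re) f'.re x :=
  Complex.reCLM.hasFDerivAt.comp_hasDerivAt x hf

theorem hasDerivAt_im {f : ℝ → ℂ} {f' : ℂ} {x : ℝ} (hf : HasDerivAt f f' x) :
    HasDerivAt (fun t => (f t).im) f'.im x :=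
  Complex.imCLM.hasFDerivAt.comp_hasDerivAt x hf

theorem hasDerivAt_ip {f g : ℝ → ℂ} {f' g' : ℂ} {x : ℝ} (hf : HasDerivAt f f' x)
    (hg : HasDerivAt g g' x) :
    HasDerivAt (fun t => ip (f t) (g t)) (ip f' (g x) + ip (f x) g') x := by
  unfold ip
  have h := ((hasDerivAt_re hf).mul (hasDerivAt_re hg)).add
    ((hasDerivAt_im hf).mul (hasDerivAt_im hg))
  refine h.congr_deriv ?_
  ring

theorem ip_self (a : ℂ) : ip a a = ‖a‖ ^ 2 := by
  rw [← Complex.normSq_eq_norm_sq, Complex.normSq_apply]; rfl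

theorem abs_ip_le (a b : ℂ) : |ip a b| ≤ ‖a‖ * ‖b‖ := by
  have h : ip a b = (a * (starRingEnd ℂ) b).re := by simp [ip]
  rw [h]
  refine (Complex.abs_re_le_norm _).trans ?_
  simp

/-! ### Profile and integrated eigenvalue problem as first order systems. -/

/-- The travelling-wave equations as an autonomous system for the specific volume `v`, the
logarithmic slope `y = v' / v`, the electric field `E = φ' / v` and the electron density
`n = exp φ`. -/
structure ProfileSystem (T ν ε s : ℝ) (v y E n : ℝ → ℝ) : Prop where
  v_pos : ∀ x, 0 < v x
  n_pos : ∀ x, 0 < n x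
  hv : ∀ x, HasDerivAt v (v x * y x) x
  hy : ∀ x, HasDerivAt y (-((s ^ 2 * v x - T / v x) * y x + E x) / (s * ν)) x
  hE : ∀ x, HasDerivAt E ((v x * n x - 1) / ε ^ 2) x
  hn : ∀ x, HasDerivAt n (v x * E x * n x) x

/-- The viscous stress perturbation, as given by the integrated momentum equation. -/
def stress (T ν ε s v y E n : ℝ) (lam U z w φ θ : ℂ) : ℂ :=
  lam * U - s * z - ((T + s * ν * v * y) / v ^ 2 : ℝ) * w + (n : ℝ) * φ - (ε ^ 2 * E : ℝ) * θ

/-- The integrated eigenvalue system as a first order system for the antiderivatives `V`, `U`, the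
velocity `z`, the potential `φ` and the field `θ`, with `w = V'` the specific volume. -/
structure EigenSystem (T ν ε s : ℝ) (v y E n : ℝ → ℝ) (lam : ℂ) (V U w z φ θ : ℝ → ℂ) : Prop where
  hw : ∀ x, lam * V x = s * w x + z x
  hV : ∀ x, HasDerivAt V (w x) x
  hU : ∀ x, HasDerivAt U (z x) x
  hz : ∀ x, HasDerivAt z ((v x / ν : ℝ) *
    stress T ν ε s (v x) (y x) (E x) (n x) lam (U x) (z x) (w x) (φ x) (θ x)) x
  hφ : ∀ x, HasDerivAt φ ((v x : ℝ) * θ x + (E x : ℝ) * w x) x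
  hθ : ∀ x, HasDerivAt θ ((n x / ε ^ 2 : ℝ) * (w x + (v x : ℝ) * φ x)) x

/-! ### The energy identity of the linearized Poisson equation. -/

section PoissonIdentity

variable {T ν ε s : ℝ} {v y E n : ℝ → ℝ} {V w φ θ : ℝ → ℂ} {γ : ℝ → ℝ} {γ' : ℝ}

/-- Potential of the identity expressing that the linearized field operator is symmetric and
nonnegative up to terms that vanish for a constant profile. -/
def poissonQ (ε E n γ : ℝ) (V φ θ : ℂ) : ℝ :=
  γ * ip φ ((ε ^ 2 / n : ℝ) * θ - V) - γ * E * ε ^ 4 / n ^ 2 / 2 * ip θ θ + γ * E / 2 * ip V V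

/-- The derivative of `poissonQ`. -/
def poissonRate (ε v E n γ γ' : ℝ) (V φ θ : ℂ) : ℝ :=
  γ * v * (ε ^ 2 / n * ip θ θ + ip φ φ) - γ * v * ip θ V
  + γ' * (ε ^ 2 / n * ip φ θ - ip φ V)
  - 2 * γ * ε ^ 2 * v * E / n * ip φ θ
  - (γ' * E + γ * ((v * n - 1) / ε ^ 2) - 2 * γ * E * (v * E))
  * (ε ^ 4 / n ^ 2 / 2) * ip θ θ
  + (γ' * E + γ * ((v * n - 1) / ε ^ 2)) / 2 * ip V V

/-- By the Poisson equation `w = (ε²/n) θ' - v φ`, so `(ε²/n) θ - V` has derivative `v φ` up to a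
multiple of `E θ`. Pairing it with `φ`, where `φ' = v θ + E w`, creates the positive form in `φ` and
`θ`. The products `E w θ` and `E w V` left over are exact derivatives up to lower order, which is
the role of the last two terms of `poissonQ`; hence no `w` survives in the rate. -/
theorem hasDerivAt_poissonQ (hε : 0 < ε) (hP : ProfileSystem T ν ε s v y E n) {x : ℝ}
    (hγ : HasDerivAt γ γ' x)
    (hV : HasDerivAt V (w x) x)
    (hφ : HasDerivAt φ ((v x : ℝ) * θ x + (E x : ℝ) * w x) x)
    (hθ : HasDerivAt θ ((n x / ε ^ 2 : ℝ) * (w x + (v x : ℝ) * φ x)) x) :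
    HasDerivAt (fun t => poissonQ ε (E t) (n t) (γ t) (V t) (φ t) (θ t))
      (poissonRate ε (v x) (E x) (n x) (γ x) γ' (V x) (φ x) (θ x)) x := by
  have hn0 := (hP.n_pos x).ne'
  have hE := hP.hE x
  have hn := hP.hn x
  have hN : HasDerivAt (fun t => ((ε ^ 2 / n t : ℝ) : ℂ))
      ((-(ε ^ 2 * v x * E x / n x) : ℝ) : ℂ) x := by
    have := ((hasDerivAt_const x (ε ^ 2)).div hn hn0).ofReal_comp
    refine this.congr_deriv ?_
    congr 1
    field_simp
    ring
  have h1 := hγ.mul (hasDerivAt_ip hφ ((hN.mul hθ).sub hV))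
  have h2 := (((((hγ.mul hE).mul_const (ε ^ 4)).div (hn.pow 2) (pow_ne_zero 2 hn0)).div_const 2).mul
    (hasDerivAt_ip hθ hθ))
  have h3 := ((hγ.mul hE).div_const 2).mul (hasDerivAt_ip hV hV)
  unfold poissonQ poissonRate
  refine ((h1.sub h2).add h3).congr_deriv ?_
  simp only [ip, Complex.add_re, Complex.add_im, Complex.sub_re, Complex.sub_im, Complex.mul_re,
    Complex.mul_im, Complex.ofReal_re, Complex.ofReal_im, Pi.mul_apply, Pi.pow_apply, Pi.sub_apply, Pi.div_apply]
  field_simp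
  ring

end PoissonIdentity

/-! ### Energy identities for the integrated system. -/

section EnergyIdentities

variable {T ν ε s : ℝ} {v y E n : ℝ → ℝ} {lam : ℂ} {V U w z φ θ : ℝ → ℂ}

/-- The quantity `v² k`, with `k` the coefficient of the specific volume in the integrated momentum
equation. -/
def stiff (T ν s v y n : ℝ) : ℝ := T + v * (s * ν * y + n)

/-- The derivative of `stiff` along the profile. -/
def stiffDeriv (T ν s v y E n : ℝ) : ℝ :=
  v * y * (s * ν * y + n - s ^ 2 * v + T / v) + v * E * (v * n - 1)

theorem hasDerivAt_stiff (hs : 0 < s) (hν : 0 < ν) (hP : ProfileSystem T ν ε s v y E n) (x : ℝ) :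
    HasDerivAt (fun t => stiff T ν s (v t) (y t) (n t))
      (stiffDeriv T ν s (v x) (y x) (E x) (n x)) x := by
  have hv0 := (hP.v_pos x).ne'
  unfold stiff stiffDeriv
  refine (((hP.hv x).mul (((hP.hy x).const_mul (s * ν)).add (hP.hn x))).const_add T).congr_deriv ?_
  simp only [Pi.add_apply]
  field_simp
  ring

/-- The main energy functional. -/
def energyQ (ε s ν v n j : ℝ) (lam V U z φ θ : ℂ) : ℝ :=
  s / 2 * ip V V + ip U V + s / 2 * (v ^ 2 / j) * ip U U + ν * v / j * ip z U
    - ε ^ 2 * v / j * ip θ U - ε ^ 2 * v / j * s * ε ^ 2 / (2 * n) * ip θ θ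
    + ε ^ 2 * v / j * s / 2 * ip φ φ
    - ε ^ 2 / j * ip φ (lam * ((ε ^ 2 / n : ℝ) * θ - V))

/-- The derivative of `energyQ`. -/
def energyRate (T ν ε s v y E n : ℝ) (lam V U w z φ θ : ℂ) : ℝ :=
  let j := stiff T ν s v y n
  let j' := stiffDeriv T ν s v y E n
  lam.re * (ip V V + v ^ 2 / j * ip U U
  - ε ^ 2 * v / j * (ε ^ 2 / n * ip θ θ + ip φ φ))
  + s / 2 * (2 * v ^ 2 * y / j - v ^ 2 * j' / j ^ 2) * ip U U
  + ν * v / j * ip z z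
  + ν * (v * y / j - v * j' / j ^ 2) * ip z U
  - ε ^ 2 * (v * y / j - v * j' / j ^ 2 + v ^ 2 * E / j) * ip θ U
  - s * ε ^ 4 / 2 * (v * y / j - v * j' / j ^ 2 - v ^ 2 * E / j) / n
  * ip θ θ
  + s * ε ^ 2 / 2 * (v * y / j - v * j' / j ^ 2) * ip φ φ
  + ε ^ 2 * v / j * s * E * ip w φ
  + ε ^ 2 * j' / j ^ 2 * ip φ (lam * ((ε ^ 2 / n : ℝ) * θ - V))
  + ε ^ 4 * v * E / (j * n) * ip φ (lam * θ)
  - ε ^ 2 * E / j * ip w (lam * ((ε ^ 2 / n : ℝ) * θ - V))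

/-- The Poisson equation gives `n φ = (ε² θ' - n w)/v`, so the momentum equation contains `w` with
coefficient `j/v²`. Testing it with `(v²/j) U` and the mass equation with `V` makes the coupling
equal to `(U V)'`. The remaining term `(ε² v/j) θ' U` is integrated by parts; then `z = lam V - s w`
and the Poisson equation reduce it to quadratic terms in `φ` and `θ` with factor `Re lam`, plus
terms with small coefficients. -/
theorem hasDerivAt_energyQ (hε : 0 < ε) (hs : 0 < s) (hν : 0 < ν)
    (hP : ProfileSystem T ν ε s v y E n)
    (hL : EigenSystem T ν ε s v y E n lam V U w z φ θ)
    {x : ℝ} (hj0 : 0 < stiff T ν s (v x) (y x) (n x)) :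
    HasDerivAt (fun t => energyQ ε s ν (v t) (n t) (stiff T ν s (v t) (y t) (n t)) lam
        (V t) (U t) (z t) (φ t) (θ t))
      (energyRate T ν ε s (v x) (y x) (E x) (n x) lam (V x) (U x) (w x) (z x) (φ x) (θ x)) x := by
  have hn0 := (hP.n_pos x).ne'
  have hv0 := (hP.v_pos x).ne'
  have hE := hP.hE x
  have hn := hP.hn x
  have hv := hP.hv x
  have hJ := hasDerivAt_stiff hs hν hP x
  obtain ⟨j, hj⟩ : ∃ j, stiff T ν s (v x) (y x) (n x) = j := ⟨_, rfl⟩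
  obtain ⟨j', hj'⟩ : ∃ j', stiffDeriv T ν s (v x) (y x) (E x) (n x) = j' := ⟨_, rfl⟩
  rw [hj'] at hJ
  have hN : HasDerivAt (fun t => ((ε ^ 2 / n t : ℝ) : ℂ))
      ((-(ε ^ 2 * v x * E x / n x) : ℝ) : ℂ) x := by
    have := ((hasDerivAt_const x (ε ^ 2)).div hn hn0).ofReal_comp
    refine this.congr_deriv ?_
    congr 1
    field_simp
    ring
  have hV := hL.hV x
  have hU := hL.hU x
  have hz := hL.hz x
  have hφ := hL.hφ x
  have hθ := hL.hθ x
  have hz0 : z x = lam * V x - s * w x := by rw [hL.hw x]; ring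
  have hvj := hv.div hJ hj0.ne'
  have h1 := (hasDerivAt_ip hV hV).const_mul (s / 2)
  have h2 := hasDerivAt_ip hU hV
  have h3 := (((hv.pow 2).div hJ hj0.ne').const_mul (s / 2)).mul (hasDerivAt_ip hU hU)
  have h4 := ((hv.const_mul ν).div hJ hj0.ne').mul (hasDerivAt_ip hz hU)
  have h5 := ((hv.const_mul (ε ^ 2)).div hJ hj0.ne').mul (hasDerivAt_ip hθ hU)
  have h6 := (((((hv.const_mul (ε ^ 2)).div hJ hj0.ne').mul_const s).mul_const (ε ^ 2)).div
    (hn.const_mul 2) (by positivity)).mul (hasDerivAt_ip hθ hθ)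
  have h7 := ((((hv.const_mul (ε ^ 2)).div hJ hj0.ne').mul_const s).div_const 2).mul
    (hasDerivAt_ip hφ hφ)
  have h8 := ((hasDerivAt_const x (ε ^ 2)).div hJ hj0.ne').mul
    (hasDerivAt_ip hφ (((hN.mul hθ).sub hV).const_mul lam))
  unfold energyQ energyRate
  rw [hj, hj']
  refine (((((((h1.add h2).add h3).add h4).sub h5).sub h6).add h7).sub h8).congr_deriv ?_
  simp only [Pi.mul_apply, Pi.pow_apply, Pi.sub_apply, Pi.div_apply, hj, hz0, stress]
  rw [hj] at hj0
  have hT : T + s * ν * v x * y x = j - v x * n x := by rw [← hj]; unfold stiff; ring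
  rw [hT]
  simp only [ip, Complex.add_re, Complex.add_im, Complex.sub_re, Complex.sub_im, Complex.mul_re,
    Complex.mul_im, Complex.ofReal_re, Complex.ofReal_im]
  clear hj hj' hT hV hU hz hφ hθ h1 h2 h3 h4 h5 h6 h7 h8 hvj hJ hN hE hn hv hL hP hz0
  generalize v x = v, y x = y, E x = E, n x = n, (V x).re = V1, (V x).im = V2, (U x).re = U1,
    (U x).im = U2, (w x).re = w1, (w x).im = w2, (φ x).re = f1, (φ x).im = f2, (θ x).re = t1,
    (θ x).im = t2, lam.re = l1, lam.im = l2 at *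
  field_simp
  ring

/-- The functional giving the dissipation of the specific volume and of the potential. -/
def volumeQ (ε s ν v : ℝ) (lam V U w φ θ : ℂ) : ℝ :=
  ip (lam * U) V + s * lam.re * ip V V + s * ν / (2 * v) * ip w w + ε ^ 2 * ip φ θ

/-- The derivative of `volumeQ`. -/
def volumeRate (T ν ε s v y E n : ℝ) (lam V w z φ θ : ℂ) : ℝ :=
  (T / v ^ 2 + s * ν * y / (2 * v)) * ip w w
  + ν / v * lam.re * ip w w + ε ^ 2 * v * ip θ θ
  + n * v * ip φ φ + 2 * ε ^ 2 * E * ip θ w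
  + 2 * lam.re ^ 2 * ip V V - ip z z

/-- The momentum equation is tested with `w`, and `z' = lam w - s w'` makes the viscous term exact
up to `Re lam |w|²` and a multiple of `y |w|²`. Since `n φ w = ε² φ θ' - n v |φ|²`, the electric
force contributes dissipation of `φ` and `θ`. Moving `lam U w` onto `V` costs `-|z|²`, which the
viscosity in `energyRate` pays for. -/
theorem hasDerivAt_volumeQ (hε : 0 < ε) (hs : 0 < s) (hν : 0 < ν)
    (hP : ProfileSystem T ν ε s v y E n)
    (hL : EigenSystem T ν ε s v y E n lam V U w z φ θ) (x : ℝ) :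
    HasDerivAt (fun t => volumeQ ε s ν (v t) lam (V t) (U t) (w t) (φ t) (θ t))
      (volumeRate T ν ε s (v x) (y x) (E x) (n x) lam (V x) (w x) (z x) (φ x) (θ x)) x := by
  have hv0 := (hP.v_pos x).ne'
  have hV := hL.hV x
  have hU := hL.hU x
  have hz := hL.hz x
  have hφ := hL.hφ x
  have hθ := hL.hθ x
  have hz0 : z x = lam * V x - s * w x := by rw [hL.hw x]; ring
  have hw : HasDerivAt w ((lam * w x - (v x / ν : ℝ) * stress T ν ε s (v x) (y x) (E x) (n x) lam
      (U x) (z x) (w x) (φ x) (θ x)) / s) x := by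
    have h := ((hV.const_mul lam).sub hz).div_const (s : ℂ)
    have hs' : (s : ℂ) ≠ 0 := by exact_mod_cast hs.ne'
    -- `EigenSystem` gives `w` no differential equation; its derivative comes from the algebraic
    -- mass equation.
    have : w = fun t => (lam * V t - z t) / s := by
      funext t; rw [hL.hw t]; field_simp; ring
    rw [this]
    refine h.congr_deriv ?_
    rw [← this]
  have h1 := hasDerivAt_ip (hU.const_mul lam) hV
  have h2 := (hasDerivAt_ip hV hV).const_mul (s * lam.re)
  have h3 := ((hasDerivAt_const x (s * ν)).div ((hP.hv x).const_mul 2) (by positivity)).mul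
    (hasDerivAt_ip hw hw)
  have h4 := (hasDerivAt_ip hφ hθ).const_mul (ε ^ 2)
  unfold volumeQ volumeRate
  refine (((h1.add h2).add h3).add h4).congr_deriv ?_
  simp only [Pi.div_apply, stress, hz0]
  simp only [ip, Complex.add_re, Complex.add_im, Complex.sub_re, Complex.sub_im, Complex.mul_re,
    Complex.mul_im, Complex.ofReal_re, Complex.ofReal_im, Complex.div_ofReal_re,
    Complex.div_ofReal_im]
  clear hw hV hU hz hφ hθ h1 h2 h3 h4 hL hP hz0
  generalize v x = v, y x = y, E x = E, n x = n, (V x).re = V1, (V x).im = V2, (U x).re = U1,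
    (U x).im = U2, (w x).re = w1, (w x).im = w2, (φ x).re = f1, (φ x).im = f2, (θ x).re = t1,
    (θ x).im = t2, lam.re = l1, lam.im = l2 at *
  field_simp
  ring

end EnergyIdentities

/-! ### Coefficient estimates near the constant state. -/

theorem le_mul_ip {c k : ℝ} (h : |c| ≤ k) (a b : ℂ) : -(k * (‖a‖ * ‖b‖)) ≤ c * ip a b := by
  have h1 : |c * ip a b| ≤ k * (‖a‖ * ‖b‖) := by
    rw [abs_mul]
    exact mul_le_mul h (abs_ip_le a b) (abs_nonneg _) ((abs_nonneg c).trans h)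
  linarith [neg_abs_le (c * ip a b)]

theorem mul_ip_le {c k : ℝ} (h : |c| ≤ k) (a b : ℂ) : c * ip a b ≤ k * (‖a‖ * ‖b‖) := by
  have h1 := le_mul_ip (c := -c) ((abs_neg c).trans_le h) a b
  linarith

/-- Values of `(s, v, y, E, n)`: the shock speed and a point of the phase space of the profile. -/
abbrev Coef : Type := ℝ × ℝ × ℝ × ℝ × ℝ

/-- Points near the constant state `p₀` with positive slope `y` dominating the field `E`. -/
def nearConst (p₀ : Coef) (C : ℝ) : Filter Coef :=
  𝓝 p₀ ⊓ 𝓟 {p | 0 < p.2.2.1 ∧ |p.2.2.2.1| ≤ C * p.2.2.1}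

theorem nearConst_slope (p₀ : Coef) (C : ℝ) :
    ∀ᶠ p in nearConst p₀ C, 0 < p.2.2.1 ∧ |p.2.2.2.1| ≤ C * p.2.2.1 :=
  mem_inf_of_right (mem_principal_self _)

theorem eventually_nearConst {p₀ : Coef} {C : ℝ} {P : Coef → Prop} (h : ∀ᶠ p in 𝓝 p₀, P p) :
    ∀ᶠ p in nearConst p₀ C, P p :=
  mem_inf_of_left h

theorem eventually_bound {p₀ : Coef} {c : Coef → ℝ} (h : ContinuousAt c p₀) :
    ∀ᶠ K in atTop, ∀ᶠ p in 𝓝 p₀, |c p| ≤ K := by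
  filter_upwards [eventually_ge_atTop (|c p₀| + 1)] with K hK
  filter_upwards [h.abs.eventually (gt_mem_nhds (lt_add_one |c p₀|))] with p hp
  linarith

/-- Coefficients that vanish for a constant profile are bounded by the slope of the profile. -/
theorem eventually_bound_slope {p₀ : Coef} {C : ℝ} {c c₁ c₂ : Coef → ℝ} (h₁ : ContinuousAt c₁ p₀)
    (h₂ : ContinuousAt c₂ p₀) (hc : ∀ p, c p = p.2.2.1 * c₁ p + p.2.2.2.1 * c₂ p) :
    ∀ᶠ K in atTop, ∀ᶠ p in nearConst p₀ C, |c p| ≤ K * p.2.2.1 := by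
  obtain ⟨K₁, hK₁⟩ := (eventually_bound h₁).exists
  obtain ⟨K₂, hK₂⟩ := (eventually_bound h₂).exists
  filter_upwards [eventually_ge_atTop (K₁ + C * K₂)] with K hK
  filter_upwards [nearConst_slope p₀ C, eventually_nearConst hK₁, eventually_nearConst hK₂]
    with p hp h1 h2
  rw [hc]
  have e1 : |p.2.2.1 * c₁ p| ≤ p.2.2.1 * K₁ := by
    rw [abs_mul, abs_of_pos hp.1]
    exact mul_le_mul_of_nonneg_left h1 hp.1.le
  have e2 : |p.2.2.2.1 * c₂ p| ≤ C * p.2.2.1 * K₂ := by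
    rw [abs_mul]
    exact mul_le_mul hp.2 h2 (abs_nonneg _) ((abs_nonneg _).trans hp.2)
  have e3 := abs_add_le (p.2.2.1 * c₁ p) (p.2.2.2.1 * c₂ p)
  nlinarith [mul_le_mul_of_nonneg_right hK hp.1.le]

/-! ### Lower bounds for the rates. -/

section Bounds

variable {T ν ε m s₀ C : ℝ}

/-- The constant state `v = m`, `y = E = 0`, `n = 1 / m` moving with the speed `s₀`. -/
def constState (m s₀ : ℝ) : Coef := (s₀, m, 0, 0, 1 / m)

/-- All these coefficients are linear in `(y, E)` with continuous factors, and `|E| ≤ C y`. The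
first must moreover be positive: `j'` is `y J₁ + E J₂`, and both factors vanish at the constant
state, so only the derivative of `v²` counts there, and it has the sign of `y`. The condition `1 ≤ K
* c` serves `scaled_young`. -/
theorem energyRate_coeff_bounds (hT : 0 < T) (hm : 0 < m) (hs₀ : 0 < s₀)
    (hson : s₀ ^ 2 * m ^ 2 = T + 1) :
    ∃ K, 1 ≤ K ∧ ∃ c, 0 < c ∧ 1 ≤ K * c ∧ ∀ᶠ p in nearConst (constState m s₀) C, ∀ s v y E n,
      p = (s, v, y, E, n) → ∀ j j', stiff T ν s v y n = j → stiffDeriv T ν s v y E n = j' →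
      c * y ≤ s / 2 * (2 * v ^ 2 * y / j - v ^ 2 * j' / j ^ 2) ∧
      |ν * (v * y / j - v * j' / j ^ 2)| ≤ K * y ∧
      |ε ^ 2 * (v * y / j - v * j' / j ^ 2 + v ^ 2 * E / j)| ≤ K * y ∧
      |s * ε ^ 4 / 2 * (v * y / j - v * j' / j ^ 2 - v ^ 2 * E / j) / n| ≤ K * y ∧
      |s * ε ^ 2 / 2 * (v * y / j - v * j' / j ^ 2)| ≤ K * y ∧
      |ε ^ 2 * v / j * s * E| ≤ K * y ∧
      |ε ^ 2 * j' / j ^ 2| ≤ K * y ∧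
      |ε ^ 4 * v * E / (j * n)| ≤ K * y ∧
      |ε ^ 2 * E / j| ≤ K * y ∧
      |ε ^ 2 / n| ≤ K ∧ |s| ≤ K := by
  set J : Coef → ℝ := fun p => stiff T ν p.1 p.2.1 p.2.2.1 p.2.2.2.2 with hJ
  set J₁ : Coef → ℝ := fun p =>
    p.2.1 * (p.1 * ν * p.2.2.1 + p.2.2.2.2 - p.1 ^ 2 * p.2.1 + T / p.2.1) with hJ₁
  set J₂ : Coef → ℝ := fun p => p.2.1 * (p.2.1 * p.2.2.2.2 - 1) with hJ₂
  have v0 : (constState m s₀).2.1 ≠ 0 := hm.ne'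
  have n0 : (constState m s₀).2.2.2.2 ≠ 0 := (one_div_pos.2 hm).ne'
  have j0 : J (constState m s₀) = T + 1 := by
    simp [hJ, constState, stiff, hm.ne']
  have j0' : J (constState m s₀) ≠ 0 := by rw [j0]; positivity
  have cJ : ContinuousAt J (constState m s₀) := by
    simp only [hJ, stiff]; fun_prop
  have cJ₁ : ContinuousAt J₁ (constState m s₀) := by
    simp only [hJ₁]; fun_prop (disch := assumption)
  have cJ₂ : ContinuousAt J₂ (constState m s₀) := by
    simp only [hJ₂]; fun_prop
  have hsd : ∀ p : Coef, stiffDeriv T ν p.1 p.2.1 p.2.2.1 p.2.2.2.1 p.2.2.2.2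
      = p.2.2.1 * J₁ p + p.2.2.2.1 * J₂ p := fun p => by
    simp only [hJ₁, hJ₂, stiffDeriv]; ring
  -- Here the sonic condition `s₀² m² = T + 1` enters.
  have z₁ : J₁ (constState m s₀) = 0 := by
    simp only [hJ₁, constState]; field_simp; linarith
  have z₂ : J₂ (constState m s₀) = 0 := by
    simp only [hJ₂, constState]; field_simp; ring
  have hstiff : ∀ p : Coef, stiff T ν p.1 p.2.1 p.2.2.1 p.2.2.2.2 = J p := fun p => rfl
  clear_value J J₁ J₂
  -- Half the limiting value of the coefficient of `y`.
  set c : ℝ := s₀ * m ^ 2 / (2 * (T + 1)) with hc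
  have hcpos : 0 < c := by positivity
  -- The subtracted term is the worst contribution of `E` under `|E| ≤ C y`; it vanishes in the
  -- limit.
  have b1 : ∀ᶠ p in 𝓝 (constState m s₀),
      c < p.1 / 2 * (2 * p.2.1 ^ 2 / J p - p.2.1 ^ 2 * J₁ p / J p ^ 2)
        - |C| * |p.1 / 2 * (p.2.1 ^ 2 * J₂ p / J p ^ 2)| := by
    have hcont : ContinuousAt (fun p : Coef =>
        p.1 / 2 * (2 * p.2.1 ^ 2 / J p - p.2.1 ^ 2 * J₁ p / J p ^ 2)
        - |C| * |p.1 / 2 * (p.2.1 ^ 2 * J₂ p / J p ^ 2)|) (constState m s₀) := by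
      have j0'' := pow_ne_zero 2 j0'
      fun_prop (disch := assumption)
    refine hcont.eventually (lt_mem_nhds ?_)
    beta_reduce
    rw [z₁, z₂, j0]
    simp only [constState, hc]
    simp
    rw [div_mul_div_comm, div_lt_div_iff₀ (by positivity) (by positivity)]
    have : 0 < s₀ * m ^ 2 * (T + 1) := by positivity
    nlinarith
  have j02 := pow_ne_zero 2 j0'
  have jn := mul_ne_zero j0' n0
  have c2 := eventually_bound_slope (p₀ := constState m s₀) (C := C)
    (c := fun p => ν * (p.2.1 * p.2.2.1 / J p
      - p.2.1 * (p.2.2.1 * J₁ p + p.2.2.2.1 * J₂ p) / J p ^ 2))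
    (c₁ := fun p => ν * (p.2.1 / J p - p.2.1 * J₁ p / J p ^ 2))
    (c₂ := fun p => ν * (- p.2.1 * J₂ p / J p ^ 2)) (by fun_prop (disch := assumption))
    (by fun_prop (disch := assumption)) (fun p => by ring)
  have c3 := eventually_bound_slope (p₀ := constState m s₀) (C := C)
    (c := fun p => ε ^ 2 * (p.2.1 * p.2.2.1 / J p
      - p.2.1 * (p.2.2.1 * J₁ p + p.2.2.2.1 * J₂ p) / J p ^ 2 + p.2.1 ^ 2 * p.2.2.2.1 / J p))
    (c₁ := fun p => ε ^ 2 * (p.2.1 / J p - p.2.1 * J₁ p / J p ^ 2))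
    (c₂ := fun p => ε ^ 2 * (- p.2.1 * J₂ p / J p ^ 2 + p.2.1 ^ 2 / J p))
    (by fun_prop (disch := assumption)) (by fun_prop (disch := assumption)) (fun p => by ring)
  have c4 := eventually_bound_slope (p₀ := constState m s₀) (C := C)
    (c := fun p => p.1 * ε ^ 4 / 2 * (p.2.1 * p.2.2.1 / J p
      - p.2.1 * (p.2.2.1 * J₁ p + p.2.2.2.1 * J₂ p) / J p ^ 2
      - p.2.1 ^ 2 * p.2.2.2.1 / J p) / p.2.2.2.2)
    (c₁ := fun p => p.1 * ε ^ 4 / 2 * (p.2.1 / J p - p.2.1 * J₁ p / J p ^ 2) / p.2.2.2.2)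
    (c₂ := fun p => p.1 * ε ^ 4 / 2 * (- p.2.1 * J₂ p / J p ^ 2 - p.2.1 ^ 2 / J p) / p.2.2.2.2)
    (by fun_prop (disch := assumption)) (by fun_prop (disch := assumption)) (fun p => by ring)
  have c5 := eventually_bound_slope (p₀ := constState m s₀) (C := C)
    (c := fun p => p.1 * ε ^ 2 / 2 * (p.2.1 * p.2.2.1 / J p
      - p.2.1 * (p.2.2.1 * J₁ p + p.2.2.2.1 * J₂ p) / J p ^ 2))
    (c₁ := fun p => p.1 * ε ^ 2 / 2 * (p.2.1 / J p - p.2.1 * J₁ p / J p ^ 2))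
    (c₂ := fun p => p.1 * ε ^ 2 / 2 * (- p.2.1 * J₂ p / J p ^ 2))
    (by fun_prop (disch := assumption)) (by fun_prop (disch := assumption)) (fun p => by ring)
  have c6 := eventually_bound_slope (p₀ := constState m s₀) (C := C)
    (c := fun p => ε ^ 2 * p.2.1 / J p * p.1 * p.2.2.2.1)
    (c₁ := fun _ => 0) (c₂ := fun p => ε ^ 2 * p.2.1 / J p * p.1)
    (by fun_prop (disch := assumption)) (by fun_prop (disch := assumption)) (fun p => by ring)
  have c7 := eventually_bound_slope (p₀ := constState m s₀) (C := C)
    (c := fun p => ε ^ 2 * (p.2.2.1 * J₁ p + p.2.2.2.1 * J₂ p) / J p ^ 2)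
    (c₁ := fun p => ε ^ 2 * J₁ p / J p ^ 2) (c₂ := fun p => ε ^ 2 * J₂ p / J p ^ 2)
    (by fun_prop (disch := assumption)) (by fun_prop (disch := assumption)) (fun p => by ring)
  have c8 := eventually_bound_slope (p₀ := constState m s₀) (C := C)
    (c := fun p => ε ^ 4 * p.2.1 * p.2.2.2.1 / (J p * p.2.2.2.2))
    (c₁ := fun _ => 0) (c₂ := fun p => ε ^ 4 * p.2.1 / (J p * p.2.2.2.2))
    (by fun_prop (disch := assumption)) (by fun_prop (disch := assumption)) (fun p => by ring)
  have c9 := eventually_bound_slope (p₀ := constState m s₀) (C := C)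
    (c := fun p => ε ^ 2 * p.2.2.2.1 / J p)
    (c₁ := fun _ => 0) (c₂ := fun p => ε ^ 2 / J p)
    (by fun_prop (disch := assumption)) (by fun_prop (disch := assumption)) (fun p => by ring)
  have c10 := eventually_bound (p₀ := constState m s₀) (c := fun p => ε ^ 2 / p.2.2.2.2)
    (by fun_prop (disch := assumption))
  have c11 := eventually_bound (p₀ := constState m s₀) (c := fun p => p.1) (by fun_prop)
  obtain ⟨K, k1, kc, k2, k3, k4, k5, k6, k7, k8, k9, k10, k11⟩ :=
    ((eventually_ge_atTop (1 : ℝ)).and ((eventually_ge_atTop (1 / c)).and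
    (c2.and (c3.and (c4.and (c5.and (c6.and (c7.and (c8.and (c9.and (c10.and c11)))))))))
    )).exists
  refine ⟨K, k1, c, hcpos, ?_, ?_⟩
  · rwa [div_le_iff₀ hcpos] at kc
  filter_upwards [nearConst_slope _ C, eventually_nearConst b1, k2, k3, k4, k5, k6, k7, k8, k9,
    eventually_nearConst k10, eventually_nearConst k11] with p hp q1 q2 q3 q4 q5 q6 q7 q8 q9 q10 q11
  rintro s v y E n rfl j j' hj hj'
  have e1 := hstiff (s, v, y, E, n)
  have e2 := hsd (s, v, y, E, n)
  simp only at e1 e2 hp q1 q2 q3 q4 q5 q6 q7 q8 q9 q10 q11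
  rw [← e1, hj] at q1 q2 q3 q4 q5 q6 q7 q8 q9
  rw [← e2, hj'] at q2 q3 q4 q5 q7
  refine ⟨?_, q2, q3, q4, q5, q6, q7, q8, q9, q10, q11⟩
  have e3 : s / 2 * (2 * v ^ 2 * y / j - v ^ 2 * j' / j ^ 2)
      = s / 2 * (2 * v ^ 2 / j - v ^ 2 * J₁ (s, v, y, E, n) / j ^ 2) * y
        - E * (s / 2 * (v ^ 2 * J₂ (s, v, y, E, n) / j ^ 2)) := by
    rw [← hj', e2]; ring
  rw [e3]
  have e4 : E * (s / 2 * (v ^ 2 * J₂ (s, v, y, E, n) / j ^ 2))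
      ≤ |C| * y * |s / 2 * (v ^ 2 * J₂ (s, v, y, E, n) / j ^ 2)| := by
    refine (le_abs_self _).trans ?_
    rw [abs_mul]
    refine mul_le_mul_of_nonneg_right (hp.2.trans ?_) (abs_nonneg _)
    exact mul_le_mul_of_nonneg_right (le_abs_self C) hp.1.le
  nlinarith [mul_le_mul_of_nonneg_right q1.le hp.1.le]

theorem mul_le_half_sq_add_sq (a b : ℝ) : a * b ≤ (a ^ 2 + b ^ 2) / 2 := by
  linarith [two_mul_le_add_sq a b]

/-- Young's inequality would give `K²/c` in front of `a²`; `1 ≤ K * c` replaces it by `K³`. -/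
theorem scaled_young {K c y : ℝ} (hK : 1 ≤ K) (hc : 0 < c) (hKc : 1 ≤ K * c) (hy : 0 ≤ y)
    (a b : ℝ) : K * y * (a * b) ≤ y * (c / 4 * b ^ 2 + K ^ 3 * a ^ 2) := by
  have h1 : 0 ≤ (c * b - 2 * K * a) ^ 2 := sq_nonneg _
  have h2 : 0 ≤ (K * c - 1) * (K ^ 2 * a ^ 2) := by
    have : 0 ≤ K * c - 1 := by linarith
    positivity
  have h3 : 0 ≤ c * (c / 4 * b ^ 2 + K ^ 3 * a ^ 2 - K * (a * b)) := by nlinarith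
  have h4 := nonneg_of_mul_nonneg_right h3 hc
  nlinarith [mul_nonneg hy h4]

/-- The letters stand for the norms of `z`, `w`, `φ`, `θ`, `lam θ` (for `L`), `U` (for `A`) and `lam
((ε²/n) θ - V)` (for `X`). Only `A` needs the good term `c y A²`, as nothing else controls `U`; the
rest stays as an `O(y)` error. -/
theorem absorb_cross_terms {K c y Z W P Θ L A X : ℝ} (hK : 1 ≤ K) (hc : 0 < c) (hKc : 1 ≤ K * c)
    (hy : 0 < y) (hW : 0 ≤ W) (hP : 0 ≤ P) (hΘ : 0 ≤ Θ) (hL : 0 ≤ L)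
    (hX : X ≤ K * (L + W + Z)) :
    K * y * (Z * A) + K * y * (Θ * A) + K * y * (Θ * Θ) + K * y * (P * P) + K * y * (W * P)
      + K * y * (P * X) + K * y * (P * L) + K * y * (W * X)
    ≤ c * y * A ^ 2 + (2 * K ^ 3 + 20 * K ^ 2) * y * (Z ^ 2 + W ^ 2 + P ^ 2 + Θ ^ 2 + L ^ 2) := by
  have hK0 : 0 < K := by linarith
  have m7 := mul_le_mul_of_nonneg_left hX (show 0 ≤ K * y * P by positivity)
  have m9 := mul_le_mul_of_nonneg_left hX (show 0 ≤ K * y * W by positivity)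
  have g2 := scaled_young hK hc hKc hy.le Z A
  have g3 := scaled_young hK hc hKc hy.le Θ A
  have hk2 : 0 ≤ K ^ 2 * y := by positivity
  have hkk : K * y ≤ K ^ 2 * y := by
    have : K ^ 2 * y = K * (K * y) := by ring
    rw [this]; exact le_mul_of_one_le_left (by positivity) hK
  have am : ∀ a b : ℝ, K ^ 2 * y * (a * b) ≤ K ^ 2 * y * ((a ^ 2 + b ^ 2) / 2) := fun a b =>
    mul_le_mul_of_nonneg_left (mul_le_half_sq_add_sq a b) hk2
  have am' : ∀ a b : ℝ, 0 ≤ a → 0 ≤ b →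
      K * y * (a * b) ≤ K ^ 2 * y * ((a ^ 2 + b ^ 2) / 2) := fun a b ha hb =>
    (mul_le_mul_of_nonneg_right hkk (mul_nonneg ha hb)).trans (am a b)
  have a4 := am' Θ Θ hΘ hΘ
  have a5 := am' P P hP hP
  have a6 := am' W P hW hP
  have a8 := am' P L hP hL
  have b1 := am P L
  have b2 := am P W
  have b3 := am P Z
  have b4 := am W L
  have b5 := am W W
  have b6 := am W Z
  have hk3 : 0 ≤ K ^ 3 * y := by positivity
  have f4 := mul_nonneg hk2 (sq_nonneg Z)
  have f5 := mul_nonneg hk2 (sq_nonneg W)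
  have f6 := mul_nonneg hk2 (sq_nonneg P)
  have f7 := mul_nonneg hk2 (sq_nonneg Θ)
  have f8 := mul_nonneg hk2 (sq_nonneg L)
  have f10 := mul_nonneg hk3 (sq_nonneg W)
  have f11 := mul_nonneg hk3 (sq_nonneg P)
  have f13 := mul_nonneg hk3 (sq_nonneg L)
  have f9 := mul_nonneg hk3 (sq_nonneg Z)
  have f12 := mul_nonneg hk3 (sq_nonneg Θ)
  have f0 : 0 ≤ c * y * A ^ 2 := by positivity
  clear am am' hX
  linarith

/-- The gain `c y |U|²` is spent entirely on the cross terms, so that outside the factor of `Re lam`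
neither `U` nor `V` remains. Since `lam V = s w + z`, the loss contains `lam` only through `lam θ`.
-/
theorem energyRate_lower (hT : 0 < T) (hm : 0 < m) (hs₀ : 0 < s₀)
    (hson : s₀ ^ 2 * m ^ 2 = T + 1) :
    ∃ K, 0 < K ∧ ∀ᶠ p in nearConst (constState m s₀) C, ∀ s v y E n, p = (s, v, y, E, n) →
      ∀ j, stiff T ν s v y n = j → ∀ lam V U w z φ θ : ℂ, lam * V = s * w + z →
      lam.re * (ip V V + v ^ 2 / j * ip U U - ε ^ 2 * v / j * (ε ^ 2 / n * ip θ θ + ip φ φ))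
        + ν * v / j * ‖z‖ ^ 2
        - K * y * (‖z‖ ^ 2 + ‖w‖ ^ 2 + ‖φ‖ ^ 2 + ‖θ‖ ^ 2 + ‖lam * θ‖ ^ 2)
      ≤ energyRate T ν ε s v y E n lam V U w z φ θ := by
  obtain ⟨K, hK, c, hc, hKc, hev⟩ := energyRate_coeff_bounds (ν := ν) (ε := ε) (C := C) hT hm hs₀ hson
  refine ⟨2 * K ^ 3 + 20 * K ^ 2, by positivity, ?_⟩
  filter_upwards [hev, nearConst_slope _ C] with p hp hy
  rintro s v y E n rfl j hj lam V U w z φ θ hlam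
  obtain ⟨q1, q2, q3, q4, q5, q6, q7, q8, q9, q10, q11⟩ := hp s v y E n rfl j _ hj rfl
  replace hy : 0 < y := hy.1
  unfold energyRate
  simp only [hj]
  set j' := stiffDeriv T ν s v y E n
  have hχ : ‖lam * ((ε ^ 2 / n : ℝ) * θ - V)‖ ≤ K * (‖lam * θ‖ + ‖w‖ + ‖z‖) := by
    have : lam * ((ε ^ 2 / n : ℝ) * θ - V) = (ε ^ 2 / n : ℝ) * (lam * θ) - (s * w + z) := by
      rw [← hlam]; ring
    rw [this]
    have n1 : ‖((ε ^ 2 / n : ℝ) : ℂ) * (lam * θ)‖ ≤ K * ‖lam * θ‖ := by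
      rw [norm_mul, Complex.norm_real, Real.norm_eq_abs]
      exact mul_le_mul_of_nonneg_right q10 (norm_nonneg _)
    have n2 : ‖(s : ℂ) * w‖ ≤ K * ‖w‖ := by
      rw [norm_mul, Complex.norm_real, Real.norm_eq_abs]
      exact mul_le_mul_of_nonneg_right q11 (norm_nonneg _)
    have n3 : ‖z‖ ≤ K * ‖z‖ := le_mul_of_one_le_left (norm_nonneg _) hK
    linarith [norm_sub_le (((ε ^ 2 / n : ℝ) : ℂ) * (lam * θ)) (s * w + z), norm_add_le ((s : ℂ) * w) z]
  have t1 : c * y * ‖U‖ ^ 2 ≤ s / 2 * (2 * v ^ 2 * y / j - v ^ 2 * j' / j ^ 2) * ip U U := by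
    rw [ip_self]; exact mul_le_mul_of_nonneg_right q1 (sq_nonneg _)
  have t2 := le_mul_ip q2 z U
  have t3 := mul_ip_le q3 θ U
  have t4 := mul_ip_le q4 θ θ
  have t5 := le_mul_ip q5 φ φ
  have t6 := le_mul_ip q6 w φ
  have t7 := le_mul_ip q7 φ (lam * ((ε ^ 2 / n : ℝ) * θ - V))
  have t8 := le_mul_ip q8 φ (lam * θ)
  have t9 := mul_ip_le q9 w (lam * ((ε ^ 2 / n : ℝ) * θ - V))
  rw [ip_self z]
  have key := absorb_cross_terms (A := ‖U‖) hK hc hKc hy (norm_nonneg w) (norm_nonneg φ)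
    (norm_nonneg θ) (norm_nonneg (lam * θ)) hχ
  linarith

end Bounds

section Bounds

variable {T ν ε m s₀ C : ℝ}

theorem eventually_abs_le {p₀ : Coef} {c : Coef → ℝ} (h : ContinuousAt c p₀) (h0 : c p₀ = 0)
    {η : ℝ} (hη : 0 < η) : ∀ᶠ p in 𝓝 p₀, |c p| ≤ η := by
  have := h.abs.eventually (gt_mem_nhds (show |c p₀| < η by rwa [h0, abs_zero]))
  exact this.mono fun p hp => le_of_lt hp

/-- At the constant state the coefficients of `|w|²`, `|θ|²`, `|φ|²` are `T/m²`, `ε² m` and `1`, and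
the cross term disappears. Terms with `Re lam` have a good sign. -/
theorem volumeRate_lower (hT : 0 < T) (hm : 0 < m) (hν : 0 < ν) (hε : 0 < ε) :
    ∃ c, 0 < c ∧ ∀ᶠ p in 𝓝 (constState m s₀), ∀ s v y E n, p = (s, v, y, E, n) →
      ∀ lam V w z φ θ : ℂ, 0 ≤ lam.re →
      c * (‖w‖ ^ 2 + ‖φ‖ ^ 2 + ‖θ‖ ^ 2) - ‖z‖ ^ 2 ≤ volumeRate T ν ε s v y E n lam V w z φ θ := by
  have v0 : (constState m s₀).2.1 ≠ 0 := hm.ne'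
  set c := min (min (T / m ^ 2) (ε ^ 2 * m)) 1 / 3 with hc
  have hcpos : 0 < c := by positivity
  have e1 : ∀ᶠ p in 𝓝 (constState m s₀), 2 * c < T / p.2.1 ^ 2 + p.1 * ν * p.2.2.1 / (2 * p.2.1) := by
    have hcont : ContinuousAt (fun p : Coef => T / p.2.1 ^ 2 + p.1 * ν * p.2.2.1 / (2 * p.2.1))
        (constState m s₀) := by
      have a := pow_ne_zero 2 v0
      have b := mul_ne_zero two_ne_zero v0
      fun_prop (disch := assumption)
    refine hcont.eventually (lt_mem_nhds ?_)
    have := (min_le_left (min (T / m ^ 2) (ε ^ 2 * m)) 1).trans (min_le_left _ _)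
    have h0 : 0 < T / m ^ 2 := by positivity
    simp only [constState, mul_zero, zero_div, add_zero]
    linarith
  have e2 : ∀ᶠ p in 𝓝 (constState m s₀), 2 * c < ε ^ 2 * p.2.1 := by
    have hcont : ContinuousAt (fun p : Coef => ε ^ 2 * p.2.1) (constState m s₀) := by fun_prop
    refine hcont.eventually (lt_mem_nhds ?_)
    have := (min_le_left (min (T / m ^ 2) (ε ^ 2 * m)) 1).trans (min_le_right _ _)
    have h0 : 0 < ε ^ 2 * m := by positivity
    simp only [constState]
    linarith
  have e3 : ∀ᶠ p in 𝓝 (constState m s₀), 2 * c < p.2.2.2.2 * p.2.1 := by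
    have hcont : ContinuousAt (fun p : Coef => p.2.2.2.2 * p.2.1) (constState m s₀) := by fun_prop
    refine hcont.eventually (lt_mem_nhds ?_)
    have := min_le_right (min (T / m ^ 2) (ε ^ 2 * m)) 1
    simp only [constState, one_div_mul_cancel hm.ne']
    linarith
  have e4 : ∀ᶠ p in 𝓝 (constState m s₀), 0 < p.2.1 := by
    have hcont : ContinuousAt (fun p : Coef => p.2.1) (constState m s₀) := by fun_prop
    exact hcont.eventually (lt_mem_nhds hm)
  have e5 := eventually_abs_le (p₀ := constState m s₀) (c := fun p => 2 * ε ^ 2 * p.2.2.2.1)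
    (by fun_prop) (by simp [constState]) hcpos
  refine ⟨c, hcpos, ?_⟩
  filter_upwards [e1, e2, e3, e4, e5] with p h1 h2 h3 h4 h5
  rintro s v y E n rfl lam V w z φ θ hr
  simp only at h1 h2 h3 h4 h5
  have t := le_mul_ip h5 θ w
  have am := mul_le_half_sq_add_sq ‖θ‖ ‖w‖
  have a1 := mul_le_mul_of_nonneg_right h1.le (sq_nonneg ‖w‖)
  have a2 := mul_le_mul_of_nonneg_right h2.le (sq_nonneg ‖θ‖)
  have a3 := mul_le_mul_of_nonneg_right h3.le (sq_nonneg ‖φ‖)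
  have a9 : 0 ≤ c * ‖φ‖ ^ 2 := by positivity
  have a4 : 0 ≤ ν / v * lam.re * ‖w‖ ^ 2 := by positivity
  have a5 : 0 ≤ 2 * lam.re ^ 2 * ‖V‖ ^ 2 := by positivity
  have a6 := mul_le_mul_of_nonneg_left am hcpos.le
  have a7 : 0 ≤ c * ‖w‖ ^ 2 := by positivity
  have a8 : 0 ≤ c * ‖θ‖ ^ 2 := by positivity
  unfold volumeRate
  rw [ip_self, ip_self, ip_self, ip_self, ip_self]
  linarith

/-- Used for `lam V`, `lam φ`, `lam θ`: it pays for `|lam θ|²` in the energy loss by `|lam V|² = |s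
w + z|²`, with constants independent of `lam`. -/
theorem poissonRate_lower (hm : 0 < m) (hε : 0 < ε) :
    ∃ c, 0 < c ∧ ∃ K, 0 < K ∧ ∀ᶠ p in 𝓝 (constState m s₀), ∀ s v y E n, p = (s, v, y, E, n) →
      ∀ V φ θ : ℂ, c * (‖φ‖ ^ 2 + ‖θ‖ ^ 2) - K * ‖V‖ ^ 2 ≤ poissonRate ε v E n 1 0 V φ θ := by
  have n0 : (constState m s₀).2.2.2.2 ≠ 0 := (one_div_pos.2 hm).ne'
  have n02 := pow_ne_zero 2 n0
  set c := min (ε ^ 2 * m ^ 2) m / 5 with hc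
  have hcpos : 0 < c := by positivity
  have e1 : ∀ᶠ p in 𝓝 (constState m s₀), 4 * c < p.2.1 * ε ^ 2 / p.2.2.2.2
      - ((p.2.1 * p.2.2.2.2 - 1) / ε ^ 2 - 2 * p.2.2.2.1 * (p.2.1 * p.2.2.2.1))
        * (ε ^ 4 / p.2.2.2.2 ^ 2 / 2) := by
    have hcont : ContinuousAt (fun p : Coef => p.2.1 * ε ^ 2 / p.2.2.2.2
      - ((p.2.1 * p.2.2.2.2 - 1) / ε ^ 2 - 2 * p.2.2.2.1 * (p.2.1 * p.2.2.2.1))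
        * (ε ^ 4 / p.2.2.2.2 ^ 2 / 2)) (constState m s₀) := by
      fun_prop (disch := assumption)
    refine hcont.eventually (lt_mem_nhds ?_)
    have := min_le_left (ε ^ 2 * m ^ 2) m
    have h0 : 0 < ε ^ 2 * m ^ 2 := by positivity
    have : m * ε ^ 2 / (1 / m) = ε ^ 2 * m ^ 2 := by field_simp
    simp only [constState, mul_one_div_cancel hm.ne', this]
    simp only [sub_self, zero_div, mul_zero, zero_mul, sub_zero]
    linarith
  have e2 : ∀ᶠ p in 𝓝 (constState m s₀), 4 * c < p.2.1 := by
    have hcont : ContinuousAt (fun p : Coef => p.2.1) (constState m s₀) := by fun_prop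
    refine hcont.eventually (lt_mem_nhds ?_)
    have := min_le_right (ε ^ 2 * m ^ 2) m
    simp only [constState]
    linarith
  have e3 := eventually_abs_le (p₀ := constState m s₀)
    (c := fun p => 2 * ε ^ 2 * p.2.1 * p.2.2.2.1 / p.2.2.2.2)
    (by fun_prop (disch := assumption)) (by simp [constState]) hcpos
  obtain ⟨K, ⟨hK, e4⟩, e5⟩ := (((eventually_ge_atTop (1 : ℝ)).and
    (eventually_bound (p₀ := constState m s₀) (c := fun p => p.2.1) (by fun_prop))).and
    (eventually_bound (p₀ := constState m s₀) (c := fun p => (p.2.1 * p.2.2.2.2 - 1) / ε ^ 2 / 2)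
      (by fun_prop))).exists
  refine ⟨c, hcpos, K ^ 2 / c + K, by positivity, ?_⟩
  filter_upwards [e1, e2, e3, e4, e5] with p h1 h2 h3 h4 h5
  rintro s v y E n rfl V φ θ
  simp only at h1 h2 h3 h4 h5
  have t1 := mul_ip_le h4 θ V
  have t2 := mul_ip_le h3 φ θ
  have t3 := le_mul_ip h5 V V
  have am := mul_le_half_sq_add_sq ‖φ‖ ‖θ‖
  have a1 := mul_le_mul_of_nonneg_right h1.le (sq_nonneg ‖θ‖)
  have a2 := mul_le_mul_of_nonneg_right h2.le (sq_nonneg ‖φ‖)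
  have a6 := mul_le_mul_of_nonneg_left am hcpos.le
  have a7 : 0 ≤ c * ‖φ‖ ^ 2 := by positivity
  have a8 : 0 ≤ c * ‖θ‖ ^ 2 := by positivity
  -- The coupling of `θ` and `V` does not vanish for a constant profile, so it is split at the
  -- expense of a large multiple of `‖V‖²`.
  have yg : K * (‖θ‖ * ‖V‖) ≤ c * ‖θ‖ ^ 2 + K ^ 2 / c * ‖V‖ ^ 2 := by
    have h0 : 0 ≤ c * (‖θ‖ - K / c * ‖V‖) ^ 2 := by positivity
    have h6 : c * (‖θ‖ - K / c * ‖V‖) ^ 2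
        = c * ‖θ‖ ^ 2 - 2 * (K * (‖θ‖ * ‖V‖)) + K ^ 2 / c * ‖V‖ ^ 2 := by
      field_simp
      ring
    have h7 : 0 ≤ K * (‖θ‖ * ‖V‖) := by positivity
    linarith
  unfold poissonRate
  rw [ip_self, ip_self, ip_self] at *
  simp only [one_mul, mul_one, zero_mul, add_zero, zero_add]
  have b1 : v * (ε ^ 2 / n * ‖θ‖ ^ 2 + ‖φ‖ ^ 2) - v * ip θ V
      - 2 * ε ^ 2 * v * E / n * ip φ θ
      - ((v * n - 1) / ε ^ 2 - 2 * E * (v * E)) * (ε ^ 4 / n ^ 2 / 2) * ‖θ‖ ^ 2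
      + (v * n - 1) / ε ^ 2 / 2 * ‖V‖ ^ 2 =
    (v * ε ^ 2 / n - ((v * n - 1) / ε ^ 2 - 2 * E * (v * E)) * (ε ^ 4 / n ^ 2 / 2)) * ‖θ‖ ^ 2
      + v * ‖φ‖ ^ 2 - v * ip θ V - 2 * ε ^ 2 * v * E / n * ip φ θ
      + (v * n - 1) / ε ^ 2 / 2 * ‖V‖ ^ 2 := by ring
  rw [b1]
  nlinarith

/-- This is the factor of `Re lam`, without its `U` part. At the constant state, with `β = ε²
m/(T+1)`, it reads `|V|² + β (ε² m |θ|² + |φ|²) - 2 β θ V`. It is positive definite because `β < ε²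
m`, that is because `T > 0`; a strict margin absorbs the perturbation. -/
theorem growth_form_nonneg (hT : 0 < T) (hm : 0 < m) (hε : 0 < ε) :
    ∀ᶠ p in 𝓝 (constState m s₀), ∀ s v y E n, p = (s, v, y, E, n) →
      ∀ j, stiff T ν s v y n = j → ∀ V φ θ : ℂ,
      0 ≤ ip V V - ε ^ 2 * v / j * (ε ^ 2 / n * ip θ θ + ip φ φ)
        + 2 * poissonRate ε v E n (ε ^ 2 / j) (-(ε ^ 2 * stiffDeriv T ν s v y E n / j ^ 2)) V φ θ := by
  set J : Coef → ℝ := fun p => stiff T ν p.1 p.2.1 p.2.2.1 p.2.2.2.2 with hJ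
  set J' : Coef → ℝ := fun p => stiffDeriv T ν p.1 p.2.1 p.2.2.1 p.2.2.2.1 p.2.2.2.2 with hJ'
  have v0 : (constState m s₀).2.1 ≠ 0 := hm.ne'
  have n0 : (constState m s₀).2.2.2.2 ≠ 0 := (one_div_pos.2 hm).ne'
  have j0 : J (constState m s₀) = T + 1 := by
    simp [hJ, constState, stiff, hm.ne']
  have j0' : J (constState m s₀) ≠ 0 := by rw [j0]; positivity
  have cJ : ContinuousAt J (constState m s₀) := by
    simp only [hJ, stiff]; fun_prop
  have cJ' : ContinuousAt J' (constState m s₀) := by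
    simp only [hJ', stiffDeriv]; fun_prop (disch := assumption)
  have z' : J' (constState m s₀) = 0 := by
    simp only [hJ', stiffDeriv, constState]; simp
  have hstiff : ∀ p : Coef, stiff T ν p.1 p.2.1 p.2.2.1 p.2.2.2.2 = J p := fun p => rfl
  have hsd : ∀ p : Coef, stiffDeriv T ν p.1 p.2.1 p.2.2.1 p.2.2.2.1 p.2.2.2.2 = J' p :=
    fun p => rfl
  clear_value J J'
  have n02 := pow_ne_zero 2 n0
  have j02 := pow_ne_zero 2 j0'
  -- Strictly between `1/(1+T)` and `1`: the share of `|V|²` spent on the cross term with `θ`,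
  -- leaving a margin in both squares.
  set ρ := (1 + T / 2) / (1 + T) with hρ
  have hρ0 : 0 < ρ := by positivity
  have hρ1 : ρ < 1 := by rw [hρ, div_lt_one (by positivity)]; linarith
  -- the cross terms have coefficients that vanish for a constant profile
  have cθφ : ContinuousAt (fun p : Coef => 2 * ((ε ^ 2 * J' p / J p ^ 2) * ε ^ 2 / p.2.2.2.2
      + 2 * (ε ^ 2 / J p) * ε ^ 2 * p.2.1 * p.2.2.2.1 / p.2.2.2.2)) (constState m s₀) := by
    fun_prop (disch := assumption)
  have cφV : ContinuousAt (fun p : Coef => 2 * (ε ^ 2 * J' p / J p ^ 2)) (constState m s₀) := by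
    fun_prop (disch := assumption)
  have cθ : ContinuousAt (fun p : Coef => 2 * ((-(ε ^ 2 * J' p / J p ^ 2) * p.2.2.2.1
      + ε ^ 2 / J p * ((p.2.1 * p.2.2.2.2 - 1) / ε ^ 2)
      - 2 * (ε ^ 2 / J p) * p.2.2.2.1 * (p.2.1 * p.2.2.2.1)) * (ε ^ 4 / p.2.2.2.2 ^ 2 / 2)))
      (constState m s₀) := by
    fun_prop (disch := assumption)
  have cV : ContinuousAt (fun p : Coef => 2 * ((-(ε ^ 2 * J' p / J p ^ 2) * p.2.2.2.1
      + ε ^ 2 / J p * ((p.2.1 * p.2.2.2.2 - 1) / ε ^ 2)) / 2)) (constState m s₀) := by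
    fun_prop (disch := assumption)
  have cβ : ContinuousAt (fun p : Coef => ε ^ 2 / J p * p.2.1) (constState m s₀) := by
    fun_prop (disch := assumption)
  have cα : ContinuousAt (fun p : Coef => ε ^ 2 / J p * p.2.1 * (ε ^ 2 / p.2.2.2.2)
      - (ε ^ 2 / J p * p.2.1) ^ 2 / ρ) (constState m s₀) := by
    fun_prop (disch := assumption)
  have α0 : 0 < ε ^ 2 / J (constState m s₀) * m * (ε ^ 2 / (1 / m))
      - (ε ^ 2 / J (constState m s₀) * m) ^ 2 / ρ := by
    rw [j0, hρ]
    have : ε ^ 2 / (T + 1) * m * (ε ^ 2 / (1 / m)) - (ε ^ 2 / (T + 1) * m) ^ 2 / ((1 + T / 2) / (1 + T))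
        = ε ^ 4 * m ^ 2 / (T + 1) * (T / 2 / (1 + T / 2)) := by
      field_simp
      ring
    rw [this]; positivity
  have β0 : 0 < ε ^ 2 / J (constState m s₀) * m := by rw [j0]; positivity
  obtain ⟨η, hη, hη1, hηα, hηβ⟩ : ∃ η : ℝ, 0 < η ∧ 3 * η < 1 - ρ ∧
      3 * η < ε ^ 2 / J (constState m s₀) * m * (ε ^ 2 / (1 / m))
      - (ε ^ 2 / J (constState m s₀) * m) ^ 2 / ρ ∧ 3 * η < ε ^ 2 / J (constState m s₀) * m := by
    set a := ε ^ 2 / J (constState m s₀) * m * (ε ^ 2 / (1 / m))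
      - (ε ^ 2 / J (constState m s₀) * m) ^ 2 / ρ
    set b := ε ^ 2 / J (constState m s₀) * m
    have hp : 0 < min (1 - ρ) (min a b) := lt_min (by linarith) (lt_min α0 β0)
    refine ⟨min (1 - ρ) (min a b) / 4, by linarith, ?_, ?_, ?_⟩
    · linarith [min_le_left (1 - ρ) (min a b)]
    · linarith [min_le_right (1 - ρ) (min a b), min_le_left a b]
    · linarith [min_le_right (1 - ρ) (min a b), min_le_right a b]
  have e1 := eventually_abs_le cθφ (by simp only [z']; simp [constState]) hη
  have e2 := eventually_abs_le cφV (by simp [z']) hη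
  have e3 := eventually_abs_le cθ (by simp [constState, hm.ne']) hη
  have e4 := eventually_abs_le cV (by simp [constState, hm.ne']) hη
  have e5 := cα.eventually (lt_mem_nhds hηα)
  have e6 := cβ.eventually (lt_mem_nhds hηβ)
  filter_upwards [e1, e2, e3, e4, e5, e6] with p h1 h2 h3 h4 h5 h6
  rintro s v y E n rfl j hj V φ θ
  have hj1 := hstiff (s, v, y, E, n)
  have hj2 := hsd (s, v, y, E, n)
  simp only at h1 h2 h3 h4 h5 h6 hj1 hj2
  rw [hj] at hj1
  rw [← hj1] at h1 h2 h3 h4 h5 h6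
  rw [hj2]
  generalize J' (s, v, y, E, n) = j' at *
  have t1 := mul_ip_le h1 φ θ
  have t2 := le_mul_ip h2 φ V
  have t3 := mul_ip_le h3 θ θ
  have t4 := le_mul_ip h4 V V
  have hβ : 0 ≤ ε ^ 2 / j * v := by linarith
  have t5 := mul_le_mul_of_nonneg_left (le_trans (le_abs_self _) (abs_ip_le θ V)) hβ
  have yg : 2 * (ε ^ 2 / j * v * (‖θ‖ * ‖V‖))
      ≤ (ε ^ 2 / j * v) ^ 2 / ρ * ‖θ‖ ^ 2 + ρ * ‖V‖ ^ 2 := by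
    have h0 : 0 ≤ ρ * (‖V‖ - ε ^ 2 / j * v / ρ * ‖θ‖) ^ 2 := by positivity
    have h7 : ρ * (‖V‖ - ε ^ 2 / j * v / ρ * ‖θ‖) ^ 2
        = ρ * ‖V‖ ^ 2 - 2 * (ε ^ 2 / j * v * (‖θ‖ * ‖V‖))
          + (ε ^ 2 / j * v) ^ 2 / ρ * ‖θ‖ ^ 2 := by
      generalize ε ^ 2 / j * v = b
      field_simp
      ring
    linarith
  have am1 := mul_le_mul_of_nonneg_left (mul_le_half_sq_add_sq ‖φ‖ ‖θ‖) hη.le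
  have am2 := mul_le_mul_of_nonneg_left (mul_le_half_sq_add_sq ‖φ‖ ‖V‖) hη.le
  have f1 := mul_le_mul_of_nonneg_right h5.le (sq_nonneg ‖θ‖)
  have f2 := mul_le_mul_of_nonneg_right h6.le (sq_nonneg ‖φ‖)
  have f3 := mul_le_mul_of_nonneg_right hη1.le (sq_nonneg ‖V‖)
  have f4 := mul_nonneg hη.le (sq_nonneg ‖θ‖)
  have f5 := mul_nonneg hη.le (sq_nonneg ‖φ‖)
  have f6 := mul_nonneg hη.le (sq_nonneg ‖V‖)
  unfold poissonRate
  rw [ip_self, ip_self, ip_self] at *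
  have b1 : ‖V‖ ^ 2 - ε ^ 2 * v / j * (ε ^ 2 / n * ‖θ‖ ^ 2 + ‖φ‖ ^ 2)
      + 2 * (ε ^ 2 / j * v * (ε ^ 2 / n * ‖θ‖ ^ 2 + ‖φ‖ ^ 2) - ε ^ 2 / j * v * ip θ V
        + -(ε ^ 2 * j' / j ^ 2) * (ε ^ 2 / n * ip φ θ - ip φ V)
        - 2 * (ε ^ 2 / j) * ε ^ 2 * v * E / n * ip φ θ
        - (-(ε ^ 2 * j' / j ^ 2) * E + ε ^ 2 / j * ((v * n - 1) / ε ^ 2)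
          - 2 * (ε ^ 2 / j) * E * (v * E)) * (ε ^ 4 / n ^ 2 / 2) * ‖θ‖ ^ 2
        + (-(ε ^ 2 * j' / j ^ 2) * E + ε ^ 2 / j * ((v * n - 1) / ε ^ 2)) / 2 * ‖V‖ ^ 2)
      = ‖V‖ ^ 2 + ε ^ 2 / j * v * (ε ^ 2 / n) * ‖θ‖ ^ 2 + ε ^ 2 / j * v * ‖φ‖ ^ 2
        - 2 * (ε ^ 2 / j * v * ip θ V)
        - 2 * ((ε ^ 2 * j' / j ^ 2) * ε ^ 2 / n
            + 2 * (ε ^ 2 / j) * ε ^ 2 * v * E / n) * ip φ θ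
        + 2 * (ε ^ 2 * j' / j ^ 2) * ip φ V
        - 2 * ((-(ε ^ 2 * j' / j ^ 2) * E + ε ^ 2 / j * ((v * n - 1) / ε ^ 2)
          - 2 * (ε ^ 2 / j) * E * (v * E)) * (ε ^ 4 / n ^ 2 / 2)) * ‖θ‖ ^ 2
        + 2 * ((-(ε ^ 2 * j' / j ^ 2) * E + ε ^ 2 / j * ((v * n - 1) / ε ^ 2)) / 2) * ‖V‖ ^ 2 := by
    ring
  rw [b1]
  linarith

/-- The multipliers are fixed in turn: `κ₂` small against the viscosity `d`, `κ₃` small against `d`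
and `κ₂ c₂`, and finally the slope `y` small against all three. Each choice uses quarters or halves
of the available dissipation, and a quarter of `d |z|²` and of `κ₂ c₂ |w|²` is left. -/
theorem total_rate_lower (hT : 0 < T) (hν : 0 < ν) (hε : 0 < ε) (hm : 0 < m) (hs₀ : 0 < s₀)
    (hson : s₀ ^ 2 * m ^ 2 = T + 1) :
    ∃ κ₂ κ₃ c : ℝ, 0 < c ∧ ∀ᶠ p in nearConst (constState m s₀) C, ∀ s v y E n,
      p = (s, v, y, E, n) → 0 < stiff T ν s v y n ∧
      ∀ lam V U w z φ θ : ℂ, 0 ≤ lam.re → lam * V = s * w + z →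
      c * (‖z‖ ^ 2 + ‖w‖ ^ 2) ≤ energyRate T ν ε s v y E n lam V U w z φ θ
        + κ₂ * volumeRate T ν ε s v y E n lam V w z φ θ
        + κ₃ * poissonRate ε v E n 1 0 (lam * V) (lam * φ) (lam * θ)
        + 2 * lam.re * poissonRate ε v E n (ε ^ 2 / stiff T ν s v y n)
          (-(ε ^ 2 * stiffDeriv T ν s v y E n / stiff T ν s v y n ^ 2)) V φ θ := by
  obtain ⟨K, hK, he⟩ := energyRate_lower (ν := ν) (ε := ε) (C := C) hT hm hs₀ hson
  obtain ⟨c₂, hc₂, hvol⟩ := volumeRate_lower (s₀ := s₀) hT hm hν hε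
  obtain ⟨c₃, hc₃, K₃, hK₃, hpoi⟩ := poissonRate_lower (s₀ := s₀) hm hε
  have hgr := growth_form_nonneg (ν := ν) (s₀ := s₀) hT hm hε
  have j0 : stiff T ν s₀ m 0 (1 / m) = T + 1 := by simp [stiff, hm.ne']
  have j0' : stiff T ν (constState m s₀).1 (constState m s₀).2.1 (constState m s₀).2.2.1
      (constState m s₀).2.2.2.2 ≠ 0 := by
    simp only [constState, j0]; positivity
  set d := ν * m / (T + 1) / 2 with hd
  have hd0 : 0 < d := by positivity
  have cstiff : ContinuousAt (fun p : Coef => stiff T ν p.1 p.2.1 p.2.2.1 p.2.2.2.2)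
      (constState m s₀) := by simp only [stiff]; fun_prop
  have ev1 : ∀ᶠ p in 𝓝 (constState m s₀), 0 < stiff T ν p.1 p.2.1 p.2.2.1 p.2.2.2.2 := by
    refine cstiff.eventually (lt_mem_nhds ?_)
    simp only [constState, j0]; positivity
  have ev2 : ∀ᶠ p in 𝓝 (constState m s₀),
      d < ν * p.2.1 / stiff T ν p.1 p.2.1 p.2.2.1 p.2.2.2.2 := by
    have hcont : ContinuousAt (fun p : Coef => ν * p.2.1 / stiff T ν p.1 p.2.1 p.2.2.1 p.2.2.2.2)
        (constState m s₀) := by fun_prop (disch := assumption)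
    refine hcont.eventually (lt_mem_nhds ?_)
    simp only [constState, j0]
    exact half_lt_self (by positivity)
  have ev3 : ∀ᶠ p in 𝓝 (constState m s₀), |p.1| ≤ s₀ + 1 := by
    have hcont : ContinuousAt (fun p : Coef => |p.1|) (constState m s₀) := by fun_prop
    have h : |(constState m s₀).1| < s₀ + 1 := by
      simp only [constState, abs_of_pos hs₀]; linarith
    exact (hcont.eventually (gt_mem_nhds h)).mono fun p hp => le_of_lt hp
  -- Bounds `K₃ |lam V|²` by `K₅ (|w|² + |z|²)` through `lam V = s w + z`.
  set K₅ := 2 * K₃ * (s₀ + 1) ^ 2 + 2 * K₃ with hK₅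
  have hK₅0 : 0 < K₅ := by positivity
  set κ₂ := d / 4 with hκ₂
  set κ₃ := min (d / 4) (κ₂ * c₂ / 2) / K₅ with hκ₃
  have hκ₂0 : 0 < κ₂ := by positivity
  have hκ₃0 : 0 < κ₃ := by positivity
  have b1 : κ₃ * K₅ ≤ d / 4 := by
    rw [hκ₃, div_mul_cancel₀ _ hK₅0.ne']; exact min_le_left _ _
  have b2 : κ₃ * K₅ ≤ κ₂ * c₂ / 2 := by
    rw [hκ₃, div_mul_cancel₀ _ hK₅0.ne']; exact min_le_right _ _
  -- The admissible size of `K y`, one entry for each dissipation that must absorb the energy loss.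
  set e := min (min (d / 4) (κ₂ * c₂ / 4)) (κ₃ * c₃) with he'
  have he0 : 0 < e := by positivity
  have ev4 := eventually_abs_le (p₀ := constState m s₀) (c := fun p => K * p.2.2.1)
    (by fun_prop) (by simp [constState]) he0
  have e1 : e ≤ d / 4 := (min_le_left _ _).trans (min_le_left _ _)
  have e2 : e ≤ κ₂ * c₂ / 4 := (min_le_left _ _).trans (min_le_right _ _)
  have e3 : e ≤ κ₃ * c₃ := min_le_right _ _
  refine ⟨κ₂, κ₃, min (d / 4) (κ₂ * c₂ / 4), by positivity, ?_⟩
  filter_upwards [he, eventually_nearConst hvol, eventually_nearConst hpoi,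
    eventually_nearConst hgr, eventually_nearConst ev1, eventually_nearConst ev2,
    eventually_nearConst ev3, eventually_nearConst ev4] with p h1 h2 h3 h4 h5 h6 h7 h8
  rintro s v y E n rfl
  refine ⟨h5, fun lam V U w z φ θ hr hlam => ?_⟩
  simp only at h5 h6 h7 h8
  have f1 := h1 s v y E n rfl _ rfl lam V U w z φ θ hlam
  have f2 := mul_le_mul_of_nonneg_left (h2 s v y E n rfl lam V w z φ θ hr) hκ₂0.le
  have f3 := mul_le_mul_of_nonneg_left (h3 s v y E n rfl (lam * V) (lam * φ) (lam * θ)) hκ₃0.le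
  have f4 := mul_nonneg hr (h4 s v y E n rfl _ rfl V φ θ)
  have f5 : ‖lam * V‖ ^ 2 ≤ 2 * (s₀ + 1) ^ 2 * ‖w‖ ^ 2 + 2 * ‖z‖ ^ 2 := by
    have g1 : ‖lam * V‖ ≤ (s₀ + 1) * ‖w‖ + ‖z‖ := by
      rw [hlam]
      refine (norm_add_le _ _).trans ?_
      rw [norm_mul, Complex.norm_real, Real.norm_eq_abs]
      linarith [mul_le_mul_of_nonneg_right h7 (norm_nonneg w)]
    have g2 : ‖lam * V‖ ^ 2 ≤ ((s₀ + 1) * ‖w‖ + ‖z‖) ^ 2 :=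
      pow_le_pow_left₀ (norm_nonneg _) g1 2
    linarith [add_sq ((s₀ + 1) * ‖w‖) ‖z‖, mul_pow (s₀ + 1) ‖w‖ 2,
      two_mul_le_add_sq ((s₀ + 1) * ‖w‖) ‖z‖]
  have f6 : K₃ * ‖lam * V‖ ^ 2 ≤ K₅ * (‖w‖ ^ 2 + ‖z‖ ^ 2) := by
    have g3 := mul_le_mul_of_nonneg_left f5 hK₃.le
    have g4 : 0 ≤ 2 * K₃ * (s₀ + 1) ^ 2 * ‖z‖ ^ 2 := by positivity
    have g5 : 0 ≤ 2 * K₃ * ‖w‖ ^ 2 := by positivity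
    rw [hK₅]; linarith
  have f7 := mul_le_mul_of_nonneg_left f6 hκ₃0.le
  generalize stiff T ν s v y n = j at *
  have f8 : 0 ≤ lam.re * (v ^ 2 / j * ip U U) := by rw [ip_self]; positivity
  have f9 : K * y * (‖z‖ ^ 2 + ‖w‖ ^ 2 + ‖φ‖ ^ 2 + ‖θ‖ ^ 2 + ‖lam * θ‖ ^ 2)
      ≤ e * (‖z‖ ^ 2 + ‖w‖ ^ 2 + ‖φ‖ ^ 2 + ‖θ‖ ^ 2 + ‖lam * θ‖ ^ 2) :=
    mul_le_mul_of_nonneg_right ((le_abs_self _).trans h8) (by positivity)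
  have f10 := mul_le_mul_of_nonneg_right h6.le (sq_nonneg ‖z‖)
  have f11 : 0 ≤ κ₃ * c₃ * ‖lam * φ‖ ^ 2 := by positivity
  have f12 := mul_le_mul_of_nonneg_right e1 (sq_nonneg ‖z‖)
  have f13 := mul_le_mul_of_nonneg_right e2 (add_nonneg (add_nonneg (sq_nonneg ‖w‖)
    (sq_nonneg ‖φ‖)) (sq_nonneg ‖θ‖))
  have f14 := mul_le_mul_of_nonneg_right e3 (sq_nonneg ‖lam * θ‖)
  have f15 := mul_le_mul_of_nonneg_right b1 (sq_nonneg ‖z‖)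
  have f16 := mul_le_mul_of_nonneg_right b2 (sq_nonneg ‖w‖)
  have f17 := mul_le_mul_of_nonneg_right (min_le_left (d / 4) (κ₂ * c₂ / 4)) (sq_nonneg ‖z‖)
  have f18 := mul_le_mul_of_nonneg_right (min_le_right (d / 4) (κ₂ * c₂ / 4)) (sq_nonneg ‖w‖)
  have f19 : 0 ≤ κ₂ * c₂ * (‖φ‖ ^ 2 + ‖θ‖ ^ 2) := by positivity
  have f20 : κ₂ * ‖z‖ ^ 2 = d / 4 * ‖z‖ ^ 2 := rfl
  linarith

end Bounds

/-! ### Triviality of decaying solutions. -/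

theorem tendsto_ip_zero {l : Filter ℝ} {f g : ℝ → ℂ} (hf : Tendsto f l (𝓝 0))
    (hg : Tendsto g l (𝓝 0)) : Tendsto (fun x => ip (f x) (g x)) l (𝓝 0) := by
  have hc : Continuous fun q : ℂ × ℂ => ip q.1 q.2 := by
    unfold ip
    fun_prop
  have h := (hc.tendsto (0, 0)).comp (hf.prodMk_nhds hg)
  simpa [ip, Function.comp_def] using h

/-- A differentiable function with nonnegative derivative that vanishes at both ends is zero. -/
theorem eq_zero_of_deriv_nonneg {Q q : ℝ → ℝ} (hQ : ∀ x, HasDerivAt Q (q x) x) (hq : ∀ x, 0 ≤ q x)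
    (hbot : Tendsto Q atBot (𝓝 0)) (htop : Tendsto Q atTop (𝓝 0)) (x : ℝ) : q x = 0 := by
  have hmono : Monotone Q := monotone_of_hasDerivAt_nonneg hQ hq
  have h0 : Q = fun _ => 0 := by
    funext t
    exact le_antisymm (hmono.ge_of_tendsto htop t) (hmono.le_of_tendsto hbot t)
  have h1 := hQ x
  rw [h0] at h1
  exact h1.unique (hasDerivAt_const x 0)

theorem tendsto_const_div_of_ne_zero {l : Filter ℝ} {f : ℝ → ℝ} {a : ℝ} (b : ℝ)
    (hf : Tendsto f l (𝓝 a)) (ha : a ≠ 0) : Tendsto (fun x => b / f x) l (𝓝 (b / a)) :=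
  tendsto_const_nhds.div hf ha

section

variable {T ν ε s : ℝ} {v y E n : ℝ → ℝ} {lam : ℂ} {V U w z φ θ : ℝ → ℂ}

/-- The functional whose derivative controls the eigenfunction. -/
def totalQ (T ν ε s κ₂ κ₃ : ℝ) (v y E n : ℝ → ℝ) (lam : ℂ) (V U w z φ θ : ℝ → ℂ) (x : ℝ) : ℝ :=
  energyQ ε s ν (v x) (n x) (stiff T ν s (v x) (y x) (n x)) lam (V x) (U x) (z x) (φ x) (θ x)
    + κ₂ * volumeQ ε s ν (v x) lam (V x) (U x) (w x) (φ x) (θ x)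
    + κ₃ * poissonQ ε (E x) (n x) 1 (lam * V x) (lam * φ x) (lam * θ x)
    + 2 * lam.re * poissonQ ε (E x) (n x) (ε ^ 2 / stiff T ν s (v x) (y x) (n x)) (V x) (φ x) (θ x)

theorem tendsto_totalQ {l : Filter ℝ} {vl : ℝ} (hT : 0 < T) (hvl : 0 < vl) (κ₂ κ₃ : ℝ)
    (hv : Tendsto v l (𝓝 vl)) (hy : Tendsto y l (𝓝 0)) (hE : Tendsto E l (𝓝 0))
    (hn : Tendsto n l (𝓝 (1 / vl))) (hV : Tendsto V l (𝓝 0)) (hU : Tendsto U l (𝓝 0))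
    (hw : Tendsto w l (𝓝 0)) (hz : Tendsto z l (𝓝 0)) (hφ : Tendsto φ l (𝓝 0))
    (hθ : Tendsto θ l (𝓝 0)) :
    Tendsto (totalQ T ν ε s κ₂ κ₃ v y E n lam V U w z φ θ) l (𝓝 0) := by
  have hJ : Tendsto (fun x => stiff T ν s (v x) (y x) (n x)) l (𝓝 (T + 1)) := by
    unfold stiff
    have h := (hv.mul ((hy.const_mul (s * ν)).add hn)).const_add T
    simpa [hvl.ne'] using h
  have hJ0 : T + 1 ≠ 0 := by positivity
  have hn0 : 1 / vl ≠ 0 := by positivity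
  have hN : Tendsto (fun x => ((ε ^ 2 / n x : ℝ) : ℂ)) l (𝓝 ((ε ^ 2 / (1 / vl) : ℝ) : ℂ)) :=
    (Complex.continuous_ofReal.tendsto _).comp (tendsto_const_div_of_ne_zero (ε ^ 2) hn hn0)
  have hχ : ∀ {V θ : ℝ → ℂ}, Tendsto V l (𝓝 0) → Tendsto θ l (𝓝 0) →
      Tendsto (fun x => ((ε ^ 2 / n x : ℝ) : ℂ) * θ x - V x) l (𝓝 0) := fun hV hθ => by
    simpa using (hN.mul hθ).sub hV
  have hP : ∀ {γ : ℝ → ℝ} {g : ℝ} {V φ θ : ℝ → ℂ}, Tendsto γ l (𝓝 g) → Tendsto V l (𝓝 0) →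
      Tendsto φ l (𝓝 0) → Tendsto θ l (𝓝 0) →
      Tendsto (fun x => poissonQ ε (E x) (n x) (γ x) (V x) (φ x) (θ x)) l (𝓝 0) := by
    intro γ g V φ θ hγ hV hφ hθ
    unfold poissonQ
    have h := ((hγ.mul (tendsto_ip_zero hφ (hχ hV hθ))).sub
      ((((((hγ.mul hE).mul_const (ε ^ 4)).div (hn.pow 2) (pow_ne_zero 2 hn0)).div_const 2)).mul
        (tendsto_ip_zero hθ hθ))).add
      (((hγ.mul hE).div_const 2).mul (tendsto_ip_zero hV hV))
    simpa using h
  have hc : ∀ {f : ℝ → ℂ}, Tendsto f l (𝓝 0) → Tendsto (fun x => lam * f x) l (𝓝 0) :=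
    fun hf => by simpa using hf.const_mul lam
  have hA : Tendsto (fun x => energyQ ε s ν (v x) (n x) (stiff T ν s (v x) (y x) (n x)) lam (V x)
      (U x) (z x) (φ x) (θ x)) l (𝓝 0) := by
    unfold energyQ
    have h := (((((((((tendsto_ip_zero hV hV).const_mul (s / 2)).add (tendsto_ip_zero hU hV)).add
      ((((hv.pow 2).div hJ hJ0).const_mul (s / 2)).mul (tendsto_ip_zero hU hU))).add
      (((hv.const_mul ν).div hJ hJ0).mul (tendsto_ip_zero hz hU))).sub
      (((hv.const_mul (ε ^ 2)).div hJ hJ0).mul (tendsto_ip_zero hθ hU))).sub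
      ((((((hv.const_mul (ε ^ 2)).div hJ hJ0).mul_const s).mul_const (ε ^ 2)).div
        (hn.const_mul 2) (mul_ne_zero two_ne_zero hn0)).mul (tendsto_ip_zero hθ hθ))).add
      (((((hv.const_mul (ε ^ 2)).div hJ hJ0).mul_const s).div_const 2).mul
        (tendsto_ip_zero hφ hφ))).sub
      ((tendsto_const_div_of_ne_zero (ε ^ 2) hJ hJ0).mul (tendsto_ip_zero hφ (hc (hχ hV hθ)))))
    simpa using h
  have hB : Tendsto (fun x => volumeQ ε s ν (v x) lam (V x) (U x) (w x) (φ x) (θ x)) l (𝓝 0) := by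
    unfold volumeQ
    have h := (((tendsto_ip_zero (hc hU) hV).add
      ((tendsto_ip_zero hV hV).const_mul (s * lam.re))).add
      ((tendsto_const_div_of_ne_zero (s * ν) (hv.const_mul 2) (mul_ne_zero two_ne_zero hvl.ne')).mul
        (tendsto_ip_zero hw hw))).add ((tendsto_ip_zero hφ hθ).const_mul (ε ^ 2))
    simpa using h
  unfold totalQ
  have h := ((hA.add (hB.const_mul κ₂)).add ((hP (γ := fun _ => 1) tendsto_const_nhds (hc hV)
    (hc hφ) (hc hθ)).const_mul κ₃)).add
    ((hP (tendsto_const_div_of_ne_zero (ε ^ 2) hJ hJ0) hV hφ hθ).const_mul (2 * lam.re))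
  simpa using h

theorem hasDerivAt_totalQ (hε : 0 < ε) (hs : 0 < s) (hν : 0 < ν)
    (hP : ProfileSystem T ν ε s v y E n)
    (hL : EigenSystem T ν ε s v y E n lam V U w z φ θ) (κ₂ κ₃ : ℝ)
    {x : ℝ} (hj0 : 0 < stiff T ν s (v x) (y x) (n x)) :
    HasDerivAt (totalQ T ν ε s κ₂ κ₃ v y E n lam V U w z φ θ)
      (energyRate T ν ε s (v x) (y x) (E x) (n x) lam (V x) (U x) (w x) (z x) (φ x) (θ x)
        + κ₂ * volumeRate T ν ε s (v x) (y x) (E x) (n x) lam (V x) (w x) (z x) (φ x) (θ x)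
        + κ₃ * poissonRate ε (v x) (E x) (n x) 1 0 (lam * V x) (lam * φ x) (lam * θ x)
        + 2 * lam.re * poissonRate ε (v x) (E x) (n x) (ε ^ 2 / stiff T ν s (v x) (y x) (n x))
          (-(ε ^ 2 * stiffDeriv T ν s (v x) (y x) (E x) (n x) / stiff T ν s (v x) (y x) (n x) ^ 2))
          (V x) (φ x) (θ x)) x := by
  have h1 := hasDerivAt_energyQ hε hs hν hP hL hj0
  have h2 := hasDerivAt_volumeQ hε hs hν hP hL x
  have h3 := hasDerivAt_poissonQ (V := fun t => lam * V t) (w := fun t => lam * w t)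
    (φ := fun t => lam * φ t) (θ := fun t => lam * θ t) hε hP (hasDerivAt_const x (1 : ℝ))
    ((hL.hV x).const_mul lam) (((hL.hφ x).const_mul lam).congr_deriv (by ring))
    (((hL.hθ x).const_mul lam).congr_deriv (by ring))
  have h4 := hasDerivAt_poissonQ hε hP
    (((hasDerivAt_const x (ε ^ 2)).div (hasDerivAt_stiff hs hν hP x) hj0.ne').congr_deriv
      (g' := -(ε ^ 2 * stiffDeriv T ν s (v x) (y x) (E x) (n x) / stiff T ν s (v x) (y x) (n x) ^ 2))
      (by ring)) (hL.hV x) (hL.hφ x) (hL.hθ x)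
  exact ((h1.add (h2.const_mul κ₂)).add (h3.const_mul κ₃)).add (h4.const_mul (2 * lam.re))

end

/-- For profiles close to a constant state, with positive slope dominating the field, the integrated
eigenvalue system has no nonzero decaying solution with `0 ≤ Re λ`. -/
theorem eigenSystem_trivial {T ν ε m s₀ : ℝ} (hT : 0 < T) (hν : 0 < ν) (hε : 0 < ε) (hm : 0 < m)
    (hs₀ : 0 < s₀) (hson : s₀ ^ 2 * m ^ 2 = T + 1) (C : ℝ) :
    ∃ η : ℝ, 0 < η ∧ ∀ (s vl vr : ℝ) (v y E n : ℝ → ℝ), 0 < s → 0 < vl → 0 < vr →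
      ProfileSystem T ν ε s v y E n → |s - s₀| < η →
      (∀ x, |v x - m| < η ∧ |y x| < η ∧ |E x| < η ∧ |n x - 1 / m| < η) →
      (∀ x, 0 < y x ∧ |E x| ≤ C * y x) →
      Tendsto v atBot (𝓝 vl) → Tendsto y atBot (𝓝 0) → Tendsto E atBot (𝓝 0) →
      Tendsto n atBot (𝓝 (1 / vl)) → Tendsto v atTop (𝓝 vr) → Tendsto y atTop (𝓝 0) →
      Tendsto E atTop (𝓝 0) → Tendsto n atTop (𝓝 (1 / vr)) →
      ∀ (lam : ℂ) (V U w z φ θ : ℝ → ℂ), 0 ≤ lam.re →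
      EigenSystem T ν ε s v y E n lam V U w z φ θ →
      Tendsto V atBot (𝓝 0) → Tendsto U atBot (𝓝 0) → Tendsto z atBot (𝓝 0) →
      Tendsto φ atBot (𝓝 0) → Tendsto θ atBot (𝓝 0) →
      Tendsto V atTop (𝓝 0) → Tendsto U atTop (𝓝 0) → Tendsto z atTop (𝓝 0) →
      Tendsto φ atTop (𝓝 0) → Tendsto θ atTop (𝓝 0) → ∀ x, w x = 0 ∧ z x = 0 := by
  obtain ⟨κ₂, κ₃, c, hc, hev⟩ := total_rate_lower (ν := ν) (ε := ε) (C := C) hT hν hε hm hs₀ hson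
  rw [nearConst, eventually_inf_principal, Metric.eventually_nhds_iff] at hev
  obtain ⟨η, hη, hev⟩ := hev
  refine ⟨η, hη, ?_⟩
  intro s vl vr v y E n hs hvl hvr hP hsη hclose hcone v1 y1 E1 n1 v2 y2 E2 n2 lam V U w z φ θ hr hL
    V1 U1 z1 φ1 θ1 V2 U2 z2 φ2 θ2
  have hpt : ∀ x, _ := fun x => hev (y := (s, v x, y x, E x, n x)) (by
    obtain ⟨a1, a2, a3, a4⟩ := hclose x
    simp only [constState, Prod.dist_eq, Real.dist_eq, sub_zero, sup_lt_iff]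
    exact ⟨hsη, a1, a2, a3, a4⟩) (hcone x) s (v x) (y x) (E x) (n x) rfl
  have hs' : (s : ℂ) ≠ 0 := by exact_mod_cast hs.ne'
  have hw : w = fun t => (lam * V t - z t) / s := by
    funext t; rw [hL.hw t]; field_simp; ring
  have w0 : ∀ l : Filter ℝ, Tendsto V l (𝓝 0) → Tendsto z l (𝓝 0) → Tendsto w l (𝓝 0) := by
    intro l h1 h2
    rw [hw]
    simpa using ((h1.const_mul lam).sub h2).div_const (s : ℂ)
  have hD := fun x => hasDerivAt_totalQ hε hs hν hP hL κ₂ κ₃ (hpt x).1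
  have hlow := fun x => (hpt x).2 lam (V x) (U x) (w x) (z x) (φ x) (θ x) hr (hL.hw x)
  -- `totalQ` is monotone and vanishes at both ends, so its rate is zero, which forces `z` and `w`
  -- to vanish.
  have hz0 := eq_zero_of_deriv_nonneg hD (fun x => le_trans (by positivity) (hlow x))
    (tendsto_totalQ hT hvl κ₂ κ₃ v1 y1 E1 n1 V1 U1 (w0 _ V1 z1) z1 φ1 θ1)
    (tendsto_totalQ hT hvr κ₂ κ₃ v2 y2 E2 n2 V2 U2 (w0 _ V2 z2) z2 φ2 θ2)
  intro x
  have h1 := hlow x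
  rw [hz0 x] at h1
  have h2 : ‖z x‖ ^ 2 + ‖w x‖ ^ 2 ≤ 0 := nonpos_of_mul_nonpos_right h1 hc
  have h3 : ‖w x‖ ^ 2 = 0 := le_antisymm (by linarith [sq_nonneg ‖z x‖]) (sq_nonneg _)
  have h4 : ‖z x‖ ^ 2 = 0 := le_antisymm (by linarith [sq_nonneg ‖w x‖]) (sq_nonneg _)
  exact ⟨by simpa using h3, by simpa using h4⟩

/-! ### Invariant cones for nearly hyperbolic systems. -/

/-- A continuous function that vanishes at both ends and is positive somewhere attains its maximum. -/
theorem exists_forall_le_of_tendsto_zero {f : ℝ → ℝ} (hf : Continuous f)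
    (hbot : Tendsto f atBot (𝓝 0)) (htop : Tendsto f atTop (𝓝 0)) {x₀ : ℝ} (h0 : 0 < f x₀) :
    ∃ x₁, ∀ x, f x ≤ f x₁ := by
  refine hf.exists_forall_ge' x₀ ?_
  rw [cocompact_eq_atBot_atTop, eventually_sup]
  exact ⟨(hbot.eventually (gt_mem_nhds h0)).mono fun _ h => le_of_lt h,
    (htop.eventually (gt_mem_nhds h0)).mono fun _ h => le_of_lt h⟩

/-- Invariant cone estimate for the expanding component `p` of a bounded solution. -/
theorem expanding_le {μ κ α β b : ℝ} (hμ : 0 < μ) (hκ : 0 < κ) (hb : 0 < b)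
    (hbμ : b * (|α| + 2 * |β|) ≤ μ / 2) {η : ℝ} (hη0 : 0 ≤ η)
    (hη : η * (3 + 1 / b) * (4 + 2 * b) ≤ μ / 2) {p q z p' q' z' : ℝ → ℝ}
    (hp : ∀ x, HasDerivAt p (p' x) x) (hq : ∀ x, HasDerivAt q (q' x) x)
    (hz : ∀ x, HasDerivAt z (z' x) x)
    (ep : ∀ x, |p' x - μ * p x| ≤ η * (|p x| + |q x| + |z x|))
    (eq : ∀ x, |q' x + κ * q x| ≤ η * (|p x| + |q x| + |z x|))
    (ez : ∀ x, |z' x - (α * p x + β * q x)| ≤ η * (|p x| + |q x| + |z x|))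
    (p1 : Tendsto p atBot (𝓝 0)) (q1 : Tendsto q atBot (𝓝 0)) (z1 : Tendsto z atBot (𝓝 0))
    (p2 : Tendsto p atTop (𝓝 0)) (q2 : Tendsto q atTop (𝓝 0)) (z2 : Tendsto z atTop (𝓝 0))
    (x : ℝ) : p x ^ 2 ≤ b ^ 2 * z x ^ 2 + q x ^ 2 / 2 := by
  by_contra! hlt
  -- Where `N > 0` one has `|q| ≤ 2 |p|` and `b |z| ≤ |p|`, so the expansion of `p` dominates and
  -- `N' > 0`. But `N` vanishes at both ends, and a positive maximum would be a critical point. The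
  -- small weight `b` weakens the driving of `z` by `p` and `q`.
  set N : ℝ → ℝ := fun x => p x ^ 2 - b ^ 2 * z x ^ 2 - q x ^ 2 / 2 with hN
  have hD : ∀ x, HasDerivAt N
      (2 * p x * p' x - b ^ 2 * (2 * z x * z' x) - 2 * q x * q' x / 2) x := fun x => by
    have h := ((((hp x).pow 2).sub (((hz x).pow 2).const_mul (b ^ 2))).sub
      (((hq x).pow 2).div_const 2))
    refine h.congr_deriv ?_
    norm_num
  have hlim : ∀ l : Filter ℝ, Tendsto p l (𝓝 0) → Tendsto q l (𝓝 0) → Tendsto z l (𝓝 0) →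
      Tendsto N l (𝓝 0) := fun l h1 h2 h3 => by
    simpa using ((h1.pow 2).sub ((h3.pow 2).const_mul (b ^ 2))).sub ((h2.pow 2).div_const 2)
  have hcont : Continuous N := continuous_iff_continuousAt.2 fun x => (hD x).continuousAt
  have hNx : 0 < N x := by simp only [hN]; linarith
  obtain ⟨x₁, hx₁⟩ := exists_forall_le_of_tendsto_zero hcont (hlim _ p1 q1 z1) (hlim _ p2 q2 z2) hNx
  have hpos : 0 < N x₁ := hNx.trans_le (hx₁ x)
  have hcrit := IsLocalMax.hasDerivAt_eq_zero (Eventually.of_forall hx₁) (hD x₁)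
  have ep := ep x₁
  have eq := eq x₁
  have ez := ez x₁
  simp only [hN] at hpos
  generalize p x₁ = p, q x₁ = q, z x₁ = z, p' x₁ = p', q' x₁ = q', z' x₁ = z' at *
  have hpp : 0 < p ^ 2 := by nlinarith [sq_nonneg (b * z), sq_nonneg q]
  have hp0 : 0 < |p| := abs_pos.2 fun h => by simp [h] at hpp
  have hqp : |q| ≤ 2 * |p| := by
    refine abs_le_of_sq_le_sq' ?_ (by positivity) |> fun h => abs_le.2 h
    rw [mul_pow, sq_abs]; nlinarith [sq_nonneg (b * z)]
  have hzp : b * |z| ≤ |p| := by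
    rw [← abs_of_pos hb, ← abs_mul]
    refine sq_le_sq.1 ?_
    nlinarith [sq_nonneg q]
  set S := |p| + |q| + |z|
  have hS : S ≤ (3 + 1 / b) * |p| := by
    have : |z| ≤ 1 / b * |p| := by
      rw [one_div, ← div_eq_inv_mul, le_div_iff₀ hb]; linarith
    simp only [S]; linarith
  have hr : η * S ≤ η * (3 + 1 / b) * |p| := by
    rw [mul_assoc]; exact mul_le_mul_of_nonneg_left hS hη0
  set R := η * (3 + 1 / b) * |p| with hR
  have hR0 : 0 ≤ R := by positivity
  have t1 : -(2 * |p| * R) ≤ 2 * p * (p' - μ * p) := by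
    have : |2 * p * (p' - μ * p)| ≤ 2 * |p| * R := by
      rw [abs_mul, abs_mul, abs_two]
      exact mul_le_mul_of_nonneg_left (ep.trans hr) (by positivity)
    linarith [neg_abs_le (2 * p * (p' - μ * p))]
  have t2 : q * (q' + κ * q) ≤ 2 * |p| * R := by
    refine (le_abs_self _).trans ?_
    rw [abs_mul]
    exact mul_le_mul hqp (eq.trans hr) (abs_nonneg _) (by positivity)
  have t3 : b ^ 2 * (2 * z * (z' - (α * p + β * q))) ≤ 2 * b * |p| * R := by
    refine (le_abs_self _).trans ?_
    have h : |b ^ 2 * (2 * z * (z' - (α * p + β * q)))|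
        = 2 * b * (b * |z|) * |z' - (α * p + β * q)| := by
      rw [abs_mul, abs_mul, abs_mul, abs_two, abs_of_pos (pow_pos hb 2)]; ring
    rw [h]
    exact mul_le_mul (mul_le_mul_of_nonneg_left hzp (by positivity)) (ez.trans hr)
      (abs_nonneg _) (by positivity)
  have t4 : b ^ 2 * (2 * z * (α * p + β * q)) ≤ 2 * b * |p| * ((|α| + 2 * |β|) * |p|) := by
    refine (le_abs_self _).trans ?_
    have h : |b ^ 2 * (2 * z * (α * p + β * q))| = 2 * b * (b * |z|) * |α * p + β * q| := by
      rw [abs_mul, abs_mul, abs_mul, abs_two, abs_of_pos (pow_pos hb 2)]; ring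
    rw [h]
    refine mul_le_mul (mul_le_mul_of_nonneg_left hzp (by positivity)) ?_
      (abs_nonneg _) (by positivity)
    refine (abs_add_le _ _).trans ?_
    rw [abs_mul, abs_mul]
    linarith [mul_le_mul_of_nonneg_left hqp (abs_nonneg β)]
  have hsq : |p| * |p| = p ^ 2 := by rw [← sq, sq_abs]
  have t5 : 2 * b * |p| * ((|α| + 2 * |β|) * |p|) ≤ μ * p ^ 2 := by
    have : 2 * b * |p| * ((|α| + 2 * |β|) * |p|) = 2 * (b * (|α| + 2 * |β|)) * p ^ 2 := by
      rw [← hsq]; ring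
    rw [this]
    exact mul_le_mul_of_nonneg_right (by linarith) hpp.le
  have t6 : (4 + 2 * b) * |p| * R ≤ μ / 2 * p ^ 2 := by
    have : (4 + 2 * b) * |p| * R = η * (3 + 1 / b) * (4 + 2 * b) * p ^ 2 := by
      rw [hR, ← hsq]; ring
    rw [this]
    exact mul_le_mul_of_nonneg_right hη hpp.le
  have t7 : 0 ≤ κ * q ^ 2 := by positivity
  have t8 : 0 < μ * p ^ 2 := by positivity
  linarith

/-- If `p` is expanding, `q` contracting and `z` is driven by `p` and `q` up to small errors, then a
solution decaying at both ends has `p` and `q` dominated by `z`. -/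
theorem hyperbolic_le_slow {μ κ : ℝ} (α β : ℝ) (hμ : 0 < μ) (hκ : 0 < κ) {τ : ℝ} (hτ : 0 < τ) :
    ∃ η : ℝ, 0 < η ∧ ∀ p q z p' q' z' : ℝ → ℝ,
      (∀ x, HasDerivAt p (p' x) x) → (∀ x, HasDerivAt q (q' x) x) →
      (∀ x, HasDerivAt z (z' x) x) →
      (∀ x, |p' x - μ * p x| ≤ η * (|p x| + |q x| + |z x|)) →
      (∀ x, |q' x + κ * q x| ≤ η * (|p x| + |q x| + |z x|)) →
      (∀ x, |z' x - (α * p x + β * q x)| ≤ η * (|p x| + |q x| + |z x|)) →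
      Tendsto p atBot (𝓝 0) → Tendsto q atBot (𝓝 0) → Tendsto z atBot (𝓝 0) →
      Tendsto p atTop (𝓝 0) → Tendsto q atTop (𝓝 0) → Tendsto z atTop (𝓝 0) →
      ∀ x, |p x| ≤ τ * |z x| ∧ |q x| ≤ τ * |z x| := by
  obtain ⟨b, hb, hb1, hb2, hb3⟩ : ∃ b : ℝ, 0 < b ∧ b * (|α| + 2 * |β|) ≤ μ / 2 ∧
      b * (|-β| + 2 * |-α|) ≤ κ / 2 ∧ 2 * b ≤ τ := by
    have hA : 0 < 2 * |α| + 2 * |β| + 1 := by positivity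
    have hm : 0 < min (min (μ / 2) (κ / 2)) τ / 2 := by positivity
    refine ⟨min (min (μ / 2) (κ / 2)) τ / 2 / (2 * |α| + 2 * |β| + 1), by positivity, ?_, ?_, ?_⟩
    · rw [div_mul_eq_mul_div, div_le_iff₀ hA]
      have h1 : min (min (μ / 2) (κ / 2)) τ ≤ μ / 2 := (min_le_left _ _).trans (min_le_left _ _)
      exact mul_le_mul (by linarith) (by linarith [abs_nonneg α]) (by positivity) (by positivity)
    · rw [div_mul_eq_mul_div, div_le_iff₀ hA, abs_neg, abs_neg]
      have h1 : min (min (μ / 2) (κ / 2)) τ ≤ κ / 2 := (min_le_left _ _).trans (min_le_right _ _)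
      exact mul_le_mul (by linarith) (by linarith [abs_nonneg β]) (by positivity) (by positivity)
    · have h1 : min (min (μ / 2) (κ / 2)) τ ≤ τ := min_le_right _ _
      have h2 : min (min (μ / 2) (κ / 2)) τ / 2 / (2 * |α| + 2 * |β| + 1)
          ≤ min (min (μ / 2) (κ / 2)) τ / 2 :=
        div_le_self hm.le (by linarith [abs_nonneg α, abs_nonneg β])
      linarith
  have hB : 0 < (3 + 1 / b) * (4 + 2 * b) := by positivity
  have hm : 0 < min (μ / 2) (κ / 2) := by positivity
  refine ⟨min (μ / 2) (κ / 2) / ((3 + 1 / b) * (4 + 2 * b)), by positivity, ?_⟩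
  set η := min (μ / 2) (κ / 2) / ((3 + 1 / b) * (4 + 2 * b)) with hη
  have hη0 : 0 ≤ η := by positivity
  have e : η * (3 + 1 / b) * (4 + 2 * b) = min (μ / 2) (κ / 2) := by
    rw [mul_assoc, hη, div_mul_cancel₀ _ hB.ne']
  intro p q z p' q' z' hp hq hz ep eq ez p1 q1 z1 p2 q2 z2 x
  have h1 := expanding_le hμ hκ hb hb1 hη0 (e.trans_le (min_le_left _ _)) hp hq hz ep eq ez
    p1 q1 z1 p2 q2 z2 x
  have hrefl : ∀ {f f' : ℝ → ℝ}, (∀ x, HasDerivAt f (f' x) x) →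
      ∀ x, HasDerivAt (fun t => f (-t)) (-f' (-x)) x := fun hf x =>
    ((hf (-x)).comp x (hasDerivAt_neg x)).congr_deriv (by ring)
  -- Reflection `x ↦ -x` exchanges the expanding and the contracting component.
  have h2 := expanding_le (p := fun t => q (-t)) (q := fun t => p (-t)) (z := fun t => z (-t))
    (α := -β) (β := -α) hκ hμ hb hb2 hη0
    (e.trans_le (min_le_right _ _)) (hrefl hq) (hrefl hp) (hrefl hz)
    (fun x => by
      have := eq (-x)
      rw [← abs_neg] at this
      convert this using 2 <;> ring)
    (fun x => by
      have := ep (-x)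
      rw [← abs_neg] at this
      convert this using 2 <;> ring)
    (fun x => by
      have := ez (-x)
      rw [← abs_neg] at this
      convert this using 2 <;> ring)
    (q2.comp tendsto_neg_atBot_atTop) (p2.comp tendsto_neg_atBot_atTop)
    (z2.comp tendsto_neg_atBot_atTop) (q1.comp tendsto_neg_atTop_atBot)
    (p1.comp tendsto_neg_atTop_atBot) (z1.comp tendsto_neg_atTop_atBot) (-x)
  simp only [neg_neg] at h2
  -- The inequalities `p² ≤ b² z² + q²/2` and `q² ≤ b² z² + p²/2` together bound both squares by `2
  -- b² z²`; the factor 4 is merely convenient.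
  have hfin : ∀ a : ℝ, a ^ 2 ≤ 4 * (b ^ 2 * z x ^ 2) → |a| ≤ τ * |z x| := fun a ha => by
    have h3 : |a| ≤ 2 * b * |z x| := by
      refine abs_le_of_sq_le_sq' ?_ (by positivity) |> fun h => abs_le.2 h
      rw [mul_pow, mul_pow, sq_abs]; linarith
    exact h3.trans (mul_le_mul_of_nonneg_right hb3 (abs_nonneg _))
  have h4 : 0 ≤ b ^ 2 * z x ^ 2 := by positivity
  exact ⟨hfin _ (by linarith), hfin _ (by linarith)⟩

/-! ### Behaviour of the profile at infinity. -/

/-- Filters at infinity, described by their stability under bounded shifts. -/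
def ShiftStable (l : Filter ℝ) : Prop :=
  ∀ ξ : ℝ → ℝ, (∀ x, x ≤ ξ x ∧ ξ x ≤ x + 1) → Tendsto ξ l l

theorem shiftStable_atTop : ShiftStable atTop := fun _ h =>
  tendsto_atTop_mono (fun x => (h x).1) tendsto_id

theorem shiftStable_atBot : ShiftStable atBot := fun _ h =>
  tendsto_atBot_mono (fun x => (h x).2) (tendsto_atBot_add_const_right _ 1 tendsto_id)

/-- The mean value theorem on `[x, x + 1]`: a convergent function has small increments, hence a
small slope at some point within distance 1. -/
theorem exists_slope_tendsto_zero {l : Filter ℝ} (hl : ShiftStable l) {f g v : ℝ → ℝ} {a b : ℝ}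
    (hf : ∀ x, HasDerivAt f (v x * g x) x) (hfl : Tendsto f l (𝓝 a)) (hv : Tendsto v l (𝓝 b))
    (hb : 0 < b) (hv0 : ∀ x, 0 < v x) :
    ∃ ξ : ℝ → ℝ, (∀ x, x < ξ x ∧ ξ x < x + 1) ∧ Tendsto (fun x => g (ξ x)) l (𝓝 0) := by
  have hmv : ∀ x, ∃ c, (x < c ∧ c < x + 1) ∧ v c * g c = f (x + 1) - f x := fun x => by
    obtain ⟨c, hc, h⟩ := exists_hasDerivAt_eq_slope f (fun t => v t * g t) (lt_add_one x)
      (fun t _ => (hf t).continuousAt.continuousWithinAt) (fun t _ => hf t)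
    exact ⟨c, hc, by simpa using h⟩
  choose ξ h1 h2 using hmv
  refine ⟨ξ, h1, ?_⟩
  have e1 := hl (fun x => x + 1) fun x => ⟨by linarith, le_rfl⟩
  have e2 := hl ξ fun x => ⟨(h1 x).1.le, (h1 x).2.le⟩
  have e3 : (fun x => g (ξ x)) = fun x => (f (x + 1) - f x) / v (ξ x) := by
    funext x
    rw [← h2 x]
    field_simp [(hv0 (ξ x)).ne']
  rw [e3]
  have h := ((hfl.comp e1).sub hfl).div (hv.comp e2) hb.ne'
  rw [sub_self, zero_div] at h
  exact h

/-- `g` is small at some point within distance 1 of `x`, and `g' → 0` lets it change little on the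
way. Only convergence of the profile is assumed, so decay of its derivatives has to be earned in
this manner. -/
theorem tendsto_zero_of_slope {l : Filter ℝ} (hl : ShiftStable l) {f g g' v : ℝ → ℝ} {a b : ℝ}
    (hf : ∀ x, HasDerivAt f (v x * g x) x) (hg : ∀ x, HasDerivAt g (g' x) x)
    (hfl : Tendsto f l (𝓝 a)) (hv : Tendsto v l (𝓝 b)) (hb : 0 < b) (hv0 : ∀ x, 0 < v x)
    (hg' : Tendsto g' l (𝓝 0)) : Tendsto g l (𝓝 0) := by
  obtain ⟨ξ, h1, h2⟩ := exists_slope_tendsto_zero hl hf hfl hv hb hv0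
  have hmv : ∀ x, ∃ c, (x < c ∧ c < ξ x) ∧ g' c * (ξ x - x) = g (ξ x) - g x := fun x => by
    obtain ⟨c, hc, h⟩ := exists_hasDerivAt_eq_slope g g' (h1 x).1
      (fun t _ => (hg t).continuousAt.continuousWithinAt) (fun t _ => hg t)
    refine ⟨c, hc, ?_⟩
    rw [h, div_mul_cancel₀ _ (sub_pos.2 (h1 x).1).ne']
  choose ζ h3 h4 using hmv
  have e1 := hg'.comp (hl ζ fun x => ⟨(h3 x).1.le, by linarith [(h3 x).2, (h1 x).2]⟩)
  have e2 : Tendsto (fun x => g' (ζ x) * (ξ x - x)) l (𝓝 0) := by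
    refine squeeze_zero_norm (fun x => ?_) (tendsto_zero_iff_norm_tendsto_zero.1 e1)
    rw [norm_mul]
    refine mul_le_of_le_one_right (norm_nonneg _) ?_
    rw [Real.norm_eq_abs, abs_le]
    constructor <;> linarith [(h1 x).1, (h1 x).2]
  have e3 : g = fun x => g (ξ x) - g' (ζ x) * (ξ x - x) := by
    funext x; rw [h4]; ring
  rw [e3]
  simpa using h2.sub e2

section

variable {T ν ε s vm um vp up : ℝ} {v u φ : ℝ → ℝ}

theorem IsShockProfile.profileSystem (hs : 0 < s) (hν : 0 < ν) (hε : 0 < ε)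
    (h : IsShockProfile T ν ε s vm um vp up v u φ) :
    ProfileSystem T ν ε s v (fun x => deriv v x / v x) (fun x => deriv φ x / v x)
      (fun x => Real.exp (φ x)) := by
  have hv0 := fun x => (h.v_pos x).ne'
  have dv : ∀ x, HasDerivAt v (deriv v x) x := fun x =>
    (h.smooth_v.differentiable (by simp) x).hasDerivAt
  have dφ : ∀ x, HasDerivAt φ (deriv φ x) x := fun x =>
    (h.smooth_φ.differentiable (by simp) x).hasDerivAt
  have sv' : ContDiff ℝ ∞ (deriv v) := (contDiff_infty_iff_deriv.1 h.smooth_v).2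
  have sφ' : ContDiff ℝ ∞ (deriv φ) := (contDiff_infty_iff_deriv.1 h.smooth_φ).2
  have dv' : ∀ x, HasDerivAt (deriv v) (deriv (deriv v) x) x := fun x =>
    (sv'.differentiable (by simp) x).hasDerivAt
  have dφ' : ∀ x, HasDerivAt (deriv φ) (deriv (deriv φ) x) x := fun x =>
    (sφ'.differentiable (by simp) x).hasDerivAt
  have hu : deriv u = fun x => -s * deriv v x := by
    funext x; linarith [h.mass x]
  refine ⟨h.v_pos, fun x => Real.exp_pos _, fun x => ?_, fun x => ?_, fun x => ?_, fun x => ?_⟩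
  · refine (dv x).congr_deriv ?_
    have := hv0 x
    field_simp
  · have hy : HasDerivAt (fun t => deriv v t / v t) _ x := (dv' x).div (dv x) (hv0 x)
    have e1 : deriv (fun y => T / v y) x = -(T * deriv v x) / v x ^ 2 := by
      rw [((hasDerivAt_const x T).fun_div (dv x) (hv0 x)).deriv]; ring
    have e2 : deriv (fun y => ν * deriv u y / v y) x
        = ν * -s * ((deriv (deriv v) x * v x - deriv v x * deriv v x) / v x ^ 2) := by
      have : (fun y => ν * deriv u y / v y) = fun y => ν * -s * (deriv v y / v y) := by
        funext y; rw [hu]; ring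
      rw [this, (hy.const_mul (ν * -s)).deriv]
    refine hy.congr_deriv ?_
    have e3 := h.momentum x
    rw [e1, e2, hu] at e3
    have := hv0 x
    field_simp at e3 ⊢
    linarith
  · have hE : HasDerivAt (fun t => deriv φ t / v t) _ x := (dφ' x).div (dv x) (hv0 x)
    refine hE.congr_deriv ?_
    have e3 := h.poisson x
    rw [hE.deriv] at e3
    rw [eq_div_iff (by positivity)]
    linarith
  · refine (dφ x).exp.congr_deriv ?_
    have := hv0 x
    field_simp

/-- The first integral of the travelling-wave equations. -/
theorem tendsto_exp_of_tendsto_neg_log {l : Filter ℝ} {a : ℝ} (ha : 0 < a)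
    (h : Tendsto φ l (𝓝 (-Real.log a))) : Tendsto (fun x => Real.exp (φ x)) l (𝓝 (1 / a)) := by
  have h' := (Real.continuous_exp.tendsto _).comp h
  rw [Real.exp_neg, Real.exp_log ha] at h'
  simpa [Function.comp_def] using h'

/-- The electric force is exact: the Poisson equation gives `(n - ε² E²/2)' = E`. -/
theorem ProfileSystem.first_integral {y E n : ℝ → ℝ} (hs : 0 < s) (hν : 0 < ν) (hε : 0 < ε)
    (hP : ProfileSystem T ν ε s v y E n) :
    ∃ c, ∀ x, s * ν * y x = c - (s ^ 2 * v x + T / v x + n x - ε ^ 2 * E x ^ 2 / 2) := by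
  have hD : ∀ x, HasDerivAt (fun x => s * ν * y x
      + (s ^ 2 * v x + T / v x + n x - ε ^ 2 * E x ^ 2 / 2)) 0 x := fun x => by
    have hv0 := (hP.v_pos x).ne'
    have h := ((hP.hy x).const_mul (s * ν)).add ((((hP.hv x).const_mul (s ^ 2)).add
      (((hasDerivAt_const x T).fun_div (hP.hv x) hv0))).add (hP.hn x) |>.sub
      ((((hP.hE x).fun_pow 2).const_mul (ε ^ 2)).div_const 2))
    refine h.congr_deriv ?_
    norm_num
    field_simp
    ring
  have hc := is_const_of_deriv_eq_zero (fun x => (hD x).differentiableAt) fun x => (hD x).deriv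
  exact ⟨s * ν * y 0 + (s ^ 2 * v 0 + T / v 0 + n 0 - ε ^ 2 * E 0 ^ 2 / 2), fun x => by
    linarith [hc x 0]⟩

/-- For `E` the Poisson equation supplies `E' → 0`. The first integral then shows that `y` has a
limit, which must be zero because `v` converges. -/
theorem ProfileSystem.tendsto {y E n φ : ℝ → ℝ} {l : Filter ℝ} [l.NeBot] (hl : ShiftStable l)
    {vl φl : ℝ} (hs : 0 < s) (hν : 0 < ν) (hε : 0 < ε) (hP : ProfileSystem T ν ε s v y E n)
    (hφ : ∀ x, HasDerivAt φ (v x * E x) x) (hv : Tendsto v l (𝓝 vl)) (hvl : 0 < vl)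
    (hφl : Tendsto φ l (𝓝 φl)) (hn : Tendsto n l (𝓝 (1 / vl))) :
    Tendsto y l (𝓝 0) ∧ Tendsto E l (𝓝 0) := by
  have hE : Tendsto E l (𝓝 0) := by
    refine tendsto_zero_of_slope hl hφ hP.hE hφl hv hvl hP.v_pos ?_
    have := ((hv.mul hn).sub_const 1).div_const (ε ^ 2)
    simpa [hvl.ne'] using this
  refine ⟨?_, hE⟩
  obtain ⟨c, hc⟩ := hP.first_integral hs hν hε
  obtain ⟨d, hd⟩ : ∃ d, Tendsto y l (𝓝 d) := by
    have e : y = fun x => (c - (s ^ 2 * v x + T / v x + n x - ε ^ 2 * E x ^ 2 / 2)) / (s * ν) := by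
      funext x; rw [← hc x]; field_simp
    rw [e]
    exact ⟨_, ((((hv.const_mul (s ^ 2)).add (tendsto_const_nhds.div hv hvl.ne')).add hn).sub
      (((hE.pow 2).const_mul (ε ^ 2)).div_const 2)).const_sub c |>.div_const (s * ν)⟩
  obtain ⟨ξ, h1, h2⟩ := exists_slope_tendsto_zero hl hP.hv hv hv hvl hP.v_pos
  have h3 := hd.comp (hl ξ fun x => ⟨(h1 x).1.le, (h1 x).2.le⟩)
  rw [tendsto_nhds_unique h3 h2] at hd
  exact hd

end

/-! ### Entropy, maximum principles and closeness to the constant state. -/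

theorem exists_forall_ge_of_tendsto {f : ℝ → ℝ} (hf : Continuous f) {a b : ℝ}
    (hbot : Tendsto f atBot (𝓝 a)) (htop : Tendsto f atTop (𝓝 b)) {x₀ : ℝ} (ha : f x₀ < a)
    (hb : f x₀ < b) : ∃ x₁, ∀ x, f x₁ ≤ f x := by
  refine hf.exists_forall_le' x₀ ?_
  rw [cocompact_eq_atBot_atTop, eventually_sup]
  exact ⟨(hbot.eventually (lt_mem_nhds ha)).mono fun _ h => le_of_lt h,
    (htop.eventually (lt_mem_nhds hb)).mono fun _ h => le_of_lt h⟩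

/-- A negative second derivative would make the point a local maximum as well, so `f` would be
locally constant. -/
theorem deriv_deriv_nonneg_of_isLocalMin {f : ℝ → ℝ} {x : ℝ} (h : IsLocalMin f x)
    (hc : ContinuousAt f x) : 0 ≤ deriv (deriv f) x := by
  by_contra! hlt
  have hmax := isLocalMax_of_deriv_deriv_neg hlt h.deriv_eq_zero hc
  have hconst : f =ᶠ[𝓝 x] fun _ => f x := by
    filter_upwards [h, hmax] with t h1 h2
    exact le_antisymm h2 h1
  have h2 := hconst.deriv
  simp only [deriv_const'] at h2
  rw [h2.deriv_eq, deriv_const] at hlt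
  exact lt_irrefl _ hlt

/-- A travelling wave of the Navier--Stokes--Poisson system, in the variables of `ProfileSystem`,
connecting the quasi-neutral states with specific volumes `m < M` at the Rankine--Hugoniot speed. -/
structure Connects (T ν ε s m M : ℝ) (v y E n φ : ℝ → ℝ) : Prop where
  sys : ProfileSystem T ν ε s v y E n
  hφ : ∀ x, HasDerivAt φ (v x * E x) x
  hn : ∀ x, n x = Real.exp (φ x)
  T_pos : 0 < T
  ν_pos : 0 < ν
  ε_pos : 0 < ε
  s_pos : 0 < s
  m_pos : 0 < m
  m_lt : m < M
  speed : s ^ 2 * (m * M) = T + 1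
  v_bot : Tendsto v atBot (𝓝 m)
  v_top : Tendsto v atTop (𝓝 M)
  φ_bot : Tendsto φ atBot (𝓝 (-Real.log m))
  φ_top : Tendsto φ atTop (𝓝 (-Real.log M))
  y_bot : Tendsto y atBot (𝓝 0)
  y_top : Tendsto y atTop (𝓝 0)
  E_bot : Tendsto E atBot (𝓝 0)
  E_top : Tendsto E atTop (𝓝 0)

/-- The entropy of the constant state `v`, relative to the state `m`. -/
def relEntropy (T s m v : ℝ) : ℝ := s ^ 2 * (v ^ 2 - m ^ 2) / 2 - (T + 1) * (Real.log v - Real.log m)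

namespace Connects

variable {T ν ε s m M : ℝ} {v y E n φ : ℝ → ℝ}

/-- The entropy flux along the profile, normalized to vanish at `-∞`. -/
def entropy (T ν s m : ℝ) (v y φ : ℝ → ℝ) (x : ℝ) : ℝ :=
  s * ν * (v x * y x) + relEntropy T s m (v x) + (φ x + Real.log (v x))

/-- The momentum equation multiplied by `v`. The electric term `v E` is `φ'`, and viscosity leaves
the production `s ν v y² ≥ 0`. The logarithm is added and subtracted so that the potential appears
through `φ + log v`, which vanishes in neutral states. -/
theorem hasDerivAt_entropy (h : Connects T ν ε s m M v y E n φ) (x : ℝ) :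
    HasDerivAt (entropy T ν s m v y φ) (s * ν * v x * y x ^ 2) x := by
  have hv0 := (h.sys.v_pos x).ne'
  have hs := h.s_pos.ne'
  have hν := h.ν_pos.ne'
  unfold entropy relEntropy
  have d := ((((h.sys.hv x).fun_mul (h.sys.hy x)).const_mul (s * ν)).add
    ((((((h.sys.hv x).fun_pow 2).sub_const (m ^ 2)).const_mul (s ^ 2)).div_const 2).sub
      ((((h.sys.hv x).log hv0).sub_const (Real.log m)).const_mul (T + 1)))).add
    ((h.hφ x).add ((h.sys.hv x).log hv0))
  refine d.congr_deriv ?_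
  norm_num
  field_simp
  ring

theorem continuous_v (h : Connects T ν ε s m M v y E n φ) : Continuous v :=
  continuous_iff_continuousAt.2 fun x => (h.sys.hv x).continuousAt

theorem continuous_φ (h : Connects T ν ε s m M v y E n φ) : Continuous φ :=
  continuous_iff_continuousAt.2 fun x => (h.hφ x).continuousAt

theorem M_pos (h : Connects T ν ε s m M v y E n φ) : 0 < M := h.m_pos.trans h.m_lt

theorem tendsto_quasineutral (h : Connects T ν ε s m M v y E n φ) :
    Tendsto (fun x => φ x + Real.log (v x)) atBot (𝓝 0) ∧
      Tendsto (fun x => φ x + Real.log (v x)) atTop (𝓝 0) := by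
  constructor
  · simpa using h.φ_bot.add (h.v_bot.log h.m_pos.ne')
  · simpa using h.φ_top.add (h.v_top.log h.M_pos.ne')

theorem tendsto_entropy (h : Connects T ν ε s m M v y E n φ) :
    Tendsto (entropy T ν s m v y φ) atBot (𝓝 0) ∧
      Tendsto (entropy T ν s m v y φ) atTop (𝓝 (relEntropy T s m M)) := by
  have hc : ∀ a : ℝ, 0 < a → ContinuousAt (relEntropy T s m) a := fun a ha => by
    unfold relEntropy
    have := ha.ne'
    fun_prop (disch := assumption)
  constructor
  · have h1 := (((h.v_bot.mul h.y_bot).const_mul (s * ν)).add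
      ((hc m h.m_pos).tendsto.comp h.v_bot)).add h.tendsto_quasineutral.1
    have e0 : relEntropy T s m m = 0 := by simp [relEntropy]
    simp only [mul_zero, add_zero, e0] at h1
    exact h1
  · have h1 := (((h.v_top.mul h.y_top).const_mul (s * ν)).add
      ((hc M h.M_pos).tendsto.comp h.v_top)).add h.tendsto_quasineutral.2
    simp only [mul_zero, zero_add, add_zero] at h1
    exact h1

theorem entropy_mono (h : Connects T ν ε s m M v y E n φ) : Monotone (entropy T ν s m v y φ) :=
  monotone_of_hasDerivAt_nonneg h.hasDerivAt_entropy fun x => by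
    have := h.sys.v_pos x
    have := h.s_pos
    have := h.ν_pos
    positivity

theorem entropy_nonneg (h : Connects T ν ε s m M v y E n φ) (x : ℝ) :
    0 ≤ entropy T ν s m v y φ x :=
  h.entropy_mono.le_of_tendsto h.tendsto_entropy.1 x

theorem entropy_le (h : Connects T ν ε s m M v y E n φ) (x : ℝ) :
    entropy T ν s m v y φ x ≤ relEntropy T s m M :=
  h.entropy_mono.ge_of_tendsto h.tendsto_entropy.2 x

theorem slope_eq_zero_of_extr (h : Connects T ν ε s m M v y E n φ) {x : ℝ}
    (hx : IsLocalExtr v x) : y x = 0 := by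
  have h1 := hx.hasDerivAt_eq_zero (h.sys.hv x)
  exact (mul_eq_zero.1 h1).resolve_left (h.sys.v_pos x).ne'

/-- Minimum principle for the potential. -/
theorem neg_log_le_potential (h : Connects T ν ε s m M v y E n φ) {K : ℝ} (hMK : M ≤ K)
    (hvK : ∀ x, v x ≤ K) (x : ℝ) : -Real.log K ≤ φ x := by
  by_contra! hlt
  have hMl : Real.log M ≤ Real.log K := Real.log_le_log h.M_pos hMK
  have hml : Real.log m < Real.log M := Real.log_lt_log h.m_pos h.m_lt
  obtain ⟨x₁, hx₁⟩ := exists_forall_ge_of_tendsto h.continuous_φ h.φ_bot h.φ_top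
    (show φ x < -Real.log m by linarith) (show φ x < -Real.log M by linarith)
  have hmin : IsLocalMin φ x₁ := Eventually.of_forall hx₁
  have hvp := h.sys.v_pos x₁
  have hE0 : E x₁ = 0 := by
    have h1 := hmin.hasDerivAt_eq_zero (h.hφ x₁)
    exact (mul_eq_zero.1 h1).resolve_left hvp.ne'
  -- At the minimum `E = 0`, so `φ'' = v E'` has the sign of `v n - 1`, whereas `φ < -log v` there
  -- makes it negative.
  have h2 := deriv_deriv_nonneg_of_isLocalMin hmin (h.hφ x₁).continuousAt
  have hd : deriv φ = fun t => v t * E t := by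
    funext t; exact (h.hφ t).deriv
  rw [hd, ((h.sys.hv x₁).fun_mul (h.sys.hE x₁)).deriv, hE0] at h2
  have h3 : v x₁ * n x₁ < 1 := by
    have h4 : φ x₁ < -Real.log (v x₁) := by
      have := Real.log_le_log hvp (hvK x₁)
      linarith [hx₁ x]
    rw [h.hn, ← lt_div_iff₀' hvp, one_div, ← Real.exp_log (inv_pos.2 hvp), Real.log_inv]
    exact Real.exp_lt_exp.2 h4
  have hε := h.ε_pos
  have h5 : v x₁ * ((v x₁ * n x₁ - 1) / ε ^ 2) < 0 :=
    mul_neg_of_pos_of_neg hvp (div_neg_of_neg_of_pos (by linarith) (by positivity))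
  linarith

/-- At a maximum of `v` above `M` the slope vanishes and, by the minimum principle with `K` this
maximum, `φ + log v ≥ 0`. Hence the relative entropy there is at most that of `M`. But `s² M² ≥ T +
1`, so it increases strictly beyond `M`. -/
theorem v_le (h : Connects T ν ε s m M v y E n φ) (x : ℝ) : v x ≤ M := by
  by_contra! hlt
  obtain ⟨x₁, hx₁⟩ := exists_forall_ge_of_tendsto (f := fun t => -v t) h.continuous_v.neg
    h.v_bot.neg h.v_top.neg (show -v x < -m by linarith [h.m_lt]) (show -v x < -M by linarith)
  have hmax : ∀ t, v t ≤ v x₁ := fun t => by linarith [hx₁ t]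
  have hy : y x₁ = 0 := h.slope_eq_zero_of_extr (Or.inr (Eventually.of_forall hmax))
  have hMv : M < v x₁ := hlt.trans_le (hmax x)
  have h1 := h.neg_log_le_potential hMv.le hmax x₁
  have h2 := h.entropy_le x₁
  have hMp := h.M_pos
  simp only [entropy, relEntropy, hy] at h2
  have hr : Real.log (v x₁) - Real.log M < v x₁ / M - 1 := by
    rw [← Real.log_div (h.sys.v_pos x₁).ne' hMp.ne']
    refine Real.log_lt_sub_one_of_pos (div_pos (h.sys.v_pos x₁) hMp) ?_
    rw [Ne, div_eq_one_iff_eq hMp.ne']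
    exact hMv.ne'
  have hT := h.T_pos
  have h3 : (T + 1) * (v x₁ / M - 1) ≤ s ^ 2 * (v x₁ ^ 2 - M ^ 2) / 2 := by
    have hk : T + 1 ≤ s ^ 2 * M ^ 2 := by
      rw [← h.speed]
      have := h.m_lt.le
      have := h.s_pos
      gcongr
      nlinarith
    have e : s ^ 2 * (v x₁ ^ 2 - M ^ 2) / 2
        = s ^ 2 * M ^ 2 * ((v x₁ / M - 1) * (v x₁ / M + 1) / 2) := by field_simp; ring
    rw [e]
    have hr1 : 1 < v x₁ / M := by rw [one_lt_div hMp]; exact hMv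
    have hr2 : v x₁ / M - 1 ≤ (v x₁ / M - 1) * (v x₁ / M + 1) / 2 := by nlinarith
    exact mul_le_mul hk hr2 (by linarith) (by positivity)
  have h4 := mul_lt_mul_of_pos_left hr (show 0 < T + 1 by linarith)
  linarith

theorem neg_log_le (h : Connects T ν ε s m M v y E n φ) (x : ℝ) : -Real.log M ≤ φ x :=
  h.neg_log_le_potential le_rfl h.v_le x

theorem exists_min_of_lt (h : Connects T ν ε s m M v y E n φ) {x : ℝ} (hx : v x < m) :
    ∃ x₁, (∀ t, v x₁ ≤ v t) ∧ y x₁ = 0 := by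
  obtain ⟨x₁, hx₁⟩ := exists_forall_ge_of_tendsto h.continuous_v h.v_bot h.v_top hx
    (hx.trans h.m_lt)
  exact ⟨x₁, hx₁, h.slope_eq_zero_of_extr (Or.inl (Eventually.of_forall hx₁))⟩

/-- A lower bound for the specific volume depending only on `T` and `m`. -/
def volFloor (T m : ℝ) : ℝ := m * Real.exp (-((2 * T + 4) / T))

theorem volFloor_pos (hm : 0 < m) : 0 < volFloor T m := mul_pos hm (Real.exp_pos _)

/-- At a minimum of `v` the entropy contains `-(T+1) log v` and, since `φ ≥ -log M`, recovers at
most one `log v`. The remaining `-T log v` is bounded above because the entropy is. -/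
theorem volFloor_le_v (h : Connects T ν ε s m M v y E n φ) (hM : M ≤ 2 * m) (x : ℝ) :
    volFloor T m ≤ v x := by
  have hm := h.m_pos
  have hT := h.T_pos
  have hMp := h.M_pos
  have hle : volFloor T m ≤ m := by
    refine mul_le_of_le_one_right hm.le (Real.exp_le_one_iff.2 ?_)
    rw [neg_nonpos]; positivity
  by_contra! hlt
  obtain ⟨x₁, hx₁, hy⟩ := h.exists_min_of_lt (hlt.trans_le hle)
  have hv := h.sys.v_pos x₁
  have h1 := h.entropy_le x₁
  have h2 := h.neg_log_le x₁
  simp only [entropy, relEntropy, hy] at h1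
  have h3 : Real.log (v x₁) < Real.log m - (2 * T + 4) / T := by
    have := Real.log_lt_log hv ((hx₁ x).trans_lt hlt)
    rwa [volFloor, Real.log_mul hm.ne' (Real.exp_pos _).ne', Real.log_exp, ← sub_eq_add_neg] at this
  have h4 : Real.log M - Real.log m ≤ 1 := by
    rw [← Real.log_div hMp.ne' hm.ne']
    have h5 := Real.log_le_sub_one_of_pos (div_pos hMp hm)
    have h6 : M / m ≤ 2 := by rw [div_le_iff₀ hm]; linarith
    linarith
  have h5 : 0 ≤ Real.log M - Real.log m := by linarith [Real.log_lt_log hm h.m_lt]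
  have h6 : s ^ 2 * m ^ 2 ≤ T + 1 := by
    rw [← h.speed]
    have := h.m_lt.le
    gcongr
    nlinarith
  have h7 : s ^ 2 * M ^ 2 ≤ 2 * (T + 1) := by
    rw [← h.speed]
    have : s ^ 2 * M ^ 2 ≤ s ^ 2 * (2 * (m * M)) := by gcongr; nlinarith
    linarith
  have h8 : 0 ≤ s ^ 2 * v x₁ ^ 2 := by positivity
  have h9 : T * (Real.log (v x₁) - Real.log m) < -(2 * T + 4) := by
    have := mul_lt_mul_of_pos_left h3 hT
    have e : T * ((2 * T + 4) / T) = 2 * T + 4 := by field_simp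
    linarith
  nlinarith

/-- A constant bounding the deviation from quasi-neutrality in terms of the entropy production. -/
def neutralityConst (T ν ε m : ℝ) : ℝ :=
  ε ^ 2 / (2 * (ν * (Real.sqrt (T + 1) / (2 * m))) * volFloor T m ^ 2) /
    (2 * min (ε ^ 2 / (4 * m)) (Real.exp (-((2 * T + 4) / T + 1))))

theorem speed_ge (h : Connects T ν ε s m M v y E n φ) (hM : M ≤ 2 * m) :
    Real.sqrt (T + 1) / (2 * m) ≤ s := by
  have hm := h.m_pos
  rw [div_le_iff₀ (by positivity)]
  refine Real.sqrt_le_iff.2 ⟨by have := h.s_pos; positivity, ?_⟩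
  rw [← h.speed, mul_pow]
  gcongr
  nlinarith

/-- Coercivity of the Poisson nonlinearity in `ψ = φ + log v`, for which `v n - 1 = exp ψ - 1`. -/
theorem mul_exp_sub_one_ge {c t : ℝ} (hc : 0 ≤ c) (ht : -c ≤ t) :
    Real.exp (-c) * t ^ 2 ≤ t * (Real.exp t - 1) := by
  rcases le_or_gt 0 t with h0 | h0
  · have h1 := Real.add_one_le_exp t
    have h2 : Real.exp (-c) ≤ 1 := Real.exp_le_one_iff.2 (by linarith)
    nlinarith [sq_nonneg t]
  · have h1 := Real.add_one_le_exp (-t)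
    have h2 : Real.exp (-c) ≤ Real.exp t := Real.exp_le_exp.2 ht
    have h3 : Real.exp t * Real.exp (-t) = 1 := by rw [← Real.exp_add]; simp
    have h4 := Real.exp_pos t
    have h5 : Real.exp t * (-t) ≤ 1 - Real.exp t := by nlinarith
    nlinarith [sq_nonneg t]

/-- With `ψ = φ + log v`, the derivative of `ε² ψ E` is coercive in `ψ` and `ψ'` up to `ε² y²/(2
v)`, and `A` times the entropy production covers that defect. There is room for `σ ψ²` with `|σ| ≤
c`, so `ε² ψ E + A · entropy + σ ψ²` is monotone for both signs of `σ`. -/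
theorem sq_quasineutral_le (h : Connects T ν ε s m M v y E n φ) (hM : M ≤ 2 * m) (x : ℝ) :
    (φ x + Real.log (v x)) ^ 2 ≤ neutralityConst T ν ε m * relEntropy T s m M := by
  have hm := h.m_pos
  have hT := h.T_pos
  have hν := h.ν_pos
  have hε := h.ε_pos
  have hs := h.s_pos
  have hMp := h.M_pos
  have hfl := volFloor_pos (T := T) hm
  set ψ : ℝ → ℝ := fun x => φ x + Real.log (v x) with hψ
  set c := min (ε ^ 2 / (4 * m)) (Real.exp (-((2 * T + 4) / T + 1))) with hc
  have hc0 : 0 < c := lt_min (by positivity) (Real.exp_pos _)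
  set A := ε ^ 2 / (2 * (ν * (Real.sqrt (T + 1) / (2 * m))) * volFloor T m ^ 2) with hA
  have hA0 : 0 < A := by positivity
  have dψ : ∀ x, HasDerivAt ψ (v x * E x + y x) x := fun x => by
    have hv0 := (h.sys.v_pos x).ne'
    refine ((h.hφ x).add ((h.sys.hv x).log hv0)).congr_deriv ?_
    field_simp
  have dF : ∀ σ : ℝ, ∀ x, HasDerivAt (fun t => ε ^ 2 * (ψ t * E t) + A * entropy T ν s m v y φ t
      + σ * ψ t ^ 2)
      (ε ^ 2 * ((v x * E x + y x) * E x) + ψ x * (Real.exp (ψ x) - 1)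
        + A * (s * ν * v x * y x ^ 2) + σ * (2 * ψ x * (v x * E x + y x))) x := fun σ x => by
    have hv0 := (h.sys.v_pos x).ne'
    have e : v x * n x = Real.exp (ψ x) := by
      rw [hψ]; beta_reduce; rw [Real.exp_add, Real.exp_log (h.sys.v_pos x), h.hn]; ring
    refine (((((dψ x).fun_mul (h.sys.hE x)).const_mul (ε ^ 2)).add
      ((h.hasDerivAt_entropy x).const_mul A)).add (((dψ x).fun_pow 2).const_mul σ)).congr_deriv ?_
    rw [e]
    norm_num
    field_simp
  have hlow : ∀ x, 2 * c * |ψ x * (v x * E x + y x)| ≤ ε ^ 2 * ((v x * E x + y x) * E x)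
      + ψ x * (Real.exp (ψ x) - 1) + A * (s * ν * v x * y x ^ 2) := fun x => by
    have hv := h.sys.v_pos x
    have hvM : v x ≤ 2 * m := (h.v_le x).trans hM
    have hvf := h.volFloor_le_v hM x
    have h1 : -((2 * T + 4) / T + 1) ≤ ψ x := by
      have e1 := h.neg_log_le x
      have e2 := Real.log_le_log hfl hvf
      rw [volFloor, Real.log_mul hm.ne' (Real.exp_pos _).ne', Real.log_exp] at e2
      have e3 : Real.log M - Real.log m ≤ 1 := by
        rw [← Real.log_div hMp.ne' hm.ne']
        have h5 := Real.log_le_sub_one_of_pos (div_pos hMp hm)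
        have h6 : M / m ≤ 2 := by rw [div_le_iff₀ hm]; linarith
        linarith
      simp only [hψ]; linarith
    have h2 := mul_exp_sub_one_ge (by positivity) h1
    have h3 : c * ψ x ^ 2 ≤ ψ x * (Real.exp (ψ x) - 1) :=
      (mul_le_mul_of_nonneg_right (min_le_right _ _) (sq_nonneg _)).trans h2
    set d := v x * E x + y x with hd
    have h4 : c * d ^ 2 ≤ ε ^ 2 * d ^ 2 / (2 * v x) := by
      have : c ≤ ε ^ 2 / (2 * v x) := by
        refine (min_le_left _ _).trans ?_
        exact div_le_div_of_nonneg_left (by positivity) (by positivity) (by linarith)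
      calc c * d ^ 2 ≤ ε ^ 2 / (2 * v x) * d ^ 2 := mul_le_mul_of_nonneg_right this (sq_nonneg _)
        _ = _ := by ring
    have h5 : ε ^ 2 * y x ^ 2 / (2 * v x) ≤ A * (s * ν * v x * y x ^ 2) := by
      have hk : ε ^ 2 / (2 * (s * ν) * v x ^ 2) ≤ A := by
        rw [hA]
        refine div_le_div_of_nonneg_left (by positivity) (by positivity) ?_
        have := h.speed_ge hM
        rw [mul_comm s ν]
        gcongr
      calc ε ^ 2 * y x ^ 2 / (2 * v x)
          = ε ^ 2 / (2 * (s * ν) * v x ^ 2) * (s * ν * v x * y x ^ 2) := by field_simp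
        _ ≤ _ := mul_le_mul_of_nonneg_right hk (by positivity)
    have h6 : ε ^ 2 * (d * E x) = ε ^ 2 * d ^ 2 / (2 * v x) - ε ^ 2 * y x ^ 2 / (2 * v x)
        + ε ^ 2 * (v x * E x ^ 2) / 2 := by
      rw [hd]; field_simp; ring
    have h7 : 0 ≤ ε ^ 2 * (v x * E x ^ 2) / 2 := by positivity
    have h8 : 2 * c * |ψ x * d| ≤ c * ψ x ^ 2 + c * d ^ 2 := by
      have := two_mul_le_add_sq |ψ x| |d|
      rw [sq_abs, sq_abs] at this
      rw [abs_mul]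
      nlinarith
    linarith
  have hlim : ∀ σ : ℝ, ∀ l : Filter ℝ, ∀ a : ℝ, Tendsto ψ l (𝓝 0) → Tendsto E l (𝓝 0) →
      Tendsto (entropy T ν s m v y φ) l (𝓝 a) → Tendsto (fun t => ε ^ 2 * (ψ t * E t)
        + A * entropy T ν s m v y φ t + σ * ψ t ^ 2) l (𝓝 (A * a)) := fun σ l a h1 h2 h3 => by
    simpa using (((h1.mul h2).const_mul (ε ^ 2)).add (h3.const_mul A)).add ((h1.pow 2).const_mul σ)
  have hmono : ∀ σ : ℝ, |σ| ≤ c → Monotone (fun t => ε ^ 2 * (ψ t * E t)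
        + A * entropy T ν s m v y φ t + σ * ψ t ^ 2) := fun σ hσ =>
    monotone_of_hasDerivAt_nonneg (dF σ) fun x => by
      have h1 := hlow x
      have h2 : |σ * (2 * ψ x * (v x * E x + y x))| ≤ 2 * c * |ψ x * (v x * E x + y x)| := by
        rw [mul_assoc 2, mul_left_comm, abs_mul, abs_mul, abs_two, mul_assoc 2]
        gcongr
      have h3 := neg_abs_le (σ * (2 * ψ x * (v x * E x + y x)))
      simp only [Pi.zero_apply]
      linarith
  have hup := (hmono c (abs_of_pos hc0).le).ge_of_tendsto
    (hlim c _ _ h.tendsto_quasineutral.2 h.E_top h.tendsto_entropy.2) x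
  have hdn := (hmono (-c) (by rw [abs_neg, abs_of_pos hc0])).le_of_tendsto
    (hlim (-c) _ _ h.tendsto_quasineutral.1 h.E_bot h.tendsto_entropy.1) x
  -- Subtracting the bounds for `σ = c` and `σ = -c` cancels `ε² ψ E`, whose sign is unknown.
  have hfin : 2 * c * ψ x ^ 2 ≤ A * relEntropy T s m M := by linarith
  have e : neutralityConst T ν ε m = A / (2 * c) := rfl
  rw [e, div_mul_eq_mul_div, le_div_iff₀ (by positivity)]
  linarith

/-- Lower bound of the specific volume in terms of the entropy production. -/
theorem sq_one_sub_le (h : Connects T ν ε s m M v y E n φ) {Ψ : ℝ}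
    (hΨ : ∀ x, |φ x + Real.log (v x)| ≤ Ψ) {x : ℝ} (hx : v x < m) :
    (1 - v x / m) ^ 2 ≤ 2 * (relEntropy T s m M + Ψ) / (T + 1) := by
  have hm := h.m_pos
  have hT := h.T_pos
  obtain ⟨x₁, hx₁, hy⟩ := h.exists_min_of_lt hx
  have hv := h.sys.v_pos x₁
  have h1 := h.entropy_le x₁
  simp only [entropy, hy, mul_zero, zero_add] at h1
  have h2 := (abs_le.1 (hΨ x₁)).1
  have hr0 : 0 < v x₁ / m := div_pos hv hm
  have hr1 : v x₁ / m < 1 := by rw [div_lt_one hm]; exact (hx₁ x).trans_lt hx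
  -- With `r = v/m < 1`, `log r ≤ r - 1` and `s² m² ≤ T + 1` bound the entropy below by `(T+1) ((r²
  -- - 1)/2 - (r - 1))`, a perfect square.
  have h3 : (T + 1) * ((1 - v x₁ / m) ^ 2 / 2) ≤ relEntropy T s m (v x₁) := by
    have h4 := Real.log_le_sub_one_of_pos hr0
    rw [Real.log_div hv.ne' hm.ne'] at h4
    have h6 : s ^ 2 * m ^ 2 ≤ T + 1 := by
      rw [← h.speed]
      have := h.m_lt.le
      gcongr
      nlinarith
    have e : relEntropy T s m (v x₁) = s ^ 2 * m ^ 2 * ((v x₁ / m) ^ 2 - 1) / 2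
        - (T + 1) * (Real.log (v x₁) - Real.log m) := by
      unfold relEntropy; field_simp
    rw [e]
    have h7 : (T + 1) * ((v x₁ / m) ^ 2 - 1) ≤ s ^ 2 * m ^ 2 * ((v x₁ / m) ^ 2 - 1) :=
      mul_le_mul_of_nonpos_right h6 (by nlinarith)
    have h8 := mul_le_mul_of_nonneg_left h4 (show 0 ≤ T + 1 by linarith)
    linarith
  have h9 : (1 - v x / m) ^ 2 ≤ (1 - v x₁ / m) ^ 2 := by
    have h10 : v x₁ / m ≤ v x / m := div_le_div_of_nonneg_right (hx₁ x) hm.le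
    have h11 : v x / m < 1 := by rw [div_lt_one hm]; exact hx
    nlinarith
  rw [le_div_iff₀ (by linarith)]
  have h10 := mul_le_mul_of_nonneg_left h9 (show 0 ≤ T + 1 by linarith)
  linarith

end Connects

theorem abs_exp_sub_one_le_exp_sub_one {t K : ℝ} (h : |t| ≤ K) :
    |Real.exp t - 1| ≤ Real.exp K - 1 := by
  obtain ⟨h1, h2⟩ := abs_le.1 h
  have e1 := Real.exp_le_exp.2 h2
  have e2 := Real.exp_le_exp.2 h1
  have e3 : Real.exp K * Real.exp (-K) = 1 := by rw [← Real.exp_add]; simp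
  have e4 : 2 ≤ Real.exp K + Real.exp (-K) := by
    nlinarith [sq_nonneg (Real.exp K - Real.exp (-K)), sq_nonneg (Real.exp K + Real.exp (-K)),
      Real.exp_pos K, Real.exp_pos (-K)]
  rw [abs_le]
  constructor <;> linarith

namespace Connects

variable {T ν ε s m M : ℝ} {v y E n φ : ℝ → ℝ}

theorem speed_eq (h : Connects T ν ε s m M v y E n φ) : s = Real.sqrt ((T + 1) / (m * M)) := by
  have hm := h.m_pos
  have hM := h.M_pos
  rw [← h.speed, mul_div_cancel_right₀ _ (by positivity), Real.sqrt_sq h.s_pos.le]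

theorem abs_relEntropy_le (h : Connects T ν ε s m M v y E n φ) (hM : M ≤ 2 * m) (x : ℝ) :
    |relEntropy T s m (v x)|
      ≤ ((T + 1) / m ^ 2 * (3 * m) / 2 + (T + 1) / volFloor T m) * |v x - m| := by
  have hm := h.m_pos
  have hT := h.T_pos
  have hv := h.sys.v_pos x
  have hfl := volFloor_pos (T := T) hm
  have hflm : volFloor T m ≤ m := by
    refine mul_le_of_le_one_right hm.le (Real.exp_le_one_iff.2 ?_)
    rw [neg_nonpos]; positivity
  have hvf := h.volFloor_le_v hM x
  have hvM := (h.v_le x).trans hM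
  have h6 : s ^ 2 ≤ (T + 1) / m ^ 2 := by
    rw [le_div_iff₀ (by positivity), ← h.speed]
    have := h.m_lt.le
    gcongr
    nlinarith
  have h1 : |s ^ 2 * (v x ^ 2 - m ^ 2) / 2| ≤ (T + 1) / m ^ 2 * (3 * m) / 2 * |v x - m| := by
    have e : s ^ 2 * (v x ^ 2 - m ^ 2) / 2 = s ^ 2 * (v x + m) / 2 * (v x - m) := by ring
    rw [e, abs_mul, abs_of_nonneg (show 0 ≤ s ^ 2 * (v x + m) / 2 by positivity)]
    gcongr
    linarith
  have hlog : ∀ a b : ℝ, volFloor T m ≤ a → 0 < b → Real.log b - Real.log a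
      ≤ |b - a| / volFloor T m := fun a b ha hb => by
    have ha0 := hfl.trans_le ha
    rw [← Real.log_div hb.ne' ha0.ne']
    have h5 := Real.log_le_sub_one_of_pos (div_pos hb ha0)
    have e : b / a - 1 = (b - a) / a := by field_simp
    rw [e] at h5
    refine h5.trans (div_le_div₀ (abs_nonneg _) (le_abs_self _) hfl ha)
  have h2 : |(T + 1) * (Real.log (v x) - Real.log m)| ≤ (T + 1) / volFloor T m * |v x - m| := by
    rw [abs_mul, abs_of_pos (show 0 < T + 1 by linarith), div_mul_eq_mul_div, mul_div_assoc]
    refine mul_le_mul_of_nonneg_left ?_ (by linarith)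
    rw [abs_le]
    have a1 := hlog m (v x) hflm hv
    have a2 := hlog (v x) m hvf hm
    rw [abs_sub_comm m] at a2
    constructor <;> linarith
  unfold relEntropy
  refine (abs_sub _ _).trans ?_
  linarith

/-- Small shock profiles stay close to the constant state. -/
theorem near_const {T ν ε m : ℝ} (hT : 0 < T) (hν : 0 < ν) (hm : 0 < m)
    {η : ℝ} (hη : 0 < η) :
    ∃ δ : ℝ, 0 < δ ∧ ∀ (s M : ℝ) (v y E n φ : ℝ → ℝ), Connects T ν ε s m M v y E n φ →
      |M - m| < δ → |s - Real.sqrt (T + 1) / m| < η ∧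
        ∀ x, |v x - m| < η ∧ |y x| < η ∧ |n x - 1 / m| < η := by
  -- All bounds are written as functions of `M` alone, continuous at `m`, where `S` takes the
  -- limiting speed and the others vanish: `G` for the entropy, `Ψ` for `|φ + log v|`, `R` for `|v -
  -- m|`, `Y` for `|y|`, `N` for `|n - 1/m|`.
  set S : ℝ → ℝ := fun M => Real.sqrt ((T + 1) / (m * M)) with hS
  set G : ℝ → ℝ := fun M => relEntropy T (S M) m M with hG
  set Ψ : ℝ → ℝ := fun M => Real.sqrt (neutralityConst T ν ε m * G M) with hΨ
  set R : ℝ → ℝ := fun M => m * Real.sqrt (2 * (G M + Ψ M) / (T + 1)) + |M - m| with hR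
  set K := (T + 1) / m ^ 2 * (3 * m) / 2 + (T + 1) / volFloor T m with hK
  set a := ν * (Real.sqrt (T + 1) / (2 * m)) * volFloor T m with ha
  set Y : ℝ → ℝ := fun M => (G M + Ψ M + K * R M) / a with hY
  set N : ℝ → ℝ := fun M => (Real.exp (Ψ M) - 1) / volFloor T m + R M / (volFloor T m * m) with hN
  have hfl := volFloor_pos (T := T) hm
  have ha0 : 0 < a := by positivity
  have hK0 : 0 < K := by positivity
  have hmm : m * m ≠ 0 := by positivity
  have hm0 := hm.ne'
  have cS : ContinuousAt S m := by simp only [hS]; fun_prop (disch := assumption)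
  have cG : ContinuousAt G m := by
    simp only [hG, relEntropy]; fun_prop (disch := assumption)
  have G0 : G m = 0 := by simp [hG, relEntropy]
  have cΨ : ContinuousAt Ψ m := by simp only [hΨ]; fun_prop
  have Ψ0 : Ψ m = 0 := by simp only [hΨ, G0]; simp
  have cR : ContinuousAt R m := by simp only [hR]; fun_prop
  have R0 : R m = 0 := by simp only [hR, G0, Ψ0]; simp
  have cY : ContinuousAt Y m := by simp only [hY]; fun_prop
  have Y0 : Y m = 0 := by simp only [hY, G0, Ψ0, R0]; simp
  have cN : ContinuousAt N m := by simp only [hN]; fun_prop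
  have N0 : N m = 0 := by simp only [hN, Ψ0, R0]; simp
  have S0 : S m = Real.sqrt (T + 1) / m := by
    simp only [hS]; rw [Real.sqrt_div (by positivity), Real.sqrt_mul_self hm.le]
  have cS' : ContinuousAt (fun M => |S M - Real.sqrt (T + 1) / m|) m := by fun_prop
  have hev := (((((cS'.eventually (gt_mem_nhds (show |S m - Real.sqrt (T + 1) / m| < η by
    rw [S0]; simpa using hη))).and (cR.eventually (gt_mem_nhds (R0.trans_lt hη)))).and
    (cY.eventually (gt_mem_nhds (Y0.trans_lt hη)))).and
    (cN.eventually (gt_mem_nhds (N0.trans_lt hη)))))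
  rw [Metric.eventually_nhds_iff] at hev
  obtain ⟨δ, hδ, hev⟩ := hev
  refine ⟨min δ m, by positivity, ?_⟩
  intro s M v y E n φ h hM
  have hM2 : M ≤ 2 * m := by
    have := (abs_lt.1 (hM.trans_le (min_le_right _ _))).2
    linarith
  obtain ⟨⟨⟨e1, e2⟩, e3⟩, e4⟩ := hev (y := M) (by
    rw [Real.dist_eq]; exact hM.trans_le (min_le_left _ _))
  have hsS : s = S M := h.speed_eq
  rw [← hsS] at e1
  refine ⟨e1, fun x => ?_⟩
  have hGM : relEntropy T s m M = G M := by rw [hsS]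
  have hψ : ∀ x, |φ x + Real.log (v x)| ≤ Ψ M := fun x =>
    Real.abs_le_sqrt (by rw [← hGM]; exact h.sq_quasineutral_le hM2 x)
  have hv : |v x - m| ≤ R M := by
    have hs0 := Real.sqrt_nonneg (2 * (G M + Ψ M) / (T + 1))
    rcases lt_or_ge (v x) m with hlt | hge
    · have h1 := h.sq_one_sub_le hψ hlt
      rw [hGM] at h1
      have h2 := Real.le_sqrt_of_sq_le h1
      have h3 : v x - m = -(m * (1 - v x / m)) := by field_simp; ring
      have h4 : v x / m < 1 := by rwa [div_lt_one hm]
      rw [h3, abs_neg, abs_of_nonneg (mul_nonneg hm.le (by linarith))]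
      have := mul_le_mul_of_nonneg_left h2 hm.le
      simp only [hR]
      linarith [abs_nonneg (M - m)]
    · have h1 := h.v_le x
      simp only [hR]
      rw [abs_of_nonneg (by linarith)]
      have := mul_nonneg hm.le hs0
      linarith [le_abs_self (M - m)]
  have hvf := h.volFloor_le_v hM2 x
  have hvp := h.sys.v_pos x
  refine ⟨hv.trans_lt e2, ?_, ?_⟩
  · refine lt_of_le_of_lt ?_ e3
    simp only [hY]
    rw [le_div_iff₀ ha0]
    have h1 : a ≤ s * ν * v x := by
      have := h.speed_ge hM2
      have := h.s_pos
      rw [ha, mul_comm s ν]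
      gcongr
    have h2 : s * ν * v x * |y x| ≤ G M + Ψ M + K * R M := by
      have hsp := h.s_pos
      have h3 : s * ν * v x * |y x| = |s * ν * (v x * y x)| := by
        rw [← mul_assoc, abs_mul, abs_of_pos (show 0 < s * ν * v x by positivity)]
      have h4 : s * ν * (v x * y x) = entropy T ν s m v y φ x - relEntropy T s m (v x)
          - (φ x + Real.log (v x)) := by unfold entropy; ring
      rw [h3, h4]
      have h5 : |entropy T ν s m v y φ x| ≤ G M := by
        rw [abs_of_nonneg (h.entropy_nonneg x), ← hGM]; exact h.entropy_le x
      have h6 := (h.abs_relEntropy_le hM2 x).trans (mul_le_mul_of_nonneg_left hv hK0.le)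
      rw [← hK] at h6
      refine (abs_sub _ _).trans ?_
      linarith [abs_sub (entropy T ν s m v y φ x) (relEntropy T s m (v x)), hψ x]
    rw [mul_comm]
    exact (mul_le_mul_of_nonneg_right h1 (abs_nonneg _)).trans h2
  · refine lt_of_le_of_lt ?_ e4
    have h1 : n x = Real.exp (φ x + Real.log (v x)) / v x := by
      rw [h.hn, Real.exp_add, Real.exp_log hvp]; field_simp
    have h2 : n x - 1 / m = (Real.exp (φ x + Real.log (v x)) - 1) / v x + (m - v x) / (v x * m) := by
      rw [h1]; field_simp; ring
    rw [h2]
    refine (abs_add_le _ _).trans (add_le_add ?_ ?_)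
    · rw [abs_div, abs_of_pos hvp]
      have h3 := abs_exp_sub_one_le_exp_sub_one (hψ x)
      exact div_le_div₀ ((abs_nonneg _).trans h3) h3 hfl hvf
    · rw [abs_div, abs_of_pos (mul_pos hvp hm), abs_sub_comm]
      refine div_le_div₀ ((abs_nonneg _).trans hv) hv (by positivity) ?_
      gcongr

end Connects

/-! ### Monotonicity of small profiles. -/

/-- A solution of a linear differential inequality that vanishes at one point vanishes. -/
theorem eq_zero_of_abs_deriv_le {f f' : ℝ → ℝ} {K : ℝ} (hf : ∀ x, HasDerivAt f (f' x) x)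
    (hK : ∀ x, |f' x| ≤ K * |f x|) {x₀ : ℝ} (h0 : f x₀ = 0) (x : ℝ) : f x = 0 := by
  have hd : ∀ c x, HasDerivAt (fun t => f t ^ 2 * Real.exp (c * t))
      ((2 * f x * f' x + c * f x ^ 2) * Real.exp (c * x)) x := fun c x => by
    refine (((hf x).fun_pow 2).fun_mul ((hasDerivAt_id x).const_mul c).exp).congr_deriv ?_
    norm_num
    ring
  have hb : ∀ x, |2 * f x * f' x| ≤ 2 * K * f x ^ 2 := fun x => by
    rw [abs_mul, abs_mul, abs_two, ← sq_abs (f x)]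
    nlinarith [hK x, abs_nonneg (f x)]
  have hup : Monotone fun t => f t ^ 2 * Real.exp (2 * K * t) :=
    monotone_of_hasDerivAt_nonneg (hd _) fun x => mul_nonneg (by
      linarith [neg_abs_le (2 * f x * f' x), hb x]) (Real.exp_pos _).le
  have hdn : Antitone fun t => f t ^ 2 * Real.exp (-(2 * K) * t) :=
    antitone_of_hasDerivAt_nonpos (hd _) fun x => mul_nonpos_of_nonpos_of_nonneg (by
      linarith [le_abs_self (2 * f x * f' x), hb x]) (Real.exp_pos _).le
  have hfin : f x ^ 2 ≤ 0 := by
    rcases le_total x x₀ with h | h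
    · have h1 := hup h
      simp only [h0] at h1
      have h2 : f x ^ 2 * Real.exp (2 * K * x) ≤ 0 := by simpa using h1
      exact nonpos_of_mul_nonpos_left h2 (Real.exp_pos _)
    · have h1 := hdn h
      simp only [h0] at h1
      have h2 : f x ^ 2 * Real.exp (-(2 * K) * x) ≤ 0 := by simpa using h1
      exact nonpos_of_mul_nonpos_left h2 (Real.exp_pos _)
  exact pow_eq_zero_iff two_ne_zero |>.1 (le_antisymm hfin (sq_nonneg _))

namespace Connects

variable {T ν ε s m M : ℝ} {v y E n φ : ℝ → ℝ}

/-- Once `|E| ≤ C |y|`, the equation for `y` is a linear differential inequality. A zero of `y`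
would make `y` vanish identically and `v` constant, against `m < M`; and a negative `y` would make
`v` decrease from `m` to `M`. -/
theorem slope_pos_of_abs_field_le (h : Connects T ν ε s m M v y E n φ) {C K : ℝ}
    (hE : ∀ x, |E x| ≤ C * |y x|) (hK : ∀ x, |s ^ 2 * v x - T / v x| ≤ K) (x : ℝ) : 0 < y x := by
  have hsν : 0 < s * ν := mul_pos h.s_pos h.ν_pos
  have hne : ∀ x, y x ≠ 0 := by
    intro x₀ h0
    have hz := eq_zero_of_abs_deriv_le (K := (K + C) / (s * ν)) h.sys.hy (fun x => by
      rw [abs_div, abs_neg, abs_of_pos hsν, div_mul_eq_mul_div]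
      refine div_le_div_of_nonneg_right ?_ hsν.le
      refine (abs_add_le _ _).trans ?_
      rw [abs_mul, add_mul]
      exact add_le_add (mul_le_mul_of_nonneg_right (hK x) (abs_nonneg _)) (hE x)) h0
    have hc := is_const_of_deriv_eq_zero (fun x => (h.sys.hv x).differentiableAt) fun x => by
      rw [(h.sys.hv x).deriv, hz x, mul_zero]
    have hv : v = fun _ => v 0 := funext fun x => hc x 0
    have h1 := h.v_bot
    have h2 := h.v_top
    rw [hv] at h1 h2
    have e1 := tendsto_nhds_unique h1 tendsto_const_nhds
    have e2 := tendsto_nhds_unique h2 tendsto_const_nhds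
    exact h.m_lt.ne (e1.trans e2.symm)
  by_contra! hle
  have hlt : y x < 0 := lt_of_le_of_ne hle (hne x)
  have hcont : Continuous y := continuous_iff_continuousAt.2 fun x => (h.sys.hy x).continuousAt
  have hneg : ∀ t, y t < 0 := fun t => by
    by_contra! hge
    obtain ⟨c, hc⟩ := mem_range_of_exists_le_of_exists_ge hcont ⟨x, hlt.le⟩ ⟨t, hge⟩
    exact hne c hc
  have hanti : Antitone v := antitone_of_hasDerivAt_nonpos h.sys.hv fun t =>
    (mul_neg_of_pos_of_neg (h.sys.v_pos t) (hneg t)).le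
  have h1 := hanti.le_of_tendsto h.v_top 0
  have h2 := hanti.ge_of_tendsto h.v_bot 0
  linarith [h.m_lt]

/-- Small shock profiles are monotone, and the field is dominated by the slope. -/
theorem abs_field_le {T ν ε m : ℝ} (hT : 0 < T) (hν : 0 < ν) (hε : 0 < ε) (hm : 0 < m) :
    ∃ η : ℝ, 0 < η ∧ ∀ (s M : ℝ) (v y E n φ : ℝ → ℝ), Connects T ν ε s m M v y E n φ →
      |s - Real.sqrt (T + 1) / m| < η → (∀ x, |v x - m| < η ∧ |n x - 1 / m| < η) →
      ∀ x, 0 < y x ∧ |E x| ≤ 2 / m * y x := by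
  set s₀ := Real.sqrt (T + 1) / m with hs₀
  have hs₀p : 0 < s₀ := by positivity
  have hson : s₀ ^ 2 * m ^ 2 = T + 1 := by
    rw [hs₀, div_pow, Real.sq_sqrt (by positivity)]; field_simp
  -- With `D = y + m E` and `F = E'`, linearization at the sonic constant state reads `D' = -b D + m
  -- F`, `F' = D/ε²`, `y' = -b D`. The eigenvalues of the `(D, F)` block are `μ = (r - b)/2` and `-κ
  -- = -(r + b)/2`.
  set b := 1 / (s₀ * ν * m) with hb
  have hbp : 0 < b := by positivity
  set r := Real.sqrt (b ^ 2 + 4 * (m / ε ^ 2)) with hr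
  have hr2 : r ^ 2 = b ^ 2 + 4 * (m / ε ^ 2) := Real.sq_sqrt (by positivity)
  have hrb : b < r := by
    have : 0 < m / ε ^ 2 := by positivity
    exact lt_of_pow_lt_pow_left₀ 2 (Real.sqrt_nonneg _) (by linarith)
  have hrp : 0 < r := hbp.trans hrb
  set μ := (r - b) / 2 with hμ
  set κ := (r + b) / 2 with hκ
  have hμp : 0 < μ := by rw [hμ]; linarith
  have hκp : 0 < κ := by rw [hκ]; linarith
  have eμ : m / ε ^ 2 = μ ^ 2 + b * μ := by rw [hμ]; linarith
  have eκ : m / ε ^ 2 = κ ^ 2 - b * κ := by rw [hκ]; linarith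
  have hsum : μ + κ = r := by rw [hμ, hκ]; ring
  -- `D = (p - q)/r` explains the coefficients in `y' = -b D`; the bound `r/2` on `p` and `q` yields
  -- `|D| ≤ |y|`.
  obtain ⟨η, hη, hyp⟩ := hyperbolic_le_slow (-(b / r)) (b / r) hμp hκp (show 0 < r / 2 by linarith)
  set L := 1 / m * (1 / r + 1) + 1 / r + 1 with hL
  have hLp : 0 < L := by positivity
  set e := η / ((μ + κ + m + 1) * L) with he
  have hep : 0 < e := by positivity
  -- closeness of the coefficients
  have hcl : ∀ᶠ q : ℝ × ℝ × ℝ in 𝓝 (s₀, m, 1 / m),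
      |(q.1 ^ 2 * q.2.1 - T / q.2.1) / (q.1 * ν) - b| < e ∧ |1 / (q.1 * ν) - b * m| < e ∧
      |(q.2.1 * q.2.2 - 1) / ε ^ 2| < e ∧ |(q.2.1 ^ 2 * q.2.2 - m) / ε ^ 2| < e ∧
      |q.1 ^ 2 * q.2.1 - T / q.2.1| < 1 / m + 1 := by
    have hne : s₀ * ν ≠ 0 := by positivity
    have hm0 := hm.ne'
    have k : s₀ ^ 2 * m - T / m = 1 / m := by field_simp; linarith
    have c1 : ContinuousAt (fun q : ℝ × ℝ × ℝ =>
        |(q.1 ^ 2 * q.2.1 - T / q.2.1) / (q.1 * ν) - b|) (s₀, m, 1 / m) := by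
      fun_prop (disch := assumption)
    have c2 : ContinuousAt (fun q : ℝ × ℝ × ℝ => |1 / (q.1 * ν) - b * m|) (s₀, m, 1 / m) := by
      fun_prop (disch := assumption)
    have c3 : ContinuousAt (fun q : ℝ × ℝ × ℝ => |(q.2.1 * q.2.2 - 1) / ε ^ 2|)
        (s₀, m, 1 / m) := by fun_prop
    have c4 : ContinuousAt (fun q : ℝ × ℝ × ℝ => |(q.2.1 ^ 2 * q.2.2 - m) / ε ^ 2|)
        (s₀, m, 1 / m) := by fun_prop
    have c5 : ContinuousAt (fun q : ℝ × ℝ × ℝ => |q.1 ^ 2 * q.2.1 - T / q.2.1|)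
        (s₀, m, 1 / m) := by fun_prop (disch := assumption)
    refine (c1.eventually (gt_mem_nhds ?_)).and ((c2.eventually (gt_mem_nhds ?_)).and
      ((c3.eventually (gt_mem_nhds ?_)).and ((c4.eventually (gt_mem_nhds ?_)).and
      (c5.eventually (gt_mem_nhds ?_)))))
    · have : (s₀ ^ 2 * m - T / m) / (s₀ * ν) - b = 0 := by rw [k, hb]; field_simp; ring
      simp only [this, abs_zero]; exact hep
    · have : 1 / (s₀ * ν) - b * m = 0 := by rw [hb]; field_simp; ring
      simp only [this, abs_zero]; exact hep
    · have : (m * (1 / m) - 1) / ε ^ 2 = 0 := by field_simp; ring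
      simp only [this, abs_zero]; exact hep
    · have : (m ^ 2 * (1 / m) - m) / ε ^ 2 = 0 := by field_simp; ring
      simp only [this, abs_zero]; exact hep
    · simp only [k]; rw [abs_of_pos (by positivity)]; linarith
  rw [Metric.eventually_nhds_iff] at hcl
  obtain ⟨η₁, hη₁, hcl⟩ := hcl
  refine ⟨η₁, hη₁, ?_⟩
  intro s M v y E n φ h hs hvn
  have hpt : ∀ x, _ := fun x => hcl (y := (s, v x, n x)) (by
    simp only [Prod.dist_eq, Real.dist_eq, sup_lt_iff]
    exact ⟨hs, hvn x⟩)
  simp only at hpt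
  have hsp := h.s_pos
  set D : ℝ → ℝ := fun x => y x + m * E x with hD
  set F : ℝ → ℝ := fun x => (v x * n x - 1) / ε ^ 2 with hF
  set y' : ℝ → ℝ := fun x => -((s ^ 2 * v x - T / v x) * y x + E x) / (s * ν) with hy'
  set F' : ℝ → ℝ := fun x => (v x * y x * n x + v x * (v x * E x * n x)) / ε ^ 2 with hF'
  have dD : ∀ x, HasDerivAt D (y' x + m * F x) x := fun x =>
    (h.sys.hy x).add ((h.sys.hE x).const_mul m)
  have dF : ∀ x, HasDerivAt F (F' x) x := fun x =>
    (((h.sys.hv x).fun_mul (h.sys.hn x)).sub_const 1).div_const (ε ^ 2)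
  -- Eigencoordinates of the `(D, F)` block.
  set p : ℝ → ℝ := fun x => μ * D x + m * F x with hp
  set q : ℝ → ℝ := fun x => -κ * D x + m * F x with hq
  have dp : ∀ x, HasDerivAt p (μ * (y' x + m * F x) + m * F' x) x := fun x =>
    ((dD x).const_mul μ).add ((dF x).const_mul m)
  have dq : ∀ x, HasDerivAt q (-κ * (y' x + m * F x) + m * F' x) x := fun x =>
    ((dD x).const_mul (-κ)).add ((dF x).const_mul m)
  have hDpq : ∀ x, D x = (p x - q x) / r := fun x => by
    rw [← hsum]
    have : μ + κ ≠ 0 := by positivity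
    simp only [hp, hq]; field_simp; ring
  have hsize : ∀ x, |y x| + |E x| ≤ L * (|p x| + |q x| + |y x|) := fun x => by
    have h1 : |D x| ≤ 1 / r * (|p x| + |q x|) := by
      rw [hDpq, abs_div, abs_of_pos hrp, div_eq_mul_one_div, mul_comm]
      exact mul_le_mul_of_nonneg_left (abs_sub _ _) (by positivity)
    have h2 : |E x| ≤ 1 / m * (|D x| + |y x|) := by
      have : E x = 1 / m * (D x - y x) := by simp only [hD]; field_simp; ring
      rw [this, abs_mul, abs_of_pos (show 0 < 1 / m by positivity)]
      exact mul_le_mul_of_nonneg_left (abs_sub _ _) (by positivity)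
    have h3 := mul_le_mul_of_nonneg_left h1 (show 0 ≤ 1 / m by positivity)
    have h4 : 0 ≤ (1 / m + 1 / r + 1) * (|p x| + |q x|) := by positivity
    have h5 : 0 ≤ (1 / m * (1 / r) + 1 / r) * |y x| := by positivity
    rw [hL]
    linarith
  have e1 : ∀ x, |y' x + b * D x| ≤ e * (|y x| + |E x|) := fun x => by
    obtain ⟨k1, k2, -⟩ := hpt x
    have : y' x + b * D x = -(((s ^ 2 * v x - T / v x) / (s * ν) - b) * y x
        + (1 / (s * ν) - b * m) * E x) := by
      have := h.ν_pos.ne'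
      simp only [hy', hD]; field_simp; ring
    rw [this, abs_neg]
    refine (abs_add_le _ _).trans ?_
    rw [abs_mul, abs_mul, mul_add]
    exact add_le_add (mul_le_mul_of_nonneg_right k1.le (abs_nonneg _))
      (mul_le_mul_of_nonneg_right k2.le (abs_nonneg _))
  have e2 : ∀ x, |F' x - D x / ε ^ 2| ≤ e * (|y x| + |E x|) := fun x => by
    obtain ⟨-, -, k1, k2, -⟩ := hpt x
    have : F' x - D x / ε ^ 2 = (v x * n x - 1) / ε ^ 2 * y x
        + (v x ^ 2 * n x - m) / ε ^ 2 * E x := by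
      simp only [hF', hD]; field_simp; ring
    rw [this]
    refine (abs_add_le _ _).trans ?_
    rw [abs_mul, abs_mul, mul_add]
    exact add_le_add (mul_le_mul_of_nonneg_right k1.le (abs_nonneg _))
      (mul_le_mul_of_nonneg_right k2.le (abs_nonneg _))
  have hfinal : ∀ x c, 0 ≤ c → c ≤ μ + κ + m + 1 →
      c * (e * (|y x| + |E x|)) ≤ η * (|p x| + |q x| + |y x|) := fun x c hc0 hc => by
    calc c * (e * (|y x| + |E x|))
        ≤ (μ + κ + m + 1) * (e * (L * (|p x| + |q x| + |y x|))) := by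
          have := hsize x
          gcongr
      _ = η * (|p x| + |q x| + |y x|) := by rw [he]; field_simp
  have hlim : ∀ l : Filter ℝ, ∀ a : ℝ, 0 < a → Tendsto v l (𝓝 a) → Tendsto φ l (𝓝 (-Real.log a)) →
      Tendsto y l (𝓝 0) → Tendsto E l (𝓝 0) → Tendsto D l (𝓝 0) ∧ Tendsto F l (𝓝 0) := by
    intro l a ha h1 h2 h3 h4
    refine ⟨by simpa using h3.add (h4.const_mul m), ?_⟩
    have hn : Tendsto n l (𝓝 (1 / a)) := by
      rw [show n = fun x => Real.exp (φ x) from funext h.hn]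
      exact tendsto_exp_of_tendsto_neg_log ha h2
    simpa [ha.ne'] using ((h1.mul hn).sub_const 1).div_const (ε ^ 2)
  obtain ⟨D1, F1⟩ := hlim _ m hm h.v_bot h.φ_bot h.y_bot h.E_bot
  obtain ⟨D2, F2⟩ := hlim _ M h.M_pos h.v_top h.φ_top h.y_top h.E_top
  have hpq := hyp p q y _ _ y' dp dq h.sys.hy
    (fun x => by
      have e : μ * (y' x + m * F x) + m * F' x - μ * p x
          = μ * (y' x + b * D x) + m * (F' x - D x / ε ^ 2) := by
        simp only [hp]; linear_combination (D x) * eμ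
      rw [e]
      refine (abs_add_le _ _).trans (le_trans ?_ (hfinal x (μ + m) (by positivity) (by linarith)))
      rw [abs_mul, abs_mul, abs_of_pos hμp, abs_of_pos hm, add_mul]
      exact add_le_add (mul_le_mul_of_nonneg_left (e1 x) hμp.le)
        (mul_le_mul_of_nonneg_left (e2 x) hm.le))
    (fun x => by
      have e : -κ * (y' x + m * F x) + m * F' x + κ * q x
          = -κ * (y' x + b * D x) + m * (F' x - D x / ε ^ 2) := by
        simp only [hq]; linear_combination (D x) * eκ
      rw [e]
      refine (abs_add_le _ _).trans (le_trans ?_ (hfinal x (κ + m) (by positivity) (by linarith)))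
      rw [abs_mul, abs_mul, abs_neg, abs_of_pos hκp, abs_of_pos hm, add_mul]
      exact add_le_add (mul_le_mul_of_nonneg_left (e1 x) hκp.le)
        (mul_le_mul_of_nonneg_left (e2 x) hm.le))
    (fun x => by
      have e : y' x - (-(b / r) * p x + b / r * q x) = y' x + b * D x := by
        rw [hDpq]; ring
      rw [e]
      have := hfinal x 1 zero_le_one (by linarith)
      rw [one_mul] at this
      exact (e1 x).trans this)
    (by simpa using (D1.const_mul μ).add (F1.const_mul m))
    (by simpa [hq] using (D1.const_mul (-κ)).add (F1.const_mul m)) h.y_bot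
    (by simpa using (D2.const_mul μ).add (F2.const_mul m))
    (by simpa [hq] using (D2.const_mul (-κ)).add (F2.const_mul m)) h.y_top
  have hE : ∀ x, |E x| ≤ 2 / m * |y x| := fun x => by
    obtain ⟨k1, k2⟩ := hpq x
    have h1 : |D x| ≤ |y x| := by
      rw [hDpq, abs_div, abs_of_pos hrp, div_le_iff₀ hrp]
      refine (abs_sub _ _).trans ?_
      linarith
    have h2 : E x = 1 / m * (D x - y x) := by simp only [hD]; field_simp; ring
    rw [h2, abs_mul, abs_of_pos (show 0 < 1 / m by positivity)]
    have h3 := mul_le_mul_of_nonneg_left ((abs_sub (D x) (y x)).trans (add_le_add_left h1 _))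
      (show 0 ≤ 1 / m by positivity)
    refine h3.trans (le_of_eq ?_)
    ring
  have hpos := h.slope_pos_of_abs_field_le hE fun x => (hpt x).2.2.2.2.le
  exact fun x => ⟨hpos x, by have := hE x; rwa [abs_of_pos (hpos x)] at this⟩

end Connects

/-! ### Weak derivatives and decay in `H¹`. -/

theorem _root_.MeasureTheory.LocallyIntegrable.intervalIntegrable_volume {F : Type*}
    [NormedAddCommGroup F] {g : ℝ → F} (hg : LocallyIntegrable g volume) (a b : ℝ) :
    IntervalIntegrable g volume a b :=
  (hg.integrableOn_isCompact isCompact_uIcc).intervalIntegrable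

theorem exists_eq_zero_of_le_abs {η : ℝ → ℝ} (hc : HasCompactSupport η) :
    ∃ R : ℝ, 0 < R ∧ ∀ x, R ≤ |x| → η x = 0 := by
  obtain ⟨R, hR⟩ := hc.isBounded.subset_closedBall 0
  refine ⟨max R 0 + 1, by positivity, fun x hx => ?_⟩
  by_contra h
  have h1 := hR (subset_tsupport η h)
  rw [mem_closedBall_zero_iff, Real.norm_eq_abs] at h1
  linarith [le_max_left R 0]

/-- Integration by parts of the primitive of a locally integrable function against a test function. -/
theorem integral_deriv_mul_primitive {g η : ℝ → ℝ} (hg : LocallyIntegrable g volume)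
    (hη : ContDiff ℝ ∞ η) (hc : HasCompactSupport η) :
    ∫ x, deriv η x * ∫ t in (0 : ℝ)..x, g t = -∫ x, η x * g x := by
  obtain ⟨R, hR, hz⟩ := exists_eq_zero_of_le_abs hc
  obtain ⟨R', hR', hz'⟩ := exists_eq_zero_of_le_abs hc.deriv
  set S := max R R' with hS
  have hSp : 0 < S := lt_max_of_lt_left hR
  have hzero : ∀ x, S ≤ |x| → η x = 0 := fun x hx => hz x ((le_max_left _ _).trans hx)
  have hzero' : ∀ x, S ≤ |x| → deriv η x = 0 := fun x hx => hz' x ((le_max_right _ _).trans hx)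
  have hsupp : ∀ f : ℝ → ℝ, (∀ x, S ≤ |x| → f x = 0) → Function.support f ⊆ Set.Ioc (-S) S := by
    intro f hf x hx
    by_contra h
    refine hx (hf x ?_)
    by_contra! h'
    exact h ⟨(abs_lt.1 h').1, (abs_lt.1 h').2.le⟩
  have hgi : IntervalIntegrable g volume (-S) S := hg.intervalIntegrable_volume _ _
  -- The primitive is only absolutely continuous, with derivative `g` almost everywhere; this
  -- suffices for integration by parts.
  have acG := hgi.absolutelyContinuousOnInterval_intervalIntegral (c := 0) (by
    rw [Set.uIcc_of_le (by linarith)]; exact ⟨by linarith, hSp.le⟩)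
  have acη : AbsolutelyContinuousOnInterval η (-S) S :=
    ContDiffOn.absolutelyContinuousOnInterval ((hη.of_le (by simp)).contDiffOn)
  have key := acη.integral_mul_deriv_eq_deriv_mul acG
  rw [hzero S (le_abs_self S), hzero (-S) (by rw [abs_neg]; exact le_abs_self S)] at key
  have e1 : ∫ x in (-S)..S, η x * deriv (fun x => ∫ t in (0 : ℝ)..x, g t) x
      = ∫ x in (-S)..S, η x * g x := by
    refine intervalIntegral.integral_congr_ae ?_
    filter_upwards [LocallyIntegrable.ae_hasDerivAt_integral hg] with x hx _
    rw [(hx 0).deriv]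
  rw [e1, intervalIntegral.integral_eq_integral_of_support_subset
      (hsupp (fun x => η x * g x) fun x hx => by simp [hzero x hx]),
    intervalIntegral.integral_eq_integral_of_support_subset
      (hsupp (fun x => deriv η x * ∫ t in (0 : ℝ)..x, g t) fun x hx => by simp [hzero' x hx])] at key
  linarith

theorem continuous_primitive_of_locallyIntegrable {g : ℝ → ℂ} (hg : LocallyIntegrable g volume) :
    Continuous fun x => ∫ t in (0 : ℝ)..x, g t :=
  intervalIntegral.continuous_primitive hg.intervalIntegrable_volume 0

theorem locallyIntegrable_clm_comp (L : ℂ →L[ℝ] ℝ) {g : ℝ → ℂ} (hg : LocallyIntegrable g volume) :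
    LocallyIntegrable (fun x => L (g x)) volume := fun x => by
  obtain ⟨s, hs, h⟩ := hg x
  exact ⟨s, hs, L.integrable_comp h⟩

theorem HasWeakDeriv.primitive {g : ℝ → ℂ} (hg : LocallyIntegrable g volume) :
    HasWeakDeriv (fun x => ∫ t in (0 : ℝ)..x, g t) g := by
  have hG := (continuous_primitive_of_locallyIntegrable hg).locallyIntegrable (μ := volume)
  refine ⟨hG, hg, fun η hη hc => ?_⟩
  have hre : LocallyIntegrable (fun x => (g x).re) volume :=
    locallyIntegrable_clm_comp Complex.reCLM hg
  have him : LocallyIntegrable (fun x => (g x).im) volume :=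
    locallyIntegrable_clm_comp Complex.imCLM hg
  have i1 := integrable_test_deriv hG hη hc
  have i2 := integrable_test hg hη.continuous hc
  have pre : ∀ x, (∫ t in (0 : ℝ)..x, g t).re = ∫ t in (0 : ℝ)..x, (g t).re := fun x =>
    (Complex.reCLM.intervalIntegral_comp_comm (hg.intervalIntegrable_volume _ _)).symm
  have pim : ∀ x, (∫ t in (0 : ℝ)..x, g t).im = ∫ t in (0 : ℝ)..x, (g t).im := fun x =>
    (Complex.imCLM.intervalIntegral_comp_comm (hg.intervalIntegrable_volume _ _)).symm
  apply Complex.ext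
  · have h := integral_deriv_mul_primitive hre hη hc
    rw [Complex.neg_re]
    refine (Complex.reCLM.integral_comp_comm i1).symm.trans (Eq.trans ?_
      (h.trans (congrArg Neg.neg (Eq.trans ?_ (Complex.reCLM.integral_comp_comm i2)))))
    · simp [pre]
    · simp
  · have h := integral_deriv_mul_primitive him hη hc
    rw [Complex.neg_im]
    refine (Complex.imCLM.integral_comp_comm i1).symm.trans (Eq.trans ?_
      (h.trans (congrArg Neg.neg (Eq.trans ?_ (Complex.imCLM.integral_comp_comm i2)))))
    · simp [pim]
    · simp

/-- A test function of zero mean is the derivative of a test function. -/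
theorem exists_test_primitive {χ : ℝ → ℝ} (hχ : ContDiff ℝ ∞ χ) (hc : HasCompactSupport χ)
    (h0 : ∫ x, χ x = 0) :
    ∃ η : ℝ → ℝ, ContDiff ℝ ∞ η ∧ HasCompactSupport η ∧ deriv η = χ := by
  obtain ⟨R, hR, hz⟩ := exists_eq_zero_of_le_abs hc
  set η : ℝ → ℝ := fun x => ∫ t in (-R)..x, χ t with hη
  have hd : ∀ x, HasDerivAt η (χ x) x := fun x =>
    intervalIntegral.integral_hasDerivAt_right (hχ.continuous.intervalIntegrable _ _)
      (hχ.continuous.stronglyMeasurableAtFilter _ _) hχ.continuous.continuousAt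
  have hde : deriv η = χ := funext fun x => (hd x).deriv
  refine ⟨η, contDiff_infty_iff_deriv.2 ⟨fun x => (hd x).differentiableAt, by rwa [hde]⟩, ?_, hde⟩
  refine HasCompactSupport.intro (isCompact_Icc (a := -R) (b := R)) fun x hx => ?_
  rw [Set.mem_Icc, not_and_or, not_le, not_le] at hx
  rcases hx with hx | hx
  · refine intervalIntegral.integral_zero_ae (Eventually.of_forall fun t ht => hz t ?_)
    rw [Set.uIoc_of_ge hx.le] at ht
    rw [abs_of_neg (by linarith [ht.2])]
    linarith [ht.2]
  · rw [hη]
    simp only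
    rw [intervalIntegral.integral_eq_integral_of_support_subset, h0]
    intro t ht
    by_contra h
    refine ht (hz t ?_)
    by_contra! h'
    exact h ⟨(abs_lt.1 h').1, (abs_lt.1 h').2.le.trans hx.le⟩

/-- A locally integrable function with vanishing weak derivative is constant. -/
theorem exists_ae_eq_const {h : ℝ → ℂ} (hh : LocallyIntegrable h volume)
    (h0 : ∀ η : ℝ → ℝ, ContDiff ℝ ∞ η → HasCompactSupport η → ∫ x, deriv η x • h x = 0) :
    ∃ c : ℂ, h =ᵐ[volume] fun _ => c := by
  let b : ContDiffBump (0 : ℝ) := ⟨1, 2, one_pos, one_lt_two⟩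
  set η₀ : ℝ → ℝ := b.normed volume with hη₀
  have s₀ : ContDiff ℝ ∞ η₀ := b.contDiff_normed
  have c₀ : HasCompactSupport η₀ := b.hasCompactSupport_normed
  have i₀ : ∫ x, η₀ x = 1 := b.integral_normed
  set c := ∫ x, η₀ x • h x with hc
  refine ⟨c, ?_⟩
  have hli : LocallyIntegrable (fun x => h x - c) volume := hh.sub (locallyIntegrable_const c)
  have key := ae_eq_zero_of_integral_contDiff_smul_eq_zero hli fun ψ hψ hψc => by
    have iψ : Integrable ψ volume := hψ.continuous.integrable_of_hasCompactSupport hψc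
    have iη : Integrable η₀ volume := s₀.continuous.integrable_of_hasCompactSupport c₀
    -- Du Bois-Reymond: a multiple of the bump `η₀` corrects `ψ` to mean zero, so that it becomes an
    -- admissible derivative.
    obtain ⟨η, k1, k2, k3⟩ := exists_test_primitive (χ := fun x => ψ x - (∫ t, ψ t) * η₀ x)
      (hψ.sub (contDiff_const.mul s₀)) (hψc.sub (c₀.mul_left (f := fun _ => ∫ t, ψ t))) (by
        rw [integral_sub iψ (iη.const_mul _), integral_const_mul, i₀]; ring)
    have k := h0 η k1 k2
    rw [k3] at k
    have j1 := integrable_test hh hψ.continuous hψc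
    have j2 := integrable_test hh s₀.continuous c₀
    simp only [sub_smul, mul_smul] at k
    have j3 : Integrable (fun x => (∫ t, ψ t) • η₀ x • h x) volume := j2.smul (∫ t, ψ t)
    rw [integral_sub j1 j3, integral_smul, ← hc] at k
    simp only [smul_sub]
    rw [integral_sub j1 (iψ.smul_const c), integral_smul_const]
    exact k
  filter_upwards [key] with x hx
  exact sub_eq_zero.1 hx

/-- A function with a weak derivative has a continuous representative, which is continuously
differentiable if the weak derivative has a continuous representative. -/
theorem HasWeakDeriv.exists_continuous {f g : ℝ → ℂ} (h : HasWeakDeriv f g) :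
    ∃ F : ℝ → ℂ, Continuous F ∧ f =ᵐ[volume] F ∧
      ∀ G : ℝ → ℂ, Continuous G → g =ᵐ[volume] G → ∀ x, HasDerivAt F (G x) x := by
  have hp := HasWeakDeriv.primitive h.2.1
  have hd : HasWeakDeriv (fun x => f x - ∫ t in (0 : ℝ)..x, g t) (fun x => 0) := by
    simpa [sub_eq_add_neg] using h.add (hp.const_mul (-1))
  obtain ⟨c, hc⟩ := exists_ae_eq_const hd.1 fun η h1 h2 => by
    rw [hd.2.2 η h1 h2]; simp
  refine ⟨fun x => c + ∫ t in (0 : ℝ)..x, g t,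
    continuous_const.add (continuous_primitive_of_locallyIntegrable h.2.1), ?_, ?_⟩
  · filter_upwards [hc] with x hx
    rw [← hx]; ring
  · intro G hG hgG x
    have e : (fun x => c + ∫ t in (0 : ℝ)..x, g t) = fun x => c + ∫ t in (0 : ℝ)..x, G t :=
      funext fun x => by
        rw [intervalIntegral.integral_congr_ae (hgG.mono fun t ht _ => ht)]
    rw [e]
    exact (intervalIntegral.integral_hasDerivAt_right (hG.intervalIntegrable _ _)
      (hG.stronglyMeasurableAtFilter _ _) hG.continuousAt).const_add c

/-- The product rule for a smooth coefficient. -/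
theorem HasWeakDeriv.smooth_mul {f g : ℝ → ℂ} {a : ℝ → ℝ} (h : HasWeakDeriv f g)
    (ha : ContDiff ℝ ∞ a) :
    HasWeakDeriv (fun x => (a x : ℂ) * f x)
      (fun x => ((deriv a x : ℝ) : ℂ) * f x + (a x : ℂ) * g x) := by
  have ha' : Continuous (deriv a) := ha.continuous_deriv (by simp)
  have hl : ∀ {k : ℝ → ℂ} {b : ℝ → ℝ}, LocallyIntegrable k volume → Continuous b →
      LocallyIntegrable (fun x => (b x : ℂ) * k x) volume := fun {k b} hk hb => by
    rw [← locallyIntegrableOn_univ] at hk ⊢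
    exact hk.continuousOn_mul (Complex.continuous_ofReal.comp hb).continuousOn
      isOpen_univ.isLocallyClosed
  refine ⟨hl h.1 ha.continuous, (hl h.1 ha').add (hl h.2.1 ha.continuous), fun η hη hc => ?_⟩
  have hprod : ContDiff ℝ ∞ fun x => η x * a x := hη.mul ha
  have hcp : HasCompactSupport fun x => η x * a x := hc.mul_right
  have k := h.2.2 _ hprod hcp
  have hd : ∀ x, deriv (fun x => η x * a x) x = deriv η x * a x + η x * deriv a x := fun x =>
    (((hη.differentiable (by simp) x).hasDerivAt).mul
      ((ha.differentiable (by simp) x).hasDerivAt)).deriv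
  have i1 : Integrable (fun x => deriv η x • ((a x : ℂ) * f x)) volume :=
    integrable_test_deriv (hl h.1 ha.continuous) hη hc
  have i2 : Integrable (fun x => η x • (((deriv a x : ℝ) : ℂ) * f x)) volume :=
    integrable_test (hl h.1 ha') hη.continuous hc
  have i3 : Integrable (fun x => η x • ((a x : ℂ) * g x)) volume :=
    integrable_test (hl h.2.1 ha.continuous) hη.continuous hc
  have e1 : ∀ x, deriv (fun x => η x * a x) x • f x
      = deriv η x • ((a x : ℂ) * f x) + η x • (((deriv a x : ℝ) : ℂ) * f x) := fun x => by
    rw [hd]; simp only [Complex.real_smul]; push_cast; ring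
  have e2 : ∀ x, (η x * a x) • g x = η x • ((a x : ℂ) * g x) := fun x => by
    simp only [Complex.real_smul]; push_cast; ring
  simp only [e1, e2] at k
  rw [integral_add i1 i2] at k
  simp only [smul_add]
  rw [integral_add i2 i3]
  linear_combination k

/-- A continuously differentiable function in `H¹(ℝ)` vanishes at infinity. -/
theorem tendsto_zero_of_memLp {f g : ℝ → ℂ} (hf : ∀ x, HasDerivAt f (g x) x)
    (h2 : MemLp f 2 volume) (h2' : MemLp g 2 volume) :
    Tendsto f atBot (𝓝 0) ∧ Tendsto f atTop (𝓝 0) := by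
  -- Both `|f|²` and its derivative are integrable, so `|f|²` tends to zero.
  have hd : ∀ x, HasDerivAt (fun x => f x * (starRingEnd ℂ) (f x))
      (g x * (starRingEnd ℂ) (f x) + f x * (starRingEnd ℂ) (g x)) x := fun x =>
    (hf x).mul (hf x).star
  have c2 : MemLp (fun x => (starRingEnd ℂ) (f x)) 2 volume := h2.star
  have c2' : MemLp (fun x => (starRingEnd ℂ) (g x)) 2 volume := h2'.star
  have i1 : Integrable (fun x => f x * (starRingEnd ℂ) (f x)) volume := h2.integrable_mul c2
  have i2 : Integrable (fun x => g x * (starRingEnd ℂ) (f x) + f x * (starRingEnd ℂ) (g x)) volume :=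
    (h2'.integrable_mul c2).add (h2.integrable_mul c2')
  have hfin : ∀ {l : Filter ℝ}, Tendsto (fun x => f x * (starRingEnd ℂ) (f x)) l (𝓝 0) →
      Tendsto f l (𝓝 0) := fun {l} h => by
    rw [tendsto_zero_iff_norm_tendsto_zero] at h ⊢
    have h' := (Real.continuous_sqrt.tendsto _).comp h
    rw [Real.sqrt_zero] at h'
    refine h'.congr fun x => ?_
    simp
  exact ⟨hfin (tendsto_zero_of_hasDerivAt_of_integrableOn_Iic (a := 0) (fun x _ => hd x)
      i2.integrableOn i1.integrableOn),
    hfin (tendsto_zero_of_hasDerivAt_of_integrableOn_Ioi (a := 0) (fun x _ => hd x)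
      i2.integrableOn i1.integrableOn)⟩

theorem memLp_mul_of_bounded {f : ℝ → ℂ} {a : ℝ → ℝ} {K : ℝ} (hf : MemLp f 2 volume)
    (ha : Continuous a) (hK : ∀ x, |a x| ≤ K) : MemLp (fun x => (a x : ℂ) * f x) 2 volume := by
  refine hf.of_le_mul (c := K)
    ((Complex.continuous_ofReal.comp ha).aestronglyMeasurable.mul hf.1)
    (Eventually.of_forall fun x => ?_)
  rw [norm_mul, Complex.norm_real]
  exact mul_le_mul_of_nonneg_right (hK x) (norm_nonneg _)

theorem exists_abs_le_of_tendsto {f : ℝ → ℝ} {a b : ℝ} (hf : Continuous f)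
    (ha : Tendsto f atBot (𝓝 a)) (hb : Tendsto f atTop (𝓝 b)) : ∃ K : ℝ, ∀ x, |f x| ≤ K := by
  obtain ⟨l, hl⟩ := eventually_atBot.1 (ha.abs.eventually (gt_mem_nhds (lt_add_one |a|)))
  obtain ⟨r, hr⟩ := eventually_atTop.1 (hb.abs.eventually (gt_mem_nhds (lt_add_one |b|)))
  obtain ⟨K, hK⟩ := (isCompact_Icc (a := l) (b := r)).exists_bound_of_continuousOn hf.continuousOn
  refine ⟨max K (max (|a| + 1) (|b| + 1)), fun x => ?_⟩
  rcases le_total x l with h | h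
  · exact (hl x h).le.trans ((le_max_left _ _).trans (le_max_right _ _))
  rcases le_total r x with h' | h'
  · exact (hr x h').le.trans ((le_max_right _ _).trans (le_max_right _ _))
  · exact (hK x ⟨h, h'⟩).trans (le_max_left _ _)

/-! ### From eigenfunctions to the integrated system. -/

theorem RankineHugoniot.speed {T s vm um vp up : ℝ} (h : RankineHugoniot T s vm um vp up)
    (hvm : 0 < vm) (hlt : vm < vp) : s ^ 2 * (vm * vp) = T + 1 := by
  obtain ⟨h1, h2⟩ := h
  have hvp : 0 < vp := hvm.trans hlt
  have h3 : (vp - vm) * (s ^ 2 * (vm * vp) - (T + 1)) = 0 := by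
    have h4 : up - um = -s * (vp - vm) := by linarith
    rw [h4] at h2
    field_simp at h2
    linear_combination h2
  rcases mul_eq_zero.1 h3 with h4 | h4 <;> linarith

section Profile

variable {T ν ε s vm um vp up : ℝ} {v u φ : ℝ → ℝ}

theorem IsShockProfile.connects (h : IsShockProfile T ν ε s vm um vp up v u φ) (hT : 0 < T)
    (hν : 0 < ν) (hε : 0 < ε) (hs : 0 < s) (hvm : 0 < vm) (hlt : vm < vp)
    (hRH : RankineHugoniot T s vm um vp up) :
    Connects T ν ε s vm vp v (fun x => deriv v x / v x) (fun x => deriv φ x / v x)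
      (fun x => Real.exp (φ x)) φ := by
  have hP := h.profileSystem hs hν hε
  have hvp : 0 < vp := hvm.trans hlt
  have hφ : ∀ x, HasDerivAt φ (v x * (deriv φ x / v x)) x := fun x => by
    rw [mul_div_cancel₀ _ (h.v_pos x).ne']
    exact (h.smooth_φ.differentiable (by simp) x).hasDerivAt
  obtain ⟨y1, E1⟩ := hP.tendsto shiftStable_atBot hs hν hε hφ h.v_bot hvm h.φ_bot
    (tendsto_exp_of_tendsto_neg_log hvm h.φ_bot)
  obtain ⟨y2, E2⟩ := hP.tendsto shiftStable_atTop hs hν hε hφ h.v_top hvp h.φ_top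
    (tendsto_exp_of_tendsto_neg_log hvp h.φ_top)
  exact ⟨hP, hφ, fun _ => rfl, hT, hν, hε, hs, hvm, hlt, hRH.speed hvm hlt, h.v_bot, h.v_top,
    h.φ_bot, h.φ_top, y1, y2, E1, E2⟩

theorem IsShockProfile.hasDerivAt_field (h : IsShockProfile T ν ε s vm um vp up v u φ) (x : ℝ) :
    HasDerivAt (fun y => deriv φ y / v y ^ 2)
      (deriv (deriv φ) x / v x ^ 2 - 2 * deriv φ x * deriv v x / v x ^ 3) x := by
  have hv0 := (h.v_pos x).ne'
  have dv : HasDerivAt v (deriv v x) x := (h.smooth_v.differentiable (by simp) x).hasDerivAt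
  have sφ' : ContDiff ℝ ∞ (deriv φ) := (contDiff_infty_iff_deriv.1 h.smooth_φ).2
  refine ((sφ'.differentiable (by simp) x).hasDerivAt.fun_div (dv.fun_pow 2)
    (pow_ne_zero 2 hv0)).congr_deriv ?_
  field_simp
  ring

/-- Elimination of the derivatives of the specific volume from the momentum flux by means of the
linearized Poisson equation. -/
theorem IsShockProfile.flux2_eq (h : IsShockProfile T ν ε s vm um vp up v u φ) (hε : 0 < ε)
    {w w' z z' p p' p'' : ℝ → ℂ} {x : ℝ}
    (hp : poissonA ε v φ p p' p'' x = poissonB ε v φ w w' x) :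
    flux2 T ν ε s v u φ w w' z z' p' p'' x =
      ((T + s * ν * v x * (deriv v x / v x)) / v x ^ 2 : ℝ) * w x + (s : ℂ) * z x
      + (ν / v x : ℝ) * z' x - (Real.exp (φ x) : ℝ) * p x
      + (ε ^ 2 * (deriv φ x / v x) : ℝ)
        * ((1 / v x : ℝ) * p' x + (-(deriv φ x / v x ^ 2) : ℝ) * w x) := by
  have hv0 : (v x : ℂ) ≠ 0 := Complex.ofReal_ne_zero.2 (h.v_pos x).ne'
  have hE : deriv (fun y => deriv φ y / v y) x = (v x * Real.exp (φ x) - 1) / ε ^ 2 := by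
    rw [eq_div_iff (by positivity)]
    linarith [h.poisson x]
  have hu : deriv u x = -s * deriv v x := by linarith [h.mass x]
  have hε0 : (ε : ℂ) ≠ 0 := Complex.ofReal_ne_zero.2 hε.ne'
  simp only [poissonA, poissonB] at hp
  simp only [flux2, a21, b21, b22, d21, e21, hE, hu, (h.hasDerivAt_field x).deriv]
  push_cast at hp ⊢
  rw [← sub_eq_zero] at hp ⊢
  -- The Poisson equation divided by `v` contains exactly the terms in `w'` and `p''` of the flux.
  refine Eq.trans ?_ (mul_eq_zero_of_right (1 / (v x : ℂ)) hp)
  field_simp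
  ring

/-- The weak derivative of the electric field perturbation. -/
theorem IsShockProfile.hasWeakDeriv_field (h : IsShockProfile T ν ε s vm um vp up v u φ)
    (hε : 0 < ε) {w w' p p' p'' : ℝ → ℂ} (hw : HasWeakDeriv w w') (hp' : HasWeakDeriv p' p'')
    (hp : ∀ᵐ x ∂(volume : Measure ℝ), poissonA ε v φ p p' p'' x = poissonB ε v φ w w' x) :
    HasWeakDeriv (fun x => (1 / v x : ℝ) * p' x + (-(deriv φ x / v x ^ 2) : ℝ) * w x)
      (fun x => (Real.exp (φ x) / ε ^ 2 : ℝ) * (w x + (v x : ℝ) * p x)) := by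
  have hv0 := fun x => (h.v_pos x).ne'
  have sφ' : ContDiff ℝ ∞ (deriv φ) := (contDiff_infty_iff_deriv.1 h.smooth_φ).2
  have s1 : ContDiff ℝ ∞ fun x => 1 / v x := contDiff_const.div h.smooth_v hv0
  have s2 : ContDiff ℝ ∞ fun x => -(deriv φ x / v x ^ 2) :=
    (sφ'.div (h.smooth_v.pow 2) fun x => pow_ne_zero 2 (hv0 x)).neg
  refine ((hp'.smooth_mul s1).add (hw.smooth_mul s2)).congr (EventuallyEq.refl _ _) ?_
  filter_upwards [hp] with x hx
  have dv : HasDerivAt v (deriv v x) x := (h.smooth_v.differentiable (by simp) x).hasDerivAt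
  have d1 : deriv (fun x => 1 / v x) x = -deriv v x / v x ^ 2 := by
    simpa using ((hasDerivAt_const x (1 : ℝ)).fun_div dv (hv0 x)).deriv
  have d2 := (h.hasDerivAt_field x).fun_neg.deriv
  rw [d1, d2]
  have hv : (v x : ℂ) ≠ 0 := Complex.ofReal_ne_zero.2 (hv0 x)
  have hε0 : (ε : ℂ) ≠ 0 := Complex.ofReal_ne_zero.2 hε.ne'
  simp only [poissonA, poissonB] at hx
  push_cast at hx ⊢
  rw [← sub_eq_zero] at hx ⊢
  refine Eq.trans ?_ (mul_eq_zero_of_right (-1 / (ε : ℂ) ^ 2) hx)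
  field_simp
  ring

/-- An eigenfunction of the linearized operator yields a classical solution of the integrated
eigenvalue system that decays at infinity. -/
theorem IsShockProfile.exists_eigenSystem (h : IsShockProfile T ν ε s vm um vp up v u φ)
    (hC : Connects T ν ε s vm vp v (fun x => deriv v x / v x) (fun x => deriv φ x / v x)
      (fun x => Real.exp (φ x)) φ) {lam : ℂ} (hlam : lam ≠ 0) {U : State}
    (hU : (U, lam • U) ∈ linearizedOp T ν ε s v u φ) :
    ∃ V Υ w z p θ : ℝ → ℂ,
      EigenSystem T ν ε s v (fun x => deriv v x / v x) (fun x => deriv φ x / v x)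
        (fun x => Real.exp (φ x)) lam V Υ w z p θ ∧
      (Tendsto V atBot (𝓝 0) ∧ Tendsto V atTop (𝓝 0)) ∧
      (Tendsto Υ atBot (𝓝 0) ∧ Tendsto Υ atTop (𝓝 0)) ∧
      (Tendsto z atBot (𝓝 0) ∧ Tendsto z atTop (𝓝 0)) ∧
      (Tendsto p atBot (𝓝 0) ∧ Tendsto p atTop (𝓝 0)) ∧
      (Tendsto θ atBot (𝓝 0) ∧ Tendsto θ atTop (𝓝 0)) ∧
      U.1 =ᵐ[volume] w ∧ U.2 =ᵐ[volume] z := by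
  obtain ⟨w', z', z'', p, p', p'', h1, h2, h3, h4, h5, hpois, h7, h8⟩ := hU
  have hs := hC.s_pos
  have hν := hC.ν_pos
  have hε := hC.ε_pos
  have hv0 := fun x => (h.v_pos x).ne'
  have hs0 : (s : ℂ) ≠ 0 := Complex.ofReal_ne_zero.2 hs.ne'
  have cv : Continuous v := h.smooth_v.continuous
  have cv' : Continuous (deriv v) := h.smooth_v.continuous_deriv (by simp)
  have cφ : Continuous φ := h.smooth_φ.continuous
  have cφ' : Continuous (deriv φ) := h.smooth_φ.continuous_deriv (by simp)
  have sm1 : ((lam • U).1 : ℝ → ℂ) =ᵐ[volume] fun x => lam * U.1 x := Lp.coeFn_smul lam U.1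
  have sm2 : ((lam • U).2 : ℝ → ℂ) =ᵐ[volume] fun x => lam * U.2 x := Lp.coeFn_smul lam U.2
  -- weak formulation of the integrated system
  have wV : HasWeakDeriv (fun x => lam⁻¹ * ((s : ℂ) * U.1 x + U.2 x)) U.1 :=
    (h7.const_mul lam⁻¹).congr (EventuallyEq.refl _ _) (by
      filter_upwards [sm1] with x hx
      rw [hx, inv_mul_cancel_left₀ hlam])
  have wΥ := (h8.const_mul lam⁻¹).congr (f' := fun x => lam⁻¹ *
      (((T + s * ν * v x * (deriv v x / v x)) / v x ^ 2 : ℝ) * U.1 x + (s : ℂ) * U.2 x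
      + (ν / v x : ℝ) * z' x - (Real.exp (φ x) : ℝ) * p x
      + (ε ^ 2 * (deriv φ x / v x) : ℝ)
        * ((1 / v x : ℝ) * p' x + (-(deriv φ x / v x ^ 2) : ℝ) * U.1 x))) (g' := U.2)
    (by filter_upwards [hpois] with x hx
        rw [h.flux2_eq hε hx])
    (by filter_upwards [sm2] with x hx
        rw [hx, inv_mul_cancel_left₀ hlam])
  have wθ := h.hasWeakDeriv_field hε h1 h5 hpois
  -- continuous representatives
  obtain ⟨V, cV, eV, dV⟩ := wV.exists_continuous
  obtain ⟨Υ, cΥ, eΥ, dΥ⟩ := wΥ.exists_continuous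
  obtain ⟨z, cz, ez, dz⟩ := h2.exists_continuous
  obtain ⟨P, cP, eP, dP⟩ := h4.exists_continuous
  obtain ⟨θ, cθ, eθ, dθ⟩ := wθ.exists_continuous
  -- Defined by the mass equation, so that this equation holds at every point and `w` is continuous.
  set w : ℝ → ℂ := fun x => (lam * V x - z x) / s with hw
  have cw : Continuous w := by fun_prop
  have ew : U.1 =ᵐ[volume] w := by
    filter_upwards [eV, ez] with x k1 k2
    rw [hw]
    simp only
    rw [← k1, ← k2, mul_inv_cancel_left₀ hlam]
    field_simp
    ring
  have cst : Continuous fun x => (v x / ν : ℝ) * stress T ν ε s (v x) (deriv v x / v x)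
      (deriv φ x / v x) (Real.exp (φ x)) lam (Υ x) (z x) (w x) (P x) (θ x) := by
    unfold stress
    fun_prop (disch := first | exact hv0 | (intro x; exact pow_ne_zero 2 (hv0 x)) | positivity)
  have e_z : z' =ᵐ[volume] fun x => (v x / ν : ℝ) * stress T ν ε s (v x) (deriv v x / v x)
      (deriv φ x / v x) (Real.exp (φ x)) lam (Υ x) (z x) (w x) (P x) (θ x) := by
    filter_upwards [eΥ, ez, ew, eP, eθ] with x k1 k2 k3 k4 k5
    rw [stress, ← k1, ← k2, ← k3, ← k4, ← k5, mul_inv_cancel_left₀ hlam]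
    have hv : (v x : ℂ) ≠ 0 := Complex.ofReal_ne_zero.2 (hv0 x)
    have hν0 : (ν : ℂ) ≠ 0 := Complex.ofReal_ne_zero.2 hν.ne'
    push_cast
    field_simp
    ring
  have c_p : Continuous fun x => (v x : ℝ) * θ x + (deriv φ x / v x : ℝ) * w x := by
    fun_prop (disch := exact hv0)
  have e_p : p' =ᵐ[volume] fun x => (v x : ℝ) * θ x + (deriv φ x / v x : ℝ) * w x := by
    filter_upwards [ew, eθ] with x k1 k2
    rw [← k1, ← k2]
    have hv : (v x : ℂ) ≠ 0 := Complex.ofReal_ne_zero.2 (hv0 x)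
    push_cast
    field_simp
    ring
  have c_θ : Continuous fun x => (Real.exp (φ x) / ε ^ 2 : ℝ) * (w x + (v x : ℝ) * P x) := by
    fun_prop
  have e_θ : (fun x => (Real.exp (φ x) / ε ^ 2 : ℝ) * (U.1 x + (v x : ℝ) * p x))
      =ᵐ[volume] fun x => (Real.exp (φ x) / ε ^ 2 : ℝ) * (w x + (v x : ℝ) * P x) := by
    filter_upwards [ew, eP] with x k1 k2
    rw [← k1, ← k2]
  have DV := dV w cw ew
  have DΥ := dΥ z cz ez
  have Dz := dz _ cst e_z
  have DP := dP _ c_p e_p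
  have Dθ := dθ _ c_θ e_θ
  -- square integrability
  have bdd : ∀ (f : ℝ → ℝ) (a b : ℝ), Continuous f → Tendsto f atBot (𝓝 a) → Tendsto f atTop (𝓝 b) →
      ∀ {g : ℝ → ℂ}, MemLp g 2 volume → MemLp (fun x => (f x : ℂ) * g x) 2 volume := by
    intro f a b hf ha hb g hg
    obtain ⟨K, hK⟩ := exists_abs_le_of_tendsto hf ha hb
    exact memLp_mul_of_bounded hg hf hK
  have nb : Tendsto (fun x => Real.exp (φ x)) atBot (𝓝 (Real.exp (-Real.log vm))) :=
    (Real.continuous_exp.tendsto _).comp h.φ_bot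
  have nt : Tendsto (fun x => Real.exp (φ x)) atTop (𝓝 (Real.exp (-Real.log vp))) :=
    (Real.continuous_exp.tendsto _).comp h.φ_top
  have hvm := hC.m_pos.ne'
  have hvp := (hC.m_pos.trans hC.m_lt).ne'
  have Lw := Lp.memLp U.1
  have Lz := Lp.memLp U.2
  have LV : MemLp V 2 volume := (((Lw.const_mul (s : ℂ)).add Lz).const_mul lam⁻¹).ae_eq eV
  have Lθ₀ : MemLp (fun x => (1 / v x : ℝ) * p' x + (-(deriv φ x / v x ^ 2) : ℝ) * U.1 x) 2
      volume := by
    refine MemLp.add (bdd (fun x => 1 / v x) _ _ (by fun_prop (disch := exact hv0))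
      (tendsto_const_nhds.div h.v_bot hvm) (tendsto_const_nhds.div h.v_top hvp) (Lp.memLp p')) ?_
    have e : (fun x => ((-(deriv φ x / v x ^ 2) : ℝ) : ℂ) * U.1 x)
        = fun x => ((-(deriv φ x / v x / v x) : ℝ) : ℂ) * U.1 x := by
      funext x
      rw [div_div, ← sq]
    rw [e]
    exact bdd (fun x => -(deriv φ x / v x / v x)) _ _ (by fun_prop (disch := exact hv0)) (hC.E_bot.div h.v_bot hvm).neg
      (hC.E_top.div h.v_top hvp).neg Lw
  have Lθ : MemLp θ 2 volume := Lθ₀.ae_eq eθ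
  have LΥ : MemLp Υ 2 volume := by
    refine MemLp.ae_eq eΥ (MemLp.const_mul ?_ _)
    refine MemLp.add (MemLp.sub (MemLp.add (MemLp.add ?_ (Lz.const_mul _)) ?_) ?_) ?_
    · exact bdd (fun x => (T + s * ν * v x * (deriv v x / v x)) / v x ^ 2) _ _ (by
        fun_prop (disch := first | exact hv0 | (intro x; exact pow_ne_zero 2 (hv0 x))))
        ((((h.v_bot.const_mul (s * ν)).mul hC.y_bot).const_add T).div (h.v_bot.pow 2)
          (pow_ne_zero 2 hvm))
        ((((h.v_top.const_mul (s * ν)).mul hC.y_top).const_add T).div (h.v_top.pow 2)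
          (pow_ne_zero 2 hvp)) Lw
    · exact bdd (fun x => ν / v x) _ _ (by fun_prop (disch := exact hv0)) (tendsto_const_nhds.div h.v_bot hvm)
        (tendsto_const_nhds.div h.v_top hvp) (Lp.memLp z')
    · exact bdd _ _ _ (by fun_prop) nb nt (Lp.memLp p)
    · exact bdd _ _ _ (by fun_prop (disch := exact hv0)) (hC.E_bot.const_mul _)
        (hC.E_top.const_mul _) Lθ₀
  have Lvp : MemLp (fun x => U.1 x + (v x : ℂ) * p x) 2 volume :=
    Lw.add (bdd _ _ _ cv h.v_bot h.v_top (Lp.memLp p))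
  have Lθ' : MemLp (fun x => (Real.exp (φ x) / ε ^ 2 : ℝ) * (w x + (v x : ℝ) * P x)) 2 volume :=
    MemLp.ae_eq e_θ (bdd _ _ _ (by fun_prop) (nb.div_const _) (nt.div_const _) Lvp)
  exact ⟨V, Υ, w, z, P, θ,
    ⟨fun x => by rw [hw]; field_simp; ring, DV, DΥ, Dz, DP, Dθ⟩,
    tendsto_zero_of_memLp DV LV (Lw.ae_eq ew), tendsto_zero_of_memLp DΥ LΥ (Lz.ae_eq ez),
    tendsto_zero_of_memLp Dz (Lz.ae_eq ez) ((Lp.memLp z').ae_eq e_z),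
    tendsto_zero_of_memLp DP ((Lp.memLp p).ae_eq eP) ((Lp.memLp p').ae_eq e_p),
    tendsto_zero_of_memLp Dθ Lθ Lθ', ew, ez⟩

end Profile

/-! ### Conclusion for the point spectrum. -/

/-- If `G - lam` is Fredholm of index zero and injective, it is invertible. -/
theorem notMem_pointSpectrum_of_not_isEigenvalue {X : Type*} [NormedAddCommGroup X]
    [NormedSpace ℂ X] {G : Submodule ℂ (X × X)} {lam : ℂ} (h : ¬ IsEigenvalue G lam) :
    lam ∉ pointSpectrum G := by
  rintro ⟨⟨-, -, hfin, hidx⟩, hninv⟩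
  have hbot : eigenspace G lam = ⊥ := by
    rw [Submodule.eq_bot_iff]
    intro U hU
    by_contra hne
    exact h ⟨U, hne, by simpa [eigenspace] using hU⟩
  refine hninv ⟨hbot, ?_⟩
  rw [hbot, finrank_bot] at hidx
  have := Module.finrank_zero_iff.1 hidx.symm
  exact Submodule.Quotient.subsingleton_iff.1 this

end NSP

end

theorem proposition4p1 (T ν ε : ℝ) (hT : 0 < T) (hν : 0 < ν) (hε : 0 < ε)
    (vm um : ℝ) (hvm : 0 < vm) :
    ∃ δ₁ : ℝ, 0 < δ₁ ∧
      ∀ vp up s : ℝ, NSP.RankineHugoniot T s vm um vp up → 0 < s → vm < vp → |vp - vm| < δ₁ →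
        ∀ v u φ : ℝ → ℝ, NSP.IsShockProfile T ν ε s vm um vp up v u φ →
          (∀ lam ∈ NSP.unstableHalfPlane,
            ¬ NSP.IsEigenvalue (NSP.linearizedOp T ν ε s v u φ) lam) ∧
          NSP.pointSpectrum (NSP.linearizedOp T ν ε s v u φ) ⊆ NSP.unstableHalfPlaneᶜ := by
  have hson : (√(T + 1) / vm) ^ 2 * vm ^ 2 = T + 1 := by
    rw [div_pow, Real.sq_sqrt (by positivity)]
    field_simp
  obtain ⟨η₁, hη₁, hstab⟩ := NSP.eigenSystem_trivial hT hν hε hvm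
    (show 0 < √(T + 1) / vm by positivity) hson (2 / vm)
  obtain ⟨η₂, hη₂, hmono⟩ := NSP.Connects.abs_field_le hT hν hε hvm
  -- `near_const` does not bound `E`; requiring `|y| < η₁ vm / 2` makes `|E| ≤ (2/vm) y < η₁`.
  obtain ⟨δ, hδ, hnear⟩ := NSP.Connects.near_const (ε := ε) hT hν hvm
    (show 0 < min (min η₁ η₂) (η₁ * (vm / 2)) by positivity)
  refine ⟨δ, hδ, fun vp up s hRH hs hlt hd v u φ h => ?_⟩
  have hC := h.connects hT hν hε hs hvm hlt hRH
  obtain ⟨hsn, hvn⟩ := hnear s vp v _ _ _ φ hC hd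
  simp only [lt_min_iff] at hsn hvn
  have hm := hmono s vp v _ _ _ φ hC hsn.1.2 fun x => ⟨(hvn x).1.1.2, (hvn x).2.2.1.2⟩
  have hnone : ∀ lam ∈ NSP.unstableHalfPlane,
      ¬ NSP.IsEigenvalue (NSP.linearizedOp T ν ε s v u φ) lam := by
    rintro lam ⟨hre, hlam⟩ ⟨U, hU0, hU⟩
    obtain ⟨V, Υ, w, z, p, θ, hsys, hV, hΥ, hz, hp, hθ, ew, ez⟩ :=
      h.exists_eigenSystem hC (by simpa using hlam) hU
    have hwz := hstab s vm vp v _ _ _ hs hvm (hvm.trans hlt) hC.sys hsn.1.1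
      (fun x => ⟨(hvn x).1.1.1, (hvn x).2.1.1.1, by
        refine (hm x).2.trans_lt ?_
        have h1 := (le_abs_self _).trans_lt (hvn x).2.1.2
        have h2 := mul_lt_mul_of_pos_left h1 (show 0 < 2 / vm by positivity)
        refine h2.trans_eq ?_
        field_simp, (hvn x).2.2.1.1⟩) hm
      hC.v_bot hC.y_bot hC.E_bot (NSP.tendsto_exp_of_tendsto_neg_log hvm hC.φ_bot) hC.v_top hC.y_top hC.E_top
      (NSP.tendsto_exp_of_tendsto_neg_log (hvm.trans hlt) hC.φ_top) lam V Υ w z p θ hre hsys hV.1 hΥ.1 hz.1 hp.1 hθ.1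
      hV.2 hΥ.2 hz.2 hp.2 hθ.2
    refine hU0 (Prod.ext (Lp.ext ?_) (Lp.ext ?_))
    · filter_upwards [ew, Lp.coeFn_zero ℂ 2 (volume : Measure ℝ)] with x k1 k2
      rw [k1, (hwz x).1]
      exact k2.symm
    · filter_upwards [ez, Lp.coeFn_zero ℂ 2 (volume : Measure ℝ)] with x k1 k2
      rw [k1, (hwz x).2]
      exact k2.symm
  exact ⟨hnone, fun lam hsp hmem =>
    NSP.notMem_pointSpectrum_of_not_isEigenvalue (hnone lam hmem) hsp⟩
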